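/- Let $q\ge 1$ be an integer and $p>0$ a real number. Let $a_e$, indexed by the $q$-element subsets $e$ of $\mathbb N$, be i.i.d. real random variables with finite moments $X_k=\mathbb E a_e^k$. For $N\ge p$ let $d^{(N)}_e$, indexed by the $q$-element subsets $e$ of $[N]$, be jointly independent, independent of the family $(a_e)$, equal to $1$ with probability $p/N^{q-1}$ and to $0$ with probability $1-p/N^{q-1}$. Let $A^{(N,p,q)}$ be the real symmetric $N\times N$ matrix with zero diagonal and with entries $A_{ij}=\sum_{e\ni i,j} a_e d^{(N)}_e$ for $i\ne j$ (the sum is over the $q$-element subsets $e$ of $[N]$ containing $i$ and $j$). Let $\lambda_1,\dots,\lambda_N$ be its eigenvalues, and put $$\mathcal M^{(N)}_k=\frac1N\sum_{j=1}^N\lambda_j^k,\qquad M^{(N)}_k=\mathbb E\,\mathcal M^{(N)}_k,\qquad C^{(N)}_{k,m}=\mathbb E\{\mathcal M^{(N)}_k\mathcal M^{(N)}_m\}-M^{(N)}_kM^{(N)}_m .$$ Assume that for some constant $C$ one has $X_{2m}\le (Cm)^{2m}$ for all $m\in\mathbb N$. Define $K^{(\varkappa)}_{j;f}$, for $\varkappa\ge1$,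 $j\in[\varkappa]$ and $f\in\mathbb Z_+^q$, by $K^{(1)}_{1;f}=1$ if $f=0$ and $K^{(1)}_{1;f}=0$ otherwise, and, for $2\le\varkappa\le q$, $$K^{(\varkappa)}_{j;f}=\sum_{\substack{a\in[\varkappa],\ a\ne j\\ f_a\ge1}}K^{(\varkappa)}_{a;f-1_a}+\delta_{j,\varkappa}\sum_{\substack{a\in[\varkappa-1]\\ f_a\ge1}}K^{(\varkappa-1)}_{a;f-1_a},$$ where $1_a$ is the $a$-th unit vector. Define $S(l,r)$, $l,r\ge 0$, by $S(l,0)=\delta_{l,0}$ and, for $r\ge1$, $$S(l,r)=p\sum_{F=1}^{l}X_F\sum_{\varkappa=1}^{q}\ \sum_{\substack{f_1,\dots,f_\varkappa\ge1\\ f_1+\dots+f_\varkappa=F,\ f_1\le r}}\frac{K^{(\varkappa)}_{1;f}}{(q-\varkappa)!}\sum_{\substack{u_1,\dots,u_\varkappa\ge0\\ u_1+\dots+u_\varkappa=l-F}}\binom{r-1}{f_1-1}S(u_1,r-f_1)\prod_{i=2}^{\varkappa}\ \sum_{v=0}^{\lfloor u_i/2\rfloor}\binom{f_i+v-1}{f_i-1}S(u_i,v)$$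 (in $K^{(\varkappa)}_{1;f}$ the vector $f$ is extended by zeros). Put $m_k=\sum_{i=0}^{\lfloor k/2\rfloor}S(k,i)$. Then the following hold. (i) For all $k,m\in\mathbb N$ there is a constant $C(k,m,p,q)$, depending only on $k,m,p,q$ and the law of the weights, such that $|C^{(N)}_{k,m}|\le C(k,m,p,q)/N$ for all $N\ge p$ (the expectations involved being finite). (ii) For all $k\in\mathbb N$ the moments $M^{(N)}_k$ are finite and $\lim_{N\to\infty}M^{(N)}_k=m_k$. (iii) $m_{2k}\ge0$ for all $k$, and the $m_k$ satisfy Carleman's condition $\sum_{k=1}^\infty m_{2k}^{-1/(2k)}=\infty$ (with $1/0=\infty$). -/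

import Mathlib

open MeasureTheory ProbabilityTheory Filter Topology

noncomputable section

namespace SparseHypergraph

/-! ### Weighted adjacency matrix of the random hypergraph -/

/-- The `q`-element subsets of the vertex set `[N]`, realised as `{0, …, N - 1} ⊂ ℕ`. -/
abbrev hyperedges (N q : ℕ) : Finset (Finset ℕ) := (Finset.range N).powersetCard q

/-- The moment `X_k` of the common law `ν` of the weights. -/
def weightMoment (ν : Measure ℝ) (k : ℕ) : ℝ := ∫ x, x ^ k ∂ν

/-- The random data. The weights `a e`, indexed by the `q`-subsets `e` of `ℕ`, are i.i.d. with
law `ν`. For every `N ≥ p` the indicators `d N e`, indexed by the `q`-subsets `e` of `[N]`, are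
jointly independent, equal to `1` with probability `p / N ^ (q - 1)` and to `0` otherwise, and
they are independent of the family of the weights.
(The values of `a` and `d` at other index sets `e` play no role.) -/
structure IsModel {Ω : Type*} [MeasurableSpace Ω] (μ : Measure Ω) (q : ℕ) (p : ℝ)
    (ν : Measure ℝ) (a : Finset ℕ → Ω → ℝ) (d : ℕ → Finset ℕ → Ω → ℝ) : Prop where
  measurable_weight : ∀ e : Finset ℕ, e.card = q → Measurable (a e)
  law_weight : ∀ e : Finset ℕ, e.card = q → μ.map (a e) = ν
  indep_weight : iIndepFun (fun (e : {e : Finset ℕ // e.card = q}) ω => a e ω) μ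
  measurable_ind : ∀ N : ℕ, p ≤ N → ∀ e ∈ hyperedges N q, Measurable (d N e)
  law_ind : ∀ N : ℕ, p ≤ N → ∀ e ∈ hyperedges N q,
    μ.map (d N e) =
      ENNReal.ofReal (p / (N : ℝ) ^ (q - 1)) • Measure.dirac 1
        + ENNReal.ofReal (1 - p / (N : ℝ) ^ (q - 1)) • Measure.dirac 0
  indep_ind : ∀ N : ℕ, p ≤ N →
    iIndepFun (fun (e : {e : Finset ℕ // e ∈ hyperedges N q}) ω => d N e ω) μ
  indep_weight_ind : ∀ N : ℕ, p ≤ N →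
    IndepFun (fun ω (e : {e : Finset ℕ // e.card = q}) => a e ω)
      (fun ω (e : {e : Finset ℕ // e ∈ hyperedges N q}) => d N e ω) μ

/-- The matrix `A^{(N,p,q)}`, for given values of the weights and of the indicators: the entry at
`(i, j)` is the sum of `a_e d_e` over the hyperedges `e` with `i ∈ e`, `j ∈ e`, `i ≠ j`. -/
def adjMatrix (N q : ℕ) (a d : Finset ℕ → ℝ) : Matrix (Fin N) (Fin N) ℝ :=
  Matrix.of fun i j => ∑ e ∈ hyperedges N q,
    if (i : ℕ) ∈ e ∧ (j : ℕ) ∈ e ∧ i ≠ j then a e * d e else 0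

theorem adjMatrix_isHermitian (N q : ℕ) (a d : Finset ℕ → ℝ) :
    (adjMatrix N q a d).IsHermitian := by
  ext i j
  simp only [adjMatrix, Matrix.conjTranspose_apply, Matrix.of_apply, star_trivial]
  refine Finset.sum_congr rfl fun e _ => ?_
  have h : ((j : ℕ) ∈ e ∧ (i : ℕ) ∈ e ∧ j ≠ i) ↔ ((i : ℕ) ∈ e ∧ (j : ℕ) ∈ e ∧ i ≠ j) := by
    constructor <;> rintro ⟨h1, h2, h3⟩ <;> exact ⟨h2, h1, h3.symm⟩
  simp only [h]

/-- The normalized eigenvalue counting measure of a real symmetric `N × N` matrix: it gives mass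
`#{j : λ_j < x} / N` to every half-line `(-∞, x)`. -/
def countingMeasure {N : ℕ} {A : Matrix (Fin N) (Fin N) ℝ} (hA : A.IsHermitian) : Measure ℝ :=
  (N : ENNReal)⁻¹ • ∑ j : Fin N, Measure.dirac (hA.eigenvalues j)

section Random

variable {Ω : Type*}

/-- The random moment `𝓜_t`, the integral of `x ^ t` against the normalized eigenvalue counting
measure of the random matrix. -/
def spectralMoment (q : ℕ) (a : Finset ℕ → Ω → ℝ) (d : ℕ → Finset ℕ → Ω → ℝ) (N t : ℕ)
    (ω : Ω) : ℝ :=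
  ∫ x, x ^ t ∂(countingMeasure
    (adjMatrix_isHermitian N q (fun e => a e ω) (fun e => d N e ω)))

variable [MeasurableSpace Ω]

/-- The expected moment `M_t`. -/
def expectedMoment (μ : Measure Ω) (q : ℕ) (a : Finset ℕ → Ω → ℝ) (d : ℕ → Finset ℕ → Ω → ℝ)
    (N t : ℕ) : ℝ :=
  ∫ ω, spectralMoment q a d N t ω ∂μ

/-- The correlator `C_{t,m}`, i.e. the covariance of `𝓜_t` and `𝓜_m`. -/
def correlator (μ : Measure Ω) (q : ℕ) (a : Finset ℕ → Ω → ℝ) (d : ℕ → Finset ℕ → Ω → ℝ)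
    (N t m : ℕ) : ℝ :=
  (∫ ω, spectralMoment q a d N t ω * spectralMoment q a d N m ω ∂μ)
    - expectedMoment μ q a d N t * expectedMoment μ q a d N m

end Random

/-! ### The recurrences -/

theorem degree_sub_single_lt (f : ℕ →₀ ℕ) (a : ℕ) (h : 1 ≤ f a) :
    (f - Finsupp.single a 1).degree < f.degree := by
  have hle : Finsupp.single a 1 ≤ f := Finsupp.single_le_iff.2 h
  have h1 : (f - Finsupp.single a 1) + Finsupp.single a 1 = f := tsub_add_cancel_of_le hle
  have h2 := congrArg Finsupp.degree h1
  rw [map_add, Finsupp.degree_single] at h2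
  omega

/-- The numbers `K^{(ϰ)}_{j;f}`. The vector `f` is a finitely supported function on `ℕ`, whose
coordinates of interest are `f 1, …, f ϰ`. -/
def walkNumber : (ϰ : ℕ) → (j : ℕ) → (f : ℕ →₀ ℕ) → ℕ
  | 0, _, _ => 0
  | 1, j, f => if j = 1 ∧ f = 0 then 1 else 0
  | ϰ + 2, j, f =>
    (∑ a ∈ Finset.Icc 1 (ϰ + 2),
      if _h : a ≠ j ∧ 1 ≤ f a then walkNumber (ϰ + 2) a (f - Finsupp.single a 1) else 0)
    + if j = ϰ + 2 then
        ∑ a ∈ Finset.Icc 1 (ϰ + 1),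
          if _h : 1 ≤ f a then walkNumber (ϰ + 1) a (f - Finsupp.single a 1) else 0
      else 0
termination_by _ _ f => f.degree
decreasing_by
  · exact degree_sub_single_lt f a _h.2
  · exact degree_sub_single_lt f a _h

/-- The right-hand side of the recurrence for `S (l, r)`, as a functional of the array `S`. -/
def momentStep (q : ℕ) (p : ℝ) (X : ℕ → ℝ) (S : ℕ → ℕ → ℝ) (l r : ℕ) : ℝ :=
  p * ∑ F ∈ Finset.Icc 1 l, X F * ∑ ϰ ∈ Finset.Icc 1 q,
    ∑ f ∈ (Finset.Icc 1 ϰ).finsuppAntidiag F with (∀ i ∈ Finset.Icc 1 ϰ, 1 ≤ f i) ∧ f 1 ≤ r,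
      1 / ((q - ϰ).factorial : ℝ) * (walkNumber ϰ 1 f : ℝ) *
        ∑ u ∈ (Finset.Icc 1 ϰ).finsuppAntidiag (l - F),
          ((r - 1).choose (f 1 - 1) : ℝ) * S (u 1) (r - f 1) *
            ∏ i ∈ Finset.Icc 2 ϰ, ∑ v ∈ Finset.range (u i / 2 + 1),
              ((f i + v - 1).choose (f i - 1) : ℝ) * S (u i) v

/-- The functional `momentStep` at `(l, r)` reads only the rows `u < l` of the array. -/
theorem momentStep_congr (q : ℕ) (p : ℝ) (X : ℕ → ℝ) (S T : ℕ → ℕ → ℝ) (l r : ℕ)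
    (h : ∀ u v, u < l → S u v = T u v) : momentStep q p X S l r = momentStep q p X T l r := by
  unfold momentStep
  refine congrArg (p * ·) (Finset.sum_congr rfl fun F hF => ?_)
  refine congrArg (X F * ·) (Finset.sum_congr rfl fun ϰ hϰ => Finset.sum_congr rfl fun f _ => ?_)
  refine congrArg (_ * ·) (Finset.sum_congr rfl fun u hu => ?_)
  rw [Finset.mem_Icc] at hF hϰ
  have hlt : ∀ i ∈ Finset.Icc 1 ϰ, u i < l := by
    intro i hi
    have h1 := (Finset.mem_finsuppAntidiag.1 hu).1
    have h2 : u i ≤ (Finset.Icc 1 ϰ).sum u :=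
      Finset.single_le_sum (f := fun i => u i) (fun _ _ => Nat.zero_le _) hi
    omega
  rw [h (u 1) (r - f 1) (hlt 1 (Finset.mem_Icc.2 ⟨le_rfl, hϰ.1⟩))]
  refine congrArg (_ * ·) (Finset.prod_congr rfl fun i hi => Finset.sum_congr rfl fun v _ => ?_)
  rw [Finset.mem_Icc] at hi
  exact congrArg (_ * ·) (h (u i) v (hlt i (Finset.mem_Icc.2 ⟨by omega, hi.2⟩)))

/-- The numbers `S (l, r)`: `S (l, 0)` is `1` if `l = 0` and `0` otherwise, and for `r ≥ 1` the
recurrence holds. Only the rows `u < l` of the array enter into `S (l, r)`; see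
`momentArray_eq_momentStep` for the recurrence without the cut-off. -/
def momentArray (q : ℕ) (p : ℝ) (X : ℕ → ℝ) (l r : ℕ) : ℝ :=
  if r = 0 then (if l = 0 then 1 else 0)
  else momentStep q p X (fun u v => if _h : u < l then momentArray q p X u v else 0) l r
termination_by l

theorem momentArray_zero_right (q : ℕ) (p : ℝ) (X : ℕ → ℝ) (l : ℕ) :
    momentArray q p X l 0 = if l = 0 then 1 else 0 := by
  rw [momentArray, if_pos rfl]

theorem momentArray_eq_momentStep (q : ℕ) (p : ℝ) (X : ℕ → ℝ) (l r : ℕ) (hr : 1 ≤ r) :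
    momentArray q p X l r = momentStep q p X (momentArray q p X) l r := by
  rw [momentArray, if_neg (by omega)]
  refine momentStep_congr q p X _ _ l r fun u v h => ?_
  simp only [h, dite_true]

/-- The limiting moments `m_k = ∑_{i = 0}^{⌊k / 2⌋} S (k, i)`. -/
def limitMoment (q : ℕ) (p : ℝ) (X : ℕ → ℝ) (k : ℕ) : ℝ :=
  ∑ i ∈ Finset.range (k / 2 + 1), momentArray q p X k i

end SparseHypergraph

end

/-! The argument is a moment method in which the combinatorics of walks is carried by polynomials.
By `adjMatrix_pow_apply` the trace of the `t`-th power of the matrix is the value of `tracePoly`, a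
sum over closed walks, with one variable for each hyperedge. Since the products of weights and
indicators are independent, expectation becomes the linear functional `momentFun`: a monomial
contributes a factor `c * X F`, with `c = p / N ^ (q - 1)`, for each hyperedge used `F ≥ 1` times.
Everything is then a statement about this functional.

Errors are measured in a weighted ℓ¹ norm `wnorm` that dominates the functional
(`abs_momentFun_le`): an exponent `F ≥ 1` weighs `c * K ^ F * F!`, where `|X F| ≤ K ^ F * F!`, and
degrees above `D` are ignored. The choice of the factorial makes one step of a walk cheap
(`sum_wnorm_mul_edgeVar_le`): a new hyperedge costs `K * c`, and at most `p / c` of them pass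
through a vertex; an old one of exponent `F` costs `K * (F + 1)`, and the exponents add up to at
most `D`. So a step costs `q * K * (2 * D + p + 1)` at most, uniformly in `N`. In the same way, a
walk that must reach a prescribed other vertex `w` along hyperedges not yet used at `w` gains a
factor `1 / N` (`wnorm_step_hit_le`), because at most `N ^ (q - 2)` hyperedges join two given
vertices.

The recurrence comes from the hyperedge `e` of the first step at the root `x`. A closed walk at `x`
starting along `e` is a closed word of `F` steps in the complete graph on `e`, interrupted by
excursions that avoid `e` (`edge_walks_eq`). Excursions between different vertices of `e` cost `1 /
N`, so up to a small error each excursion is closed. The variable of `e` is independent of the rest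
and yields `c * X F`; a marker variable keeps count of the departures from `x`; what remains is a
product of closed walks at distinct vertices with fewer steps in total
(`momentFun_coeff_edgeMain_mul`). There are about `N ^ (q - 1) / (q - 1)!` hyperedges at `x`.
Sorting the words by the order of first visits turns the sum into the numbers `walkNumber`
(`wordSum_eq_sum_walkNumber`, `momentStep_eq_wordSum`), and the binomial coefficients count the ways
to distribute departures over the slots of a word.

To close the induction one treats products over several distinct vertices at once: `factorizesUpTo`
shows, by induction on the total number of steps, that the expectation of such a product is the
product of the limits up to `O(1 / N)`. One vertex gives the limit of the moments. Two vertices give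
the covariance bound, in which the `N` diagonal pairs are merely bounded and the other pairs are
`O(1 / N)`.

For Carleman's condition the cost of a step is used with `D = t`: it gives `|m_t| ≤ (q * K * (2 * t
+ p + 1)) ^ t` (`abs_limitMoment_le`), whose roots grow linearly. The even limits are nonnegative
because the functional is realized by actual random variables (`tracePoly_even_nonneg`). For `q = 1`
the matrix vanishes and all is explicit. -/

noncomputable section

namespace SparseHypergraph

/-! ### Weighted `ℓ¹` norms on polynomials and truncated power series -/

section Norm

variable {ι : Type*}

/-- The weighted `ℓ¹` norm of a polynomial, for a weight on the monomials. -/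
def wnorm (w : (ι →₀ ℕ) → ℝ) (P : MvPolynomial ι ℝ) : ℝ :=
  ∑ m ∈ P.support, |MvPolynomial.coeff m P| * w m

variable {w : (ι →₀ ℕ) → ℝ}

theorem wnorm_eq_sum {P : MvPolynomial ι ℝ} {T : Finset (ι →₀ ℕ)} (h : P.support ⊆ T) :
    wnorm w P = ∑ m ∈ T, |MvPolynomial.coeff m P| * w m := by
  refine Finset.sum_subset h fun m _ hm => ?_
  rw [MvPolynomial.notMem_support_iff.1 hm, abs_zero, zero_mul]

theorem wnorm_nonneg (hw : 0 ≤ w) (P : MvPolynomial ι ℝ) : 0 ≤ wnorm w P :=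
  Finset.sum_nonneg fun m _ => mul_nonneg (abs_nonneg _) (hw m)

@[simp] theorem wnorm_zero : wnorm w 0 = 0 := by simp [wnorm]

theorem wnorm_add_le (hw : 0 ≤ w) (P Q : MvPolynomial ι ℝ) :
    wnorm w (P + Q) ≤ wnorm w P + wnorm w Q := by
  classical
  have hT : (P + Q).support ⊆ P.support ∪ Q.support := MvPolynomial.support_add
  rw [wnorm_eq_sum hT, wnorm_eq_sum (Finset.subset_union_left (s₂ := Q.support)),
    wnorm_eq_sum (Finset.subset_union_right (s₁ := P.support)), ← Finset.sum_add_distrib]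
  refine Finset.sum_le_sum fun m _ => ?_
  rw [MvPolynomial.coeff_add, ← add_mul]
  exact mul_le_mul_of_nonneg_right (abs_add_le _ _) (hw m)

theorem wnorm_neg (P : MvPolynomial ι ℝ) : wnorm w (-P) = wnorm w P := by
  simp [wnorm, MvPolynomial.support_neg]

theorem wnorm_sum_le (hw : 0 ≤ w) {α : Type*} (s : Finset α) (f : α → MvPolynomial ι ℝ) :
    wnorm w (∑ i ∈ s, f i) ≤ ∑ i ∈ s, wnorm w (f i) :=
  Finset.le_sum_of_subadditive _ wnorm_zero.le (wnorm_add_le hw) _ _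

theorem wnorm_monomial (m : ι →₀ ℕ) (a : ℝ) :
    wnorm w (MvPolynomial.monomial m a) = |a| * w m := by
  rw [wnorm_eq_sum (T := {m}) MvPolynomial.support_monomial_subset]
  classical simp [MvPolynomial.coeff_monomial]

theorem wnorm_smul (a : ℝ) (P : MvPolynomial ι ℝ) : wnorm w (a • P) = |a| * wnorm w P := by
  rw [wnorm_eq_sum (T := P.support) MvPolynomial.support_smul, wnorm, Finset.mul_sum]
  refine Finset.sum_congr rfl fun m _ => ?_
  rw [MvPolynomial.coeff_smul, smul_eq_mul, abs_mul, mul_assoc]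

theorem wnorm_C_mul (a : ℝ) (P : MvPolynomial ι ℝ) :
    wnorm w (MvPolynomial.C a * P) = |a| * wnorm w P := by
  rw [← MvPolynomial.smul_eq_C_mul, wnorm_smul]

/-- A multiplication operator is estimated by its values on monomials. -/
theorem sum_wnorm_mul_le (hw : 0 ≤ w) {α : Type*} (s : Finset α) (P : MvPolynomial ι ℝ)
    (Q : α → MvPolynomial ι ℝ) (κ : ℝ)
    (h : ∀ m ∈ P.support, ∑ i ∈ s, wnorm w (MvPolynomial.monomial m 1 * Q i) ≤ κ * w m) :
    ∑ i ∈ s, wnorm w (P * Q i) ≤ κ * wnorm w P := by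
  have h1 : ∀ i, wnorm w (P * Q i) ≤ ∑ m ∈ P.support,
      |MvPolynomial.coeff m P| * wnorm w (MvPolynomial.monomial m 1 * Q i) := by
    intro i
    conv_lhs => rw [← MvPolynomial.support_sum_monomial_coeff P, Finset.sum_mul]
    refine (wnorm_sum_le hw _ _).trans (Finset.sum_le_sum fun m _ => le_of_eq ?_)
    rw [← wnorm_C_mul, ← mul_assoc, MvPolynomial.C_mul_monomial, mul_one]
  calc _ ≤ ∑ i ∈ s, ∑ m ∈ P.support,
        |MvPolynomial.coeff m P| * wnorm w (MvPolynomial.monomial m 1 * Q i) :=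
        Finset.sum_le_sum fun i _ => h1 i
    _ = ∑ m ∈ P.support, |MvPolynomial.coeff m P| *
          ∑ i ∈ s, wnorm w (MvPolynomial.monomial m 1 * Q i) := by
        rw [Finset.sum_comm]; simp only [Finset.mul_sum]
    _ ≤ ∑ m ∈ P.support, |MvPolynomial.coeff m P| * (κ * w m) :=
        Finset.sum_le_sum fun m hm => mul_le_mul_of_nonneg_left (h m hm) (abs_nonneg _)
    _ = κ * wnorm w P := by
        rw [wnorm, Finset.mul_sum]
        exact Finset.sum_congr rfl fun m _ => by ring

theorem wnorm_mul_le (hw : 0 ≤ w) (P Q : MvPolynomial ι ℝ) (κ : ℝ)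
    (h : ∀ m ∈ P.support, wnorm w (MvPolynomial.monomial m 1 * Q) ≤ κ * w m) :
    wnorm w (P * Q) ≤ κ * wnorm w P := by
  simpa using sum_wnorm_mul_le hw {()} P (fun _ => Q) κ (by simpa using h)

/-- Multiplication by `Q` has operator norm at most `κ`. -/
def MulBound (w : (ι →₀ ℕ) → ℝ) (κ : ℝ) (Q : MvPolynomial ι ℝ) : Prop :=
  ∀ P, wnorm w (P * Q) ≤ κ * wnorm w P

theorem MulBound.mono (hw : 0 ≤ w) {κ κ' : ℝ} {Q : MvPolynomial ι ℝ} (h : MulBound w κ Q)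
    (hκ : κ ≤ κ') : MulBound w κ' Q := fun P =>
  (h P).trans (mul_le_mul_of_nonneg_right hκ (wnorm_nonneg hw P))

theorem MulBound.one : MulBound w 1 1 := fun P => by simp

theorem MulBound.zero : MulBound w 0 0 := fun P => by simp

theorem MulBound.mul {κ κ' : ℝ} (h0 : 0 ≤ κ') {Q Q' : MvPolynomial ι ℝ}
    (h : MulBound w κ Q) (h' : MulBound w κ' Q') : MulBound w (κ * κ') (Q * Q') := fun P => by
  rw [← mul_assoc]
  calc _ ≤ κ' * wnorm w (P * Q) := h' _
    _ ≤ κ' * (κ * wnorm w P) := mul_le_mul_of_nonneg_left (h P) h0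
    _ = _ := by ring

theorem MulBound.sum (hw : 0 ≤ w) {α : Type*} (s : Finset α) {κ : α → ℝ}
    {Q : α → MvPolynomial ι ℝ} (h : ∀ i ∈ s, MulBound w (κ i) (Q i)) :
    MulBound w (∑ i ∈ s, κ i) (∑ i ∈ s, Q i) := fun P => by
  rw [Finset.mul_sum, Finset.sum_mul]
  exact (wnorm_sum_le hw _ _).trans (Finset.sum_le_sum fun i hi => h i hi P)

theorem MulBound.C (a : ℝ) : MulBound w |a| (MvPolynomial.C a) := fun P => by
  rw [mul_comm, wnorm_C_mul]

theorem MulBound.prod {α : Type*} (s : Finset α) {κ : ℝ} (h0 : 0 ≤ κ)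
    {Q : α → MvPolynomial ι ℝ} (h : ∀ i ∈ s, MulBound w κ (Q i)) :
    MulBound w (κ ^ s.card) (∏ i ∈ s, Q i) := by
  classical
  induction s using Finset.induction_on with
  | empty => simpa using MulBound.one
  | insert a s ha ih =>
    rw [Finset.prod_insert ha, Finset.card_insert_of_notMem ha, pow_succ']
    exact (h a (Finset.mem_insert_self _ _)).mul (pow_nonneg h0 _)
      (ih fun i hi => h i (Finset.mem_insert_of_mem hi))

/-- A difference of products is small if the differences of the factors are small. -/
theorem wnorm_mul_prod_sub_prod_le (hw : 0 ≤ w) {α : Type*} (s : Finset α) {κ ε : ℝ}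
    (hκ : 1 ≤ κ) (P : MvPolynomial ι ℝ)
    {Q Q' : α → MvPolynomial ι ℝ} (h : ∀ i ∈ s, MulBound w κ (Q i))
    (h' : ∀ i ∈ s, MulBound w κ (Q' i)) (hε : ∀ i ∈ s, wnorm w (P * (Q i - Q' i)) ≤ ε) :
    wnorm w (P * (∏ i ∈ s, Q i - ∏ i ∈ s, Q' i)) ≤ s.card * κ ^ s.card * ε := by
  classical
  have hκ0 : 0 ≤ κ := zero_le_one.trans hκ
  induction s using Finset.induction_on with
  | empty => simp
  | insert a s ha ih =>
    have ha' := Finset.mem_insert_self a s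
    have hε0 : 0 ≤ ε := (wnorm_nonneg hw _).trans (hε a ha')
    have ih' := ih (fun i hi => h i (Finset.mem_insert_of_mem hi))
      (fun i hi => h' i (Finset.mem_insert_of_mem hi))
      (fun i hi => hε i (Finset.mem_insert_of_mem hi))
    rw [Finset.prod_insert ha, Finset.prod_insert ha, Finset.card_insert_of_notMem ha]
    have e : P * (Q a * ∏ i ∈ s, Q i - Q' a * ∏ i ∈ s, Q' i)
        = P * (Q a - Q' a) * ∏ i ∈ s, Q i + P * (∏ i ∈ s, Q i - ∏ i ∈ s, Q' i) * Q' a := by ring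
    rw [e]
    have b1 := (MulBound.prod s hκ0 fun i hi => h i (Finset.mem_insert_of_mem hi))
      (P * (Q a - Q' a))
    have b2 := h' a ha' (P * (∏ i ∈ s, Q i - ∏ i ∈ s, Q' i))
    have b3 : κ ^ s.card ≤ κ ^ (s.card + 1) := pow_le_pow_right₀ hκ (Nat.le_succ _)
    have b4 : 0 ≤ κ ^ s.card := pow_nonneg hκ0 _
    calc _ ≤ _ := wnorm_add_le hw _ _
      _ ≤ κ ^ s.card * ε + κ * (s.card * κ ^ s.card * ε) :=
          add_le_add (b1.trans (mul_le_mul_of_nonneg_left (hε a ha') b4))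
            (b2.trans (mul_le_mul_of_nonneg_left ih' hκ0))
      _ ≤ κ ^ (s.card + 1) * ε + κ * (s.card * κ ^ s.card * ε) := by gcongr
      _ = _ := by push_cast; ring

/-! #### Power series -/

/-- The sum of the norms of the coefficients up to degree `D`. -/
def snorm (w : (ι →₀ ℕ) → ℝ) (D : ℕ) (F : PowerSeries (MvPolynomial ι ℝ)) : ℝ :=
  ∑ k ∈ Finset.range (D + 1), wnorm w (PowerSeries.coeff k F)

variable {D : ℕ}

theorem snorm_nonneg (hw : 0 ≤ w) (F : PowerSeries (MvPolynomial ι ℝ)) : 0 ≤ snorm w D F :=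
  Finset.sum_nonneg fun _ _ => wnorm_nonneg hw _

@[simp] theorem snorm_zero : snorm w D 0 = 0 := by simp [snorm]

theorem snorm_neg (F : PowerSeries (MvPolynomial ι ℝ)) : snorm w D (-F) = snorm w D F := by
  simp [snorm, wnorm_neg]

theorem snorm_add_le (hw : 0 ≤ w) (F G : PowerSeries (MvPolynomial ι ℝ)) :
    snorm w D (F + G) ≤ snorm w D F + snorm w D G := by
  rw [snorm, snorm, snorm, ← Finset.sum_add_distrib]
  exact Finset.sum_le_sum fun k _ => by rw [map_add]; exact wnorm_add_le hw _ _

theorem snorm_sum_le (hw : 0 ≤ w) {α : Type*} (s : Finset α)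
    (f : α → PowerSeries (MvPolynomial ι ℝ)) :
    snorm w D (∑ i ∈ s, f i) ≤ ∑ i ∈ s, snorm w D (f i) :=
  Finset.le_sum_of_subadditive _ snorm_zero.le (snorm_add_le hw) _ _

theorem wnorm_coeff_le (hw : 0 ≤ w) (F : PowerSeries (MvPolynomial ι ℝ)) {k : ℕ} (hk : k ≤ D) :
    wnorm w (PowerSeries.coeff k F) ≤ snorm w D F :=
  Finset.single_le_sum (f := fun k => wnorm w (PowerSeries.coeff k F))
    (fun _ _ => wnorm_nonneg hw _) (Finset.mem_range.2 (Nat.lt_succ_of_le hk))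

theorem snorm_C (P : MvPolynomial ι ℝ) : snorm w D (PowerSeries.C P) = wnorm w P := by
  rw [snorm, Finset.sum_eq_single 0]
  · simp
  · intro k _ hk; simp [PowerSeries.coeff_C, hk]
  · simp

/-- In the Cauchy product truncated at `D` the pairs of degrees with sum at most `D` form a subset
of the full square, so enlarging the range only adds nonnegative terms. This reduces operator bounds
to constant series on the left. -/
theorem snorm_mul_le_sum (hw : 0 ≤ w) (F G : PowerSeries (MvPolynomial ι ℝ)) :
    snorm w D (F * G) ≤ ∑ k ∈ Finset.range (D + 1),
      snorm w D (PowerSeries.C (PowerSeries.coeff k F) * G) := by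
  have h1 : snorm w D (F * G) ≤ ∑ n ∈ Finset.range (D + 1), ∑ k ∈ Finset.range (n + 1),
      wnorm w (PowerSeries.coeff k F * PowerSeries.coeff (n - k) G) := by
    refine Finset.sum_le_sum fun n _ => ?_
    rw [PowerSeries.coeff_mul, Finset.Nat.sum_antidiagonal_eq_sum_range_succ_mk]
    exact wnorm_sum_le hw _ _
  refine h1.trans ?_
  simp only [snorm, PowerSeries.coeff_C_mul]
  have h2 : ∀ n ∈ Finset.range (D + 1), ∑ k ∈ Finset.range (n + 1),
      wnorm w (PowerSeries.coeff k F * PowerSeries.coeff (n - k) G)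
      = ∑ k ∈ Finset.range (D + 1), if k ≤ n then
          wnorm w (PowerSeries.coeff k F * PowerSeries.coeff (n - k) G) else 0 := by
    intro n hn
    rw [← Finset.sum_filter]
    refine Finset.sum_congr ?_ fun _ _ => rfl
    ext k; simp only [Finset.mem_range, Finset.mem_filter] at hn ⊢; omega
  rw [Finset.sum_congr rfl h2, Finset.sum_comm]
  refine Finset.sum_le_sum fun k _ => ?_
  rw [← Finset.sum_filter]
  have h3 : ∑ n ∈ Finset.range (D + 1) with k ≤ n,
      wnorm w (PowerSeries.coeff k F * PowerSeries.coeff (n - k) G)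
      = ∑ j ∈ ((Finset.range (D + 1)).filter (k ≤ ·)).image (· - k),
      wnorm w (PowerSeries.coeff k F * PowerSeries.coeff j G) := by
    rw [Finset.sum_image]
    intro a ha b hb hab
    simp only [Finset.mem_coe, Finset.mem_filter] at ha hb hab
    omega
  rw [h3]
  refine Finset.sum_le_sum_of_subset_of_nonneg ?_ fun _ _ _ => wnorm_nonneg hw _
  intro j hj
  simp only [Finset.mem_image, Finset.mem_filter, Finset.mem_range] at hj ⊢
  omega

/-- Multiplication by the power series `G` has operator norm at most `κ`. -/
def SeriesBound (w : (ι →₀ ℕ) → ℝ) (D : ℕ) (κ : ℝ) (G : PowerSeries (MvPolynomial ι ℝ)) : Prop :=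
  ∀ F, snorm w D (F * G) ≤ κ * snorm w D F

theorem SeriesBound.of_C (hw : 0 ≤ w) {κ : ℝ} {G : PowerSeries (MvPolynomial ι ℝ)}
    (h : ∀ P, snorm w D (PowerSeries.C P * G) ≤ κ * wnorm w P) : SeriesBound w D κ G := fun F => by
  refine (snorm_mul_le_sum hw F G).trans ?_
  rw [snorm, Finset.mul_sum]
  exact Finset.sum_le_sum fun k _ => h _

theorem SeriesBound.mono (hw : 0 ≤ w) {κ κ' : ℝ} {G : PowerSeries (MvPolynomial ι ℝ)}
    (h : SeriesBound w D κ G) (hκ : κ ≤ κ') : SeriesBound w D κ' G := fun F =>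
  (h F).trans (mul_le_mul_of_nonneg_right hκ (snorm_nonneg hw F))

theorem SeriesBound.one : SeriesBound w D 1 1 := fun P => by simp

theorem SeriesBound.zero {κ : ℝ} (hw : 0 ≤ w) (hκ : 0 ≤ κ) : SeriesBound w D κ 0 := fun P => by
  simpa using mul_nonneg hκ (snorm_nonneg hw P)

theorem SeriesBound.neg {κ : ℝ} {G : PowerSeries (MvPolynomial ι ℝ)}
    (h : SeriesBound w D κ G) : SeriesBound w D κ (-G) := fun F => by
  rw [mul_neg, snorm_neg]; exact h F

theorem SeriesBound.mul {κ κ' : ℝ} (h0 : 0 ≤ κ') {G G' : PowerSeries (MvPolynomial ι ℝ)}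
    (h : SeriesBound w D κ G) (h' : SeriesBound w D κ' G') :
    SeriesBound w D (κ * κ') (G * G') := fun F => by
  rw [← mul_assoc]
  calc _ ≤ κ' * snorm w D (F * G) := h' _
    _ ≤ κ' * (κ * snorm w D F) := mul_le_mul_of_nonneg_left (h F) h0
    _ = _ := by ring

theorem SeriesBound.pow {κ : ℝ} (h0 : 0 ≤ κ) {G : PowerSeries (MvPolynomial ι ℝ)}
    (h : SeriesBound w D κ G) (n : ℕ) : SeriesBound w D (κ ^ n) (G ^ n) := by
  induction n with
  | zero => simpa using SeriesBound.one
  | succ n ih => rw [pow_succ, pow_succ]; exact ih.mul h0 h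

theorem SeriesBound.add (hw : 0 ≤ w) {κ κ' : ℝ} {G G' : PowerSeries (MvPolynomial ι ℝ)}
    (h : SeriesBound w D κ G) (h' : SeriesBound w D κ' G') :
    SeriesBound w D (κ + κ') (G + G') := fun F => by
  rw [mul_add, add_mul]
  exact (snorm_add_le hw _ _).trans (add_le_add (h F) (h' F))

theorem SeriesBound.sum (hw : 0 ≤ w) {α : Type*} (s : Finset α) {κ : α → ℝ}
    {G : α → PowerSeries (MvPolynomial ι ℝ)} (h : ∀ i ∈ s, SeriesBound w D (κ i) (G i)) :
    SeriesBound w D (∑ i ∈ s, κ i) (∑ i ∈ s, G i) := fun F => by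
  rw [Finset.mul_sum, Finset.sum_mul]
  exact (snorm_sum_le hw _ _).trans (Finset.sum_le_sum fun i hi => h i hi F)

theorem SeriesBound.C (hw : 0 ≤ w) {κ : ℝ} {Q : MvPolynomial ι ℝ} (h : MulBound w κ Q) :
    SeriesBound w D κ (PowerSeries.C Q) :=
  .of_C hw fun P => by rw [← map_mul, snorm_C]; exact h P

theorem SeriesBound.X (hw : 0 ≤ w) :
    SeriesBound w D 1 (PowerSeries.X : PowerSeries (MvPolynomial ι ℝ)) :=
  .of_C hw fun P => by
    rw [one_mul, snorm, Finset.sum_range_succ']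
    simp only [PowerSeries.coeff_succ_mul_X, PowerSeries.coeff_zero_mul_X, wnorm_zero, add_zero]
    rw [← snorm_C (D := D) P, snorm, Finset.sum_range_succ]
    exact le_add_of_nonneg_right (wnorm_nonneg hw _)

theorem SeriesBound.coeff (hw : 0 ≤ w) {κ : ℝ} {G : PowerSeries (MvPolynomial ι ℝ)}
    (h : SeriesBound w D κ G) {l : ℕ} (hl : l ≤ D) :
    MulBound w κ (PowerSeries.coeff l G) := fun P => by
  have h1 := h (PowerSeries.C P)
  rw [snorm_C] at h1
  refine le_trans ?_ h1
  rw [← PowerSeries.coeff_C_mul]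
  exact wnorm_coeff_le hw _ hl

theorem SeriesBound.of_coeff (hw : 0 ≤ w) {κ : ℝ} {G : PowerSeries (MvPolynomial ι ℝ)}
    (h : ∀ l ≤ D, MulBound w κ (PowerSeries.coeff l G)) :
    SeriesBound w D ((D + 1) * κ) G :=
  .of_C hw fun P => by
    rw [snorm]
    calc _ ≤ ∑ k ∈ Finset.range (D + 1), κ * wnorm w P := by
          refine Finset.sum_le_sum fun k hk => ?_
          rw [PowerSeries.coeff_C_mul]
          exact h k (Nat.lt_succ_iff.1 (Finset.mem_range.1 hk)) P
      _ = _ := by simp; ring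

/-- A difference of powers is small if the difference of the bases is small. -/
theorem snorm_mul_pow_sub_pow_le (hw : 0 ≤ w) {κ ε : ℝ} (hκ : 1 ≤ κ)
    (F : PowerSeries (MvPolynomial ι ℝ)) {G G' : PowerSeries (MvPolynomial ι ℝ)}
    (h : SeriesBound w D κ G) (h' : SeriesBound w D κ G')
    (hε : snorm w D (F * (G - G')) ≤ ε) (n : ℕ) :
    snorm w D (F * (G ^ n - G' ^ n)) ≤ n * κ ^ n * ε := by
  have hκ0 : 0 ≤ κ := zero_le_one.trans hκ
  have hε0 : 0 ≤ ε := (snorm_nonneg hw _).trans hε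
  induction n with
  | zero => simp
  | succ n ih =>
    have e : F * (G ^ (n + 1) - G' ^ (n + 1))
        = F * (G - G') * G ^ n + F * (G ^ n - G' ^ n) * G' := by ring
    rw [e]
    have b3 : κ ^ n ≤ κ ^ (n + 1) := pow_le_pow_right₀ hκ (Nat.le_succ _)
    have b4 : 0 ≤ κ ^ n := pow_nonneg hκ0 _
    calc _ ≤ _ := snorm_add_le hw _ _
      _ ≤ κ ^ n * ε + κ * (n * κ ^ n * ε) :=
          add_le_add ((h.pow hκ0 n _).trans (mul_le_mul_of_nonneg_left hε b4))
            ((h' _).trans (mul_le_mul_of_nonneg_left ih hκ0))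
      _ ≤ κ ^ (n + 1) * ε + κ * (n * κ ^ n * ε) := by gcongr
      _ = _ := by push_cast; ring

end Norm

end SparseHypergraph

end

noncomputable section

namespace SparseHypergraph

/-! ### Generating functions of walks on a weighted hypergraph -/

section Walks

variable {R : Type*} [CommRing R]

/-- The weighted number of walks of length `l` from `i` to `j` along the hyperedges of `H`: a step
from `z` along `e` has weight `σ z * b e`. -/
def walkPoly (σ : ℕ → R) (b : Finset ℕ → R) (H : Finset (Finset ℕ)) (j : ℕ) : ℕ → ℕ → R
  | 0, i => if i = j then 1 else 0
  | l + 1, i => σ i * ∑ e ∈ H with i ∈ e, b e * ∑ k ∈ e.erase i, walkPoly σ b H j l k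

/-- The generating function of the walks from `i` to `j`. -/
def walkSeries (σ : ℕ → R) (b : Finset ℕ → R) (H : Finset (Finset ℕ)) (i j : ℕ) : PowerSeries R :=
  PowerSeries.mk fun l => walkPoly σ b H j l i

/-- The sum of a function over the endpoints of all steps from `i`. -/
def stepSum (b : Finset ℕ → R) (H : Finset (Finset ℕ)) (g : ℕ → PowerSeries R) (i : ℕ) :
    PowerSeries R :=
  PowerSeries.X * ∑ e ∈ H with i ∈ e, PowerSeries.C (b e) * ∑ k ∈ e.erase i, g k

/-- The generating function of the nontrivial walks from `i` to `j`, without the factor of the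
first vertex. -/
def stepSeries (σ : ℕ → R) (b : Finset ℕ → R) (H : Finset (Finset ℕ)) (i j : ℕ) : PowerSeries R :=
  stepSum b H (fun k => walkSeries σ b H k j) i

variable (σ : ℕ → R) (b : Finset ℕ → R) (H : Finset (Finset ℕ))

theorem stepSum_add (g g' : ℕ → PowerSeries R) (i : ℕ) :
    stepSum b H (fun k => g k + g' k) i = stepSum b H g i + stepSum b H g' i := by
  simp only [stepSum, Finset.sum_add_distrib, mul_add]

theorem stepSum_sub (g g' : ℕ → PowerSeries R) (i : ℕ) :
    stepSum b H (fun k => g k - g' k) i = stepSum b H g i - stepSum b H g' i := by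
  simp only [stepSum, Finset.sum_sub_distrib, mul_sub]

theorem stepSum_mul (g : ℕ → PowerSeries R) (c : PowerSeries R) (i : ℕ) :
    stepSum b H (fun k => g k * c) i = stepSum b H g i * c := by
  simp only [stepSum, ← Finset.sum_mul, ← mul_assoc]

theorem stepSum_sum {α : Type*} (s : Finset α) (g : α → ℕ → PowerSeries R) (i : ℕ) :
    stepSum b H (fun k => ∑ z ∈ s, g z k) i = ∑ z ∈ s, stepSum b H (g z) i := by
  classical
  induction s using Finset.induction_on with
  | empty => simp [stepSum]
  | insert a s ha ih => simp only [Finset.sum_insert ha, stepSum_add, ih]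

variable {b H} in
theorem stepSum_eq_erase {e : Finset ℕ} (he : e ∈ H) (g : ℕ → PowerSeries R) (i : ℕ) :
    stepSum b H g i = stepSum b (H.erase e) g i
      + if i ∈ e then PowerSeries.X * PowerSeries.C (b e) * ∑ k ∈ e.erase i, g k else 0 := by
  rw [stepSum, stepSum, Finset.sum_filter, Finset.sum_filter, ← Finset.sum_erase_add _ _ he, mul_add]
  congr 1
  split_ifs with h
  · ring
  · simp

theorem coeff_zero_stepSum (g : ℕ → PowerSeries R) (i : ℕ) :
    PowerSeries.coeff 0 (stepSum b H g i) = 0 := by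
  simp [stepSum]

theorem coeff_succ_stepSum (g : ℕ → PowerSeries R) (i l : ℕ) :
    PowerSeries.coeff (l + 1) (stepSum b H g i)
      = ∑ e ∈ H with i ∈ e, b e * ∑ k ∈ e.erase i, PowerSeries.coeff l (g k) := by
  simp only [stepSum, PowerSeries.coeff_succ_X_mul, map_sum, PowerSeries.coeff_C_mul]

theorem coeff_walkSeries (i j l : ℕ) :
    PowerSeries.coeff l (walkSeries σ b H i j) = walkPoly σ b H j l i := by
  simp [walkSeries]

theorem walkSeries_eq (i j : ℕ) :
    walkSeries σ b H i j
      = (if i = j then 1 else 0) + PowerSeries.C (σ i) * stepSeries σ b H i j := by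
  ext l
  rw [coeff_walkSeries, map_add, PowerSeries.coeff_C_mul]
  cases l with
  | zero =>
    rw [stepSeries, coeff_zero_stepSum, mul_zero, add_zero, walkPoly]
    split_ifs <;> simp
  | succ l =>
    rw [stepSeries, coeff_succ_stepSum, walkPoly]
    have : PowerSeries.coeff (l + 1) (if i = j then 1 else 0 : PowerSeries R) = 0 := by
      split_ifs <;> simp [PowerSeries.coeff_one]
    rw [this, zero_add]
    simp only [coeff_walkSeries]

/-- A step raises the degree by one, so the homogeneous first-step equation forces the coefficients
to vanish one degree after another. -/
theorem eq_zero_of_stepSum {Δ : ℕ → PowerSeries R}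
    (h : ∀ i, Δ i = PowerSeries.C (σ i) * stepSum b H Δ i) (i : ℕ) : Δ i = 0 := by
  have key : ∀ l i, PowerSeries.coeff l (Δ i) = 0 := by
    intro l
    induction l with
    | zero =>
      intro i
      rw [h i, PowerSeries.coeff_C_mul, coeff_zero_stepSum, mul_zero]
    | succ l ih =>
      intro i
      rw [h i, PowerSeries.coeff_C_mul, coeff_succ_stepSum]
      simp [ih]
  ext l
  rw [key, map_zero]

/-- The uniqueness principle behind the decompositions of walks: two families agree once they solve
the same first-step equation with the same source `f`. It replaces bijections between sets of walks.
-/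
theorem eq_of_stepSum {g g' f : ℕ → PowerSeries R}
    (h : ∀ i, g i = f i + PowerSeries.C (σ i) * stepSum b H g i)
    (h' : ∀ i, g' i = f i + PowerSeries.C (σ i) * stepSum b H g' i) (i : ℕ) : g i = g' i := by
  refine sub_eq_zero.1 (eq_zero_of_stepSum σ b H (Δ := fun k => g k - g' k) (fun i => ?_) i)
  rw [stepSum_sub, h i, h' i]
  ring

/-- Decomposition of the walks at their first step along the hyperedge `e`. -/
theorem walkSeries_eq_erase {e : Finset ℕ} (he : e ∈ H) (i j : ℕ) :
    walkSeries σ b H i j = walkSeries σ b (H.erase e) i j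
      + ∑ z ∈ e, walkSeries σ b (H.erase e) i z * (PowerSeries.C (σ z) *
          (PowerSeries.X * PowerSeries.C (b e)) * ∑ w ∈ e.erase z, walkSeries σ b H w j) := by
  let V : ℕ → PowerSeries R := fun z => PowerSeries.C (σ z) *
          (PowerSeries.X * PowerSeries.C (b e)) * ∑ w ∈ e.erase z, walkSeries σ b H w j
  -- Both sides are solutions of the first-step equation on `H.erase e`; the steps along `e` appear
  -- as a source `V` at the vertices of `e`.
  refine eq_of_stepSum σ b (H.erase e)
    (g := fun i => walkSeries σ b H i j)
    (g' := fun i => walkSeries σ b (H.erase e) i j + ∑ z ∈ e, walkSeries σ b (H.erase e) i z * V z)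
    (f := fun i => (if i = j then 1 else 0) + if i ∈ e then V i else 0) (fun i => ?_) (fun i => ?_) i
  · rw [walkSeries_eq, stepSeries, stepSum_eq_erase he, mul_add, add_assoc, add_comm (_ * _) (_ * _)]
    congr 2
    split_ifs
    · simp only [V]; ring
    · simp
  · rw [stepSum_add, stepSum_sum, walkSeries_eq]
    simp only [stepSum_mul]
    have h : ∀ z ∈ e, walkSeries σ b (H.erase e) i z * V z = (if i = z then V z else 0)
        + PowerSeries.C (σ i) * (stepSum b (H.erase e)
            (fun k => walkSeries σ b (H.erase e) k z) i * V z) := by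
      intro z _
      rw [walkSeries_eq, stepSeries]
      split_ifs <;> ring
    rw [Finset.sum_congr rfl h, Finset.sum_add_distrib, Finset.sum_ite_eq, mul_add, Finset.mul_sum,
      stepSeries]
    ring

theorem stepSeries_eq_erase {e : Finset ℕ} (he : e ∈ H) (i j : ℕ) :
    stepSeries σ b H i j = stepSeries σ b (H.erase e) i j
      + (∑ z ∈ e, stepSeries σ b (H.erase e) i z * (PowerSeries.C (σ z) *
          (PowerSeries.X * PowerSeries.C (b e)) * ∑ w ∈ e.erase z, walkSeries σ b H w j))
      + if i ∈ e then PowerSeries.X * PowerSeries.C (b e) *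
          ∑ k ∈ e.erase i, walkSeries σ b H k j else 0 := by
  rw [stepSeries, stepSum_eq_erase he]
  congr 1
  have h : (fun k => walkSeries σ b H k j) = fun k => walkSeries σ b (H.erase e) k j
      + ∑ z ∈ e, walkSeries σ b (H.erase e) k z * (PowerSeries.C (σ z) *
          (PowerSeries.X * PowerSeries.C (b e)) * ∑ w ∈ e.erase z, walkSeries σ b H w j) :=
    funext fun k => walkSeries_eq_erase σ b H he k j
  rw [congrArg (fun g => stepSum b (H.erase e) g i) h, stepSum_add, stepSum_sum]
  simp only [stepSum_mul]
  rfl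

/-- The effect of a change of the vertex weight at `x`. -/
theorem walkSeries_update (σ' : ℕ → R) (x : ℕ) (hσ : ∀ i, i ≠ x → σ i = σ' i) (i j : ℕ) :
    walkSeries σ b H i j = walkSeries σ' b H i j
      + walkSeries σ' b H i x * (PowerSeries.C (σ x - σ' x) * stepSeries σ b H x j) := by
  let V : PowerSeries R := PowerSeries.C (σ x - σ' x) * stepSeries σ b H x j
  refine eq_of_stepSum σ' b H (g := fun i => walkSeries σ b H i j)
    (g' := fun i => walkSeries σ' b H i j + walkSeries σ' b H i x * V)
    (f := fun i => (if i = j then 1 else 0) + if i = x then V else 0) (fun i => ?_) (fun i => ?_) i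
  · rw [walkSeries_eq, add_assoc]
    congr 1
    by_cases h : i = x
    · subst h
      simp only [if_true, V, map_sub, stepSeries]
      ring
    · rw [if_neg h, zero_add, hσ i h, stepSeries]
  · rw [stepSum_add, stepSum_mul, walkSeries_eq, walkSeries_eq σ' b H i x]
    simp only [stepSeries]
    split_ifs <;> ring

/-- The generating function of the first returns to `x`. -/
def returnSeries (b : Finset ℕ → R) (H : Finset (Finset ℕ)) (x : ℕ) : PowerSeries R :=
  stepSeries (Function.update 1 x 0) b H x x

/-- A closed walk is empty or a first return followed by a closed walk, and each departure from `x`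
carries one factor `s`. Thus the closed walks form the geometric series of `s` times `returnSeries`.
-/
theorem walkSeries_update_self (x : ℕ) (s : R) :
    walkSeries (Function.update 1 x s) b H x x
      = 1 + PowerSeries.C s * returnSeries b H x * walkSeries (Function.update 1 x s) b H x x := by
  set σ : ℕ → R := Function.update 1 x s
  set σ' : ℕ → R := Function.update 1 x 0
  have hσx : σ x = s := Function.update_self ..
  have hσx' : σ' x = 0 := Function.update_self ..
  have h0 : walkSeries σ b H x x = 1 + PowerSeries.C s * stepSeries σ b H x x := by
    rw [walkSeries_eq, if_pos rfl, hσx]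
  -- The weight `0` at `x` stops a walk at its first arrival there; the rest is a closed walk at
  -- `x`.
  have h1 : ∀ k, walkSeries σ b H k x = walkSeries σ' b H k x * walkSeries σ b H x x := by
    intro k
    rw [walkSeries_update σ b H σ' x
      (fun i hi => by simp only [σ, σ', Function.update_of_ne hi]) k x, h0, hσx, hσx', sub_zero]
    ring
  have h2 : stepSeries σ b H x x = returnSeries b H x * walkSeries σ b H x x := by
    rw [stepSeries, funext h1, stepSum_mul]; rfl
  conv_lhs => rw [h0, h2]
  ring

/-- A step never stays in place, so a return takes at least two steps. Hence `l` steps allow at most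
`l / 2` returns, the source of all cut-offs by `l / 2`. -/
theorem X_sq_dvd_returnSeries (x : ℕ) : PowerSeries.X ^ 2 ∣ returnSeries b H x := by
  rw [PowerSeries.X_pow_dvd_iff]
  intro m hm
  interval_cases m
  · exact coeff_zero_stepSum b H _ x
  · rw [returnSeries, stepSeries, coeff_succ_stepSum]
    refine Finset.sum_eq_zero fun e _ => ?_
    rw [Finset.sum_eq_zero, mul_zero]
    intro k hk
    rw [coeff_walkSeries, walkPoly, if_neg (Finset.ne_of_mem_erase hk)]

/-- The weighted number of closed walks from `x` of length `l` that depart from `x` exactly `r`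
times. -/
def closedWalk (b : Finset ℕ → R) (H : Finset (Finset ℕ)) (x l r : ℕ) : R :=
  PowerSeries.coeff l (returnSeries b H x ^ r)

theorem closedWalk_eq_zero (x : ℕ) {l r : ℕ} (h : l < 2 * r) : closedWalk b H x l r = 0 := by
  have h1 : PowerSeries.X ^ (2 * r) ∣ returnSeries b H x ^ r := by
    rw [pow_mul]; exact pow_dvd_pow_of_dvd (X_sq_dvd_returnSeries b H x) r
  exact PowerSeries.X_pow_dvd_iff.1 h1 l h

theorem closedWalk_zero_left (x r : ℕ) : closedWalk b H x 0 r = if r = 0 then 1 else 0 := by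
  split_ifs with h
  · subst h; simp [closedWalk]
  · exact closedWalk_eq_zero b H x (by omega)

theorem closedWalk_zero_right (x l : ℕ) : closedWalk b H x l 0 = if l = 0 then 1 else 0 := by
  simp [closedWalk, PowerSeries.coeff_one]

/-- This is the negative binomial expansion of `(1 - A)⁻¹ ^ f`, with `G` in the role of the inverse.
Divisibility of the remainder by a power of `A` expresses it without convergence. -/
theorem dvd_pow_sub_sum_multichoose {A G : R} (h : G = 1 + A * G) (f V : ℕ) :
    A ^ (V + 1) ∣ G ^ f - ∑ v ∈ Finset.range (V + 1), (Nat.multichoose f v : R) * A ^ v := by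
  induction f with
  | zero =>
    rw [Finset.sum_range_succ']
    simp
  | succ f ih =>
    obtain ⟨c, hc⟩ := ih
    -- Multiplication by `1 - A` telescopes by Pascal's rule for `Nat.multichoose`.
    have h1 : ∀ V, (1 - A) * ∑ v ∈ Finset.range (V + 1), (Nat.multichoose (f + 1) v : R) * A ^ v
        = (∑ v ∈ Finset.range (V + 1), (Nat.multichoose f v : R) * A ^ v)
          - (Nat.multichoose (f + 1) V : R) * A ^ (V + 1) := by
      intro V
      induction V with
      | zero => simp
      | succ V ihV =>
        rw [Finset.sum_range_succ, mul_add, ihV, Finset.sum_range_succ _ (V + 1),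
          Nat.multichoose_succ_succ]
        push_cast
        ring
    have h2 : G * (1 - A) = 1 := by linear_combination h
    refine ⟨G * c + G * (Nat.multichoose (f + 1) V : R), ?_⟩
    have h3 := h1 V
    set T := ∑ v ∈ Finset.range (V + 1), (Nat.multichoose (f + 1) v : R) * A ^ v
    set T' := ∑ v ∈ Finset.range (V + 1), (Nat.multichoose f v : R) * A ^ v
    rw [pow_succ]
    linear_combination G * hc + T * h2 - G * h3

/-- The coefficient `Nat.multichoose f v` is the number of ways to distribute `v` returns over `f`
slots. Nothing is lost beyond `V`, since the remainder is divisible by `X ^ (2 * (V + 1))`. -/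
theorem coeff_walkSeries_pow (x : ℕ) (s : R) (f l : ℕ) {V : ℕ} (hV : l / 2 ≤ V) :
    PowerSeries.coeff l (walkSeries (Function.update 1 x s) b H x x ^ f)
      = ∑ v ∈ Finset.range (V + 1), (Nat.multichoose f v : R) * (s ^ v * closedWalk b H x l v) := by
  have h := dvd_pow_sub_sum_multichoose (walkSeries_update_self b H x s) f V
  have h1 : PowerSeries.X ^ (2 * (V + 1)) ∣ (PowerSeries.C s * returnSeries b H x) ^ (V + 1) := by
    rw [pow_mul]
    exact pow_dvd_pow_of_dvd ((X_sq_dvd_returnSeries b H x).mul_left _) _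
  have h2 := PowerSeries.X_pow_dvd_iff.1 (h1.trans h) l (by omega)
  rw [map_sub, sub_eq_zero] at h2
  rw [h2, map_sum]
  refine Finset.sum_congr rfl fun v _ => ?_
  rw [mul_pow, ← map_pow, ← map_natCast (PowerSeries.C (R := R)), PowerSeries.coeff_C_mul,
    PowerSeries.coeff_C_mul, closedWalk]

theorem coeff_walkSeries_self (x : ℕ) (s : R) (l : ℕ) {V : ℕ} (hV : l / 2 ≤ V) :
    walkPoly (Function.update 1 x s) b H x l x
      = ∑ v ∈ Finset.range (V + 1), s ^ v * closedWalk b H x l v := by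
  have h := coeff_walkSeries_pow b H x s 1 l hV
  rw [pow_one, coeff_walkSeries] at h
  simpa [Nat.multichoose_one] using h

theorem walkPoly_one_self (x l : ℕ) {V : ℕ} (hV : l / 2 ≤ V) :
    walkPoly 1 b H x l x = ∑ v ∈ Finset.range (V + 1), closedWalk b H x l v := by
  have h := coeff_walkSeries_self b H x 1 l hV
  simpa using h

/-! #### Membership of the coefficients in a subring -/

variable {b H σ}

theorem walkPoly_mem (𝒜 : Subring R) (hσ : ∀ i, σ i ∈ 𝒜) (hb : ∀ e ∈ H, b e ∈ 𝒜) (j l i : ℕ) :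
    walkPoly σ b H j l i ∈ 𝒜 := by
  induction l generalizing i with
  | zero =>
    rw [walkPoly]
    split_ifs
    exacts [one_mem _, zero_mem _]
  | succ l ih =>
    rw [walkPoly]
    exact mul_mem (hσ i) (sum_mem fun e he =>
      mul_mem (hb e (Finset.mem_filter.1 he).1) (sum_mem fun k _ => ih k))

theorem coeff_mul_mem (𝒜 : Subring R) {F G : PowerSeries R}
    (hF : ∀ l, PowerSeries.coeff l F ∈ 𝒜) (hG : ∀ l, PowerSeries.coeff l G ∈ 𝒜) (l : ℕ) :
    PowerSeries.coeff l (F * G) ∈ 𝒜 := by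
  rw [PowerSeries.coeff_mul]
  exact sum_mem fun a _ => mul_mem (hF _) (hG _)

theorem closedWalk_mem (𝒜 : Subring R) (hb : ∀ e ∈ H, b e ∈ 𝒜) (x l r : ℕ) :
    closedWalk b H x l r ∈ 𝒜 := by
  rw [closedWalk]
  induction r generalizing l with
  | zero =>
    rw [pow_zero, PowerSeries.coeff_one]
    split_ifs
    exacts [one_mem _, zero_mem _]
  | succ r ih =>
    rw [pow_succ]
    refine coeff_mul_mem 𝒜 ih (fun l => ?_) l
    cases l with
    | zero =>
      rw [returnSeries, stepSeries, coeff_zero_stepSum]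
      exact zero_mem _
    | succ l =>
      rw [returnSeries, stepSeries, coeff_succ_stepSum]
      refine sum_mem fun e he => mul_mem (hb e (Finset.mem_filter.1 he).1) (sum_mem fun k _ => ?_)
      rw [coeff_walkSeries]
      refine walkPoly_mem 𝒜 (fun i => ?_) hb _ _ _
      by_cases h : i = x
      · subst h; rw [Function.update_self]; exact zero_mem _
      · rw [Function.update_of_ne h]; exact one_mem _

/-! #### The walks that start along a given hyperedge -/

variable (σ b H)

/-- The matrix of the walk series between the vertices of `e`. -/
def edgeMatrix (e : Finset ℕ) (H' : Finset (Finset ℕ)) :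
    Matrix {z // z ∈ e} {z // z ∈ e} (PowerSeries R) :=
  Matrix.of fun z w => walkSeries σ b H' z w

/-- The complete graph on `e`, with weights on the departures. -/
def departMatrix {S : Type*} [CommRing S] (e : Finset ℕ) (y : ℕ → S) :
    Matrix {z // z ∈ e} {z // z ∈ e} S :=
  Matrix.of fun z w => if z = w then 0 else y z

theorem sum_departMatrix_mul {S : Type*} [CommRing S] (e : Finset ℕ) (y : ℕ → S)
    (z : {z // z ∈ e}) (g : ℕ → S) :
    ∑ w : {z // z ∈ e}, departMatrix e y z w * g w = y z * ∑ w ∈ e.erase z, g w := by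
  have h1 : ∑ w ∈ e.erase z, g w = ∑ w ∈ e, if (z : ℕ) = w then 0 else g w := by
    rw [← Finset.sum_erase_add _ _ z.2, if_pos rfl, add_zero]
    exact Finset.sum_congr rfl fun w hw => (if_neg (Finset.ne_of_mem_erase hw).symm).symm
  rw [h1, ← Finset.sum_coe_sort e fun w => if (z : ℕ) = w then 0 else g w, Finset.mul_sum]
  refine Finset.sum_congr rfl fun w _ => ?_
  simp only [departMatrix, Matrix.of_apply, Subtype.ext_iff]
  split_ifs <;> simp

theorem matrix_eq_geom {n S : Type*} [Fintype n] [DecidableEq n] [CommRing S]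
    {Z V : Matrix n n S} (h : V = Z + Z * V) (k : ℕ) :
    V = (∑ F ∈ Finset.Icc 1 k, Z ^ F) + Z ^ k * V := by
  induction k with
  | zero => simp
  | succ k ih =>
    rw [Finset.sum_Icc_succ_top (by omega), add_assoc, pow_succ, mul_assoc, ← mul_add, ← h]
    exact ih

variable {H} in
/-- Decomposition of the walks that start along `e` according to the number of steps along `e`. -/
theorem edge_walks_eq {e : Finset ℕ} (he : e ∈ H) (k : ℕ) :
    (PowerSeries.X * PowerSeries.C (b e)) •
        (departMatrix e (fun z => PowerSeries.C (σ z)) * edgeMatrix σ b e H)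
      = ∑ F ∈ Finset.Icc 1 k, (PowerSeries.X * PowerSeries.C (b e)) ^ F •
          (departMatrix e (fun z => PowerSeries.C (σ z)) * edgeMatrix σ b e (H.erase e)) ^ F
        + (PowerSeries.X : PowerSeries R) ^ (k + 1) • (PowerSeries.C (b e) ^ (k + 1) •
          ((departMatrix e (fun z => PowerSeries.C (σ z)) * edgeMatrix σ b e (H.erase e)) ^ k *
            (departMatrix e (fun z => PowerSeries.C (σ z)) * edgeMatrix σ b e H))) := by
  set c : PowerSeries R := PowerSeries.X * PowerSeries.C (b e)
  set M := departMatrix e (fun z => PowerSeries.C (σ z))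
  set G := edgeMatrix σ b e H
  set G' := edgeMatrix σ b e (H.erase e)
  -- The decomposition at the first step along `e`, read as an identity of matrices indexed by the
  -- vertices of `e`; iterating it counts the steps along `e`.
  have hG : G = G' + c • (G' * (M * G)) := by
    ext1 z w
    simp only [G, G', edgeMatrix, Matrix.of_apply, Matrix.add_apply, Matrix.smul_apply]
    rw [walkSeries_eq_erase σ b H he, Matrix.mul_apply, ← Finset.sum_coe_sort]
    congr 1
    rw [smul_eq_mul, Finset.mul_sum]
    refine Finset.sum_congr rfl fun v _ => ?_
    rw [Matrix.mul_apply]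
    simp only [Matrix.of_apply, M]
    rw [sum_departMatrix_mul e _ v (fun k => walkSeries σ b H k w)]
    ring
  have h1 : c • (M * G) = c • (M * G') + c • (M * G') * c • (M * G) := by
    conv_lhs => rw [hG]
    rw [mul_add, smul_add]
    simp only [Matrix.mul_smul, Matrix.smul_mul, mul_assoc]
  have h2 := matrix_eq_geom h1 k
  rw [h2]
  congr 1
  · exact Finset.sum_congr rfl fun F _ => by rw [smul_pow]
  · rw [smul_pow, Matrix.smul_mul, Matrix.mul_smul, smul_smul, smul_smul, ← pow_succ, mul_pow]

end Walks

end SparseHypergraph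

end

noncomputable section

namespace SparseHypergraph

/-! ### Words in a hyperedge and the numbers `walkNumber` -/

section Words

/-- The sum of `Φ j f` over the words of `F` steps in the complete graph on `e` that start at `x`;
`j` is the end of the word and `f` counts the departures from the vertices. -/
def wordSum {A : Type*} [AddCommMonoid A] (e : Finset ℕ) (x : ℕ) :
    ℕ → (ℕ → (ℕ →₀ ℕ) → A) → A
  | 0, Φ => Φ x 0
  | F + 1, Φ => wordSum e x F fun a f => ∑ j ∈ e.erase a, Φ j (f + Finsupp.single a 1)

variable {A : Type*} [AddCommMonoid A] {e : Finset ℕ} {x : ℕ}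

theorem support_add_single_subset {f : ℕ →₀ ℕ} (hf : f.support ⊆ e) {a : ℕ} (ha : a ∈ e) :
    (f + Finsupp.single a 1).support ⊆ e := by
  refine Finsupp.support_add.trans (Finset.union_subset hf ?_)
  exact Finsupp.support_single_subset.trans (Finset.singleton_subset_iff.2 ha)

theorem wordSum_congr (hx : x ∈ e) (F : ℕ) {Φ Φ' : ℕ → (ℕ →₀ ℕ) → A}
    (h : ∀ j ∈ e, ∀ f : ℕ →₀ ℕ, f.support ⊆ e → f.degree = F → Φ j f = Φ' j f) :
    wordSum e x F Φ = wordSum e x F Φ' := by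
  induction F generalizing Φ Φ' with
  | zero => exact h x hx 0 (by simp) (by simp)
  | succ F ih =>
    refine ih fun a ha f hf hd => Finset.sum_congr rfl fun j hj => ?_
    exact h j (Finset.mem_of_mem_erase hj) _ (support_add_single_subset hf ha)
      (by rw [map_add, Finsupp.degree_single, hd])

theorem map_wordSum {B : Type*} [AddCommMonoid B] (L : A →+ B) (F : ℕ)
    (Φ : ℕ → (ℕ →₀ ℕ) → A) :
    L (wordSum e x F Φ) = wordSum e x F fun j f => L (Φ j f) := by
  induction F generalizing Φ with
  | zero => rfl
  | succ F ih => simp only [wordSum, ih, map_sum]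

theorem wordSum_sub {A : Type*} [AddCommGroup A] (F : ℕ) (Φ Φ' : ℕ → (ℕ →₀ ℕ) → A) :
    wordSum e x F Φ - wordSum e x F Φ' = wordSum e x F fun j f => Φ j f - Φ' j f := by
  induction F generalizing Φ Φ' with
  | zero => rfl
  | succ F ih => simp only [wordSum, ih, Finset.sum_sub_distrib]

theorem abs_wordSum_le (hx : x ∈ e) (F : ℕ) {Φ : ℕ → (ℕ →₀ ℕ) → ℝ} {ε : ℝ} (hε : 0 ≤ ε)
    (h : ∀ j ∈ e, ∀ f : ℕ →₀ ℕ, f.support ⊆ e → f.degree = F → |Φ j f| ≤ ε) :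
    |wordSum e x F Φ| ≤ (e.card : ℝ) ^ F * ε := by
  induction F generalizing Φ ε with
  | zero => simpa [wordSum] using h x hx 0 (by simp) (by simp)
  | succ F ih =>
    rw [wordSum, pow_succ, mul_assoc]
    refine ih (by positivity) fun a ha f hf hd => ?_
    calc _ ≤ ∑ j ∈ e.erase a, |Φ j (f + Finsupp.single a 1)| := Finset.abs_sum_le_sum_abs _ _
      _ ≤ ∑ j ∈ e.erase a, ε := Finset.sum_le_sum fun j hj =>
          h j (Finset.mem_of_mem_erase hj) _ (support_add_single_subset hf ha)
            (by rw [map_add, Finsupp.degree_single, hd])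
      _ ≤ _ := by
          rw [Finset.sum_const, nsmul_eq_mul]
          gcongr
          exact Finset.erase_subset _ _

theorem prod_pow_add_single {S : Type*} [CommSemiring S] {a : ℕ} (ha : a ∈ e) (y : ℕ → S)
    (f : ℕ →₀ ℕ) :
    ∏ z ∈ e, y z ^ (f + Finsupp.single a 1 : ℕ →₀ ℕ) z = y a * ∏ z ∈ e, y z ^ f z := by
  rw [← Finset.mul_prod_erase e _ ha, ← Finset.mul_prod_erase e (fun z => y z ^ f z) ha]
  have : ∏ z ∈ e.erase a, y z ^ (f + Finsupp.single a 1 : ℕ →₀ ℕ) z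
      = ∏ z ∈ e.erase a, y z ^ f z :=
    Finset.prod_congr rfl fun z hz => by simp [Finset.ne_of_mem_erase hz]
  rw [this]
  simp only [Finsupp.add_apply, Finsupp.single_eq_same, pow_succ]
  ring

theorem sum_departMatrix_pow_mul {S : Type*} [CommRing S] (y c : ℕ → S) (F : ℕ)
    (x : {z // z ∈ e}) :
    ∑ j : {z // z ∈ e}, (departMatrix e y ^ F) x j * c j
      = wordSum e x F fun j f => c j * ∏ z ∈ e, y z ^ f z := by
  induction F generalizing c with
  | zero =>
    rw [pow_zero, wordSum]
    simp [Matrix.one_apply]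
  | succ F ih =>
    have h1 : ∑ j : {z // z ∈ e}, (departMatrix e y ^ (F + 1)) x j * c j
        = ∑ a : {z // z ∈ e}, (departMatrix e y ^ F) x a * (y a * ∑ j ∈ e.erase a, c j) := by
      simp only [pow_succ, Matrix.mul_apply, Finset.sum_mul]
      rw [Finset.sum_comm]
      refine Finset.sum_congr rfl fun a _ => ?_
      rw [← sum_departMatrix_mul, Finset.mul_sum]
      exact Finset.sum_congr rfl fun j _ => by ring
    rw [h1, ih fun a => y a * ∑ j ∈ e.erase a, c j, wordSum]
    refine wordSum_congr x.2 F fun a ha f _ _ => ?_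
    rw [Finset.mul_sum, Finset.sum_mul]
    exact Finset.sum_congr rfl fun j _ => by rw [prod_pow_add_single ha]; ring

theorem departMatrix_pow_apply_self {S : Type*} [CommRing S] (y : ℕ → S) (F : ℕ)
    (x : {z // z ∈ e}) :
    (departMatrix e y ^ F) x x
      = wordSum e x F fun j f => if j = x then ∏ z ∈ e, y z ^ f z else 0 := by
  have h := sum_departMatrix_pow_mul y (fun j => if j = x then 1 else 0) F x
  simp only [Subtype.coe_inj, mul_ite, mul_one, mul_zero, Finset.sum_ite_eq', Finset.mem_univ,
    if_true, ite_mul, one_mul, zero_mul] at h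
  exact h

/-! #### The recurrence of `walkNumber` -/

theorem walkNumber_eq {ϰ j : ℕ} (hj : j ∈ Finset.Icc 1 ϰ) {f : ℕ →₀ ℕ} (hf : f ≠ 0) :
    walkNumber ϰ j f = (∑ a ∈ Finset.Icc 1 ϰ,
        if a ≠ j ∧ 1 ≤ f a then walkNumber ϰ a (f - Finsupp.single a 1) else 0)
      + if j = ϰ then ∑ a ∈ Finset.Icc 1 (ϰ - 1),
        if 1 ≤ f a then walkNumber (ϰ - 1) a (f - Finsupp.single a 1) else 0 else 0 := by
  rw [Finset.mem_Icc] at hj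
  match ϰ, hj with
  | 0, hj => omega
  | 1, hj =>
    obtain rfl : j = 1 := by omega
    rw [walkNumber, if_neg (by simp [hf])]
    simp
  | ϰ + 2, hj =>
    rw [walkNumber]
    simp only [dite_eq_ite]
    rfl

theorem walkNumber_zero_right {ϰ j : ℕ} (h : ϰ ≠ 1) : walkNumber ϰ j 0 = 0 := by
  match ϰ, h with
  | 0, _ => rw [walkNumber]
  | ϰ + 2, _ => rw [walkNumber]; simp

theorem ne_zero_or_ne_zero_of_add_ne_zero {m n : ℕ} (h : m + n ≠ 0) : m ≠ 0 ∨ n ≠ 0 := by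
  omega

theorem sum_eq_degree {s : Finset ℕ} {f : ℕ →₀ ℕ} (hf : f.support ⊆ s) : s.sum f = f.degree :=
  Finsupp.degree_apply f ▸ (Finset.sum_subset hf fun i _ hi => by simpa using hi).symm

/-- `walkNumber ϰ j f` counts the words that start at `1`, visit `1, …, ϰ` for the first time in
this order, end at `j`, and have departure numbers `f`. Every visited vertex other than the last one
has been left. -/
theorem walkNumber_ne_zero {ϰ j : ℕ} (hj : j ∈ Finset.Icc 1 ϰ) {f : ℕ →₀ ℕ}
    (h : walkNumber ϰ j f ≠ 0) :
    f.support ⊆ Finset.Icc 1 ϰ ∧ ∀ i ∈ Finset.Icc 1 ϰ, i ≠ j → 1 ≤ f i := by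
  induction hn : f.degree using Nat.strong_induction_on generalizing ϰ j f with
  | _ n ih =>
  by_cases hf : f = 0
  · subst hf
    by_cases hϰ : ϰ = 1
    · subst hϰ
      refine ⟨by simp, fun i hi hij => ?_⟩
      rw [Finset.mem_Icc] at hi hj
      omega
    · exact absurd (walkNumber_zero_right hϰ) h
  · have key : ∀ a, 1 ≤ f a → ∀ s : Finset ℕ, a ∈ s →
        (f - Finsupp.single a 1).support ⊆ s → f.support ⊆ s := by
      intro a ha s has hs i hi
      by_cases hia : i = a
      · exact hia ▸ has
      · refine hs ?_
        rw [Finsupp.mem_support_iff] at hi ⊢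
        simpa [Finsupp.single_apply, Ne.symm hia] using hi
    have sub_le : ∀ a i, (f - Finsupp.single a 1 : ℕ →₀ ℕ) i ≤ f i := fun a i => by
      simp only [Finsupp.tsub_apply]; exact Nat.sub_le _ _
    rw [walkNumber_eq hj hf] at h
    rcases ne_zero_or_ne_zero_of_add_ne_zero h with h | h
    · obtain ⟨a, ha, h1⟩ := Finset.exists_ne_zero_of_sum_ne_zero h
      split_ifs at h1 with h2
      · obtain ⟨i1, i2⟩ := ih _ (hn ▸ degree_sub_single_lt f a h2.2) ha h1 rfl
        refine ⟨key a h2.2 _ ha i1, fun i hi _ => ?_⟩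
        by_cases hia : i = a
        · exact hia ▸ h2.2
        · exact (i2 i hi hia).trans (sub_le a i)
      · exact absurd rfl h1
    · split_ifs at h with hϰ
      · obtain ⟨a, ha, h1⟩ := Finset.exists_ne_zero_of_sum_ne_zero h
        split_ifs at h1 with h2
        · obtain ⟨i1, i2⟩ := ih _ (hn ▸ degree_sub_single_lt f a h2) ha h1 rfl
          have hs : Finset.Icc 1 (ϰ - 1) ⊆ Finset.Icc 1 ϰ :=
            Finset.Icc_subset_Icc_right (Nat.sub_le _ _)
          refine ⟨key a h2 _ (hs ha) (i1.trans hs), fun i hi hij => ?_⟩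
          by_cases hia : i = a
          · exact hia ▸ h2
          · refine (i2 i ?_ hia).trans (sub_le a i)
            rw [Finset.mem_Icc] at hi ⊢
            omega
        · exact absurd rfl h1
      · exact absurd rfl h

/-- A nonempty word that ends at its start `1` has also left `1`. Hence the restriction `f i ≥ 1` in
the recurrence discards only zero terms. -/
theorem walkNumber_closed_ne_zero {ϰ : ℕ} (hϰ : 1 ≤ ϰ) {f : ℕ →₀ ℕ} (hf : f ≠ 0)
    (h : walkNumber ϰ 1 f ≠ 0) : ∀ i ∈ Finset.Icc 1 ϰ, 1 ≤ f i := by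
  have h1 : (1 : ℕ) ∈ Finset.Icc 1 ϰ := Finset.mem_Icc.2 ⟨le_rfl, hϰ⟩
  intro i hi
  by_cases hi1 : i = 1
  · subst hi1
    rw [walkNumber_eq h1 hf] at h
    rcases ne_zero_or_ne_zero_of_add_ne_zero h with h | h
    · obtain ⟨a, ha, h3⟩ := Finset.exists_ne_zero_of_sum_ne_zero h
      split_ifs at h3 with h2
      · refine ((walkNumber_ne_zero ha h3).2 1 h1 h2.1.symm).trans ?_
        simp only [Finsupp.tsub_apply]; exact Nat.sub_le _ _
      · exact absurd rfl h3
    · split_ifs at h with h3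
      · subst h3; simp at h
      · exact absurd rfl h
  · exact (walkNumber_ne_zero h1 h).2 i hi hi1

theorem sum_finsuppAntidiag_succ {S : Type*} [AddCommMonoid S] {s : Finset ℕ} {a : ℕ}
    (ha : a ∈ s) (F : ℕ) (h : (ℕ →₀ ℕ) → (ℕ →₀ ℕ) → S) :
    (∑ g ∈ s.finsuppAntidiag (F + 1),
        if 1 ≤ g a then h (g - Finsupp.single a 1) g else 0)
      = ∑ f ∈ s.finsuppAntidiag F, h f (f + Finsupp.single a 1) := by
  rw [← Finset.sum_filter]
  symm
  refine Finset.sum_bij' (fun f _ => f + Finsupp.single a 1) (fun g _ => g - Finsupp.single a 1)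
    ?_ ?_ ?_ ?_ ?_
  · intro f hf
    rw [Finset.mem_finsuppAntidiag] at hf
    rw [Finset.mem_filter, Finset.mem_finsuppAntidiag]
    have hs := support_add_single_subset hf.2 ha
    refine ⟨⟨?_, hs⟩, by simp⟩
    rw [sum_eq_degree hs, map_add, Finsupp.degree_single, ← hf.1, sum_eq_degree hf.2]
  · intro g hg
    rw [Finset.mem_filter, Finset.mem_finsuppAntidiag] at hg
    have hle : Finsupp.single a 1 ≤ g := Finsupp.single_le_iff.2 hg.2
    have hs : (g - Finsupp.single a 1).support ⊆ s :=
      (Finsupp.support_mono tsub_le_self).trans hg.1.2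
    rw [Finset.mem_finsuppAntidiag]
    refine ⟨?_, hs⟩
    have h1 := congrArg Finsupp.degree (tsub_add_cancel_of_le hle)
    rw [map_add, Finsupp.degree_single, ← sum_eq_degree hg.1.2, hg.1.1] at h1
    rw [sum_eq_degree hs]
    omega
  · intro f _
    exact add_tsub_cancel_right f _
  · intro g hg
    rw [Finset.mem_filter] at hg
    exact tsub_add_cancel_of_le (Finsupp.single_le_iff.2 hg.2)
  · intro f _
    rw [add_tsub_cancel_right]

/-- Summation over the words in `[q]` by the order of the first visits, for a symmetric function. -/
theorem wordSum_eq_sum_walkNumber {S : Type*} [CommSemiring S] {q : ℕ} (hq : 1 ≤ q) (F : ℕ)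
    (Φ : ℕ → (ℕ →₀ ℕ) → S)
    (hΦ : ∀ τ : Equiv.Perm ℕ, τ 1 = 1 → (∀ i, τ i ∈ Finset.Icc 1 q ↔ i ∈ Finset.Icc 1 q) →
      ∀ j f, Φ (τ j) (f.mapDomain τ) = Φ j f) :
    wordSum (Finset.Icc 1 q) 1 F Φ = ∑ ϰ ∈ Finset.Icc 1 q, ((q - 1).descFactorial (ϰ - 1) : S) *
      ∑ j ∈ Finset.Icc 1 ϰ, ∑ f ∈ (Finset.Icc 1 ϰ).finsuppAntidiag F,
        (walkNumber ϰ j f : S) * Φ j f := by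
  induction F generalizing Φ with
  | zero =>
    rw [Finset.sum_eq_single 1]
    · simp [wordSum, walkNumber]
    · intro ϰ _ hϰ
      simp [walkNumber_zero_right hϰ]
    · intro h; exact absurd (Finset.mem_Icc.2 ⟨le_rfl, hq⟩) h
  | succ F ih =>
    rw [wordSum, ih]
    swap
    · intro τ h1 hτ a f
      refine (Finset.sum_equiv τ (fun j => ?_) fun j _ => ?_).symm
      · rw [Finset.mem_erase, Finset.mem_erase, hτ, τ.injective.ne_iff]
      · rw [← hΦ τ h1 hτ, Finsupp.mapDomain_add, Finsupp.mapDomain_single]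
    -- The recurrence of `walkNumber` splits words of `F + 1` steps by the last step: it goes to a
    -- vertex visited before, or it discovers the vertex `ϰ`.
    have hR : ∀ ϰ ∈ Finset.Icc 1 q, ∑ j ∈ Finset.Icc 1 ϰ,
        ∑ f ∈ (Finset.Icc 1 ϰ).finsuppAntidiag (F + 1), (walkNumber ϰ j f : S) * Φ j f
        = (∑ a ∈ Finset.Icc 1 ϰ, ∑ f ∈ (Finset.Icc 1 ϰ).finsuppAntidiag F,
            (walkNumber ϰ a f : S) * ∑ j ∈ (Finset.Icc 1 ϰ).erase a, Φ j (f + Finsupp.single a 1))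
          + ∑ a ∈ Finset.Icc 1 (ϰ - 1), ∑ f ∈ (Finset.Icc 1 (ϰ - 1)).finsuppAntidiag F,
            (walkNumber (ϰ - 1) a f : S) * Φ ϰ (f + Finsupp.single a 1) := by
      intro ϰ hϰ
      have hϰ1 := (Finset.mem_Icc.1 hϰ).1
      have e1 : ∀ j ∈ Finset.Icc 1 ϰ, ∑ f ∈ (Finset.Icc 1 ϰ).finsuppAntidiag (F + 1),
          (walkNumber ϰ j f : S) * Φ j f
          = (∑ a ∈ Finset.Icc 1 ϰ, if a ≠ j then ∑ f ∈ (Finset.Icc 1 ϰ).finsuppAntidiag F,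
              (walkNumber ϰ a f : S) * Φ j (f + Finsupp.single a 1) else 0)
            + if j = ϰ then ∑ a ∈ Finset.Icc 1 (ϰ - 1),
                ∑ f ∈ (Finset.Icc 1 ϰ).finsuppAntidiag F,
                (walkNumber (ϰ - 1) a f : S) * Φ j (f + Finsupp.single a 1) else 0 := by
        intro j hj
        have e2 : ∀ g ∈ (Finset.Icc 1 ϰ).finsuppAntidiag (F + 1), (walkNumber ϰ j g : S) * Φ j g
            = (∑ a ∈ Finset.Icc 1 ϰ, if a ≠ j then if 1 ≤ g a then
                (walkNumber ϰ a (g - Finsupp.single a 1) : S) * Φ j g else 0 else 0)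
              + if j = ϰ then ∑ a ∈ Finset.Icc 1 (ϰ - 1), if 1 ≤ g a then
                (walkNumber (ϰ - 1) a (g - Finsupp.single a 1) : S) * Φ j g else 0 else 0 := by
          intro g hg
          have hg0 : g ≠ 0 := by
            rintro rfl
            simpa using (Finset.mem_finsuppAntidiag.1 hg).1
          rw [walkNumber_eq hj hg0]
          push_cast
          rw [add_mul, Finset.sum_mul]
          congr 1
          · refine Finset.sum_congr rfl fun a _ => ?_
            rw [ite_and, ite_mul, zero_mul, ite_mul, zero_mul]
          · rw [ite_mul, zero_mul, Finset.sum_mul]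
            simp only [ite_mul, zero_mul]
        rw [Finset.sum_congr rfl e2, Finset.sum_add_distrib, Finset.sum_comm]
        congr 1
        · refine Finset.sum_congr rfl fun a ha => ?_
          split_ifs with h
          · exact sum_finsuppAntidiag_succ ha F
              fun f g => (walkNumber ϰ a f : S) * Φ j g
          · simp
        · split_ifs with h
          · rw [Finset.sum_comm]
            refine Finset.sum_congr rfl fun a ha => ?_
            exact sum_finsuppAntidiag_succ
              (Finset.Icc_subset_Icc_right (Nat.sub_le _ _) ha) F
              fun f g => (walkNumber (ϰ - 1) a f : S) * Φ j g
          · simp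
      rw [Finset.sum_congr rfl e1, Finset.sum_add_distrib, Finset.sum_comm]
      congr 1
      · refine Finset.sum_congr rfl fun a ha => ?_
        simp only [Finset.mul_sum]
        rw [Finset.sum_comm (s := (Finset.Icc 1 ϰ).finsuppAntidiag F), ← Finset.sum_erase_add _ _ ha]
        simp only [ne_eq, not_true_eq_false, if_false, add_zero]
        exact Finset.sum_congr rfl fun j hj => if_pos (Finset.ne_of_mem_erase hj).symm
      · rw [Finset.sum_ite_eq', if_pos (Finset.mem_Icc.2 ⟨hϰ1, le_rfl⟩)]
        refine Finset.sum_congr rfl fun a ha => ?_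
        symm
        refine Finset.sum_subset (Finset.finsuppAntidiag_mono
          (Finset.Icc_subset_Icc_right (Nat.sub_le _ _)) F) fun f hf hf' => ?_
        have : walkNumber (ϰ - 1) a f = 0 := by
          by_contra h
          have hs := (walkNumber_ne_zero ha h).1
          rw [Finset.mem_finsuppAntidiag] at hf
          refine hf' (Finset.mem_finsuppAntidiag.2 ⟨?_, hs⟩)
          rw [sum_eq_degree hs, ← hf.1, sum_eq_degree hf.2]
        rw [this, Nat.cast_zero, zero_mul]
    -- The same dichotomy on the side of labelled words: by symmetry all `q - ϰ` unvisited targets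
    -- give the value at `ϰ + 1`.
    have hL : ∀ ϰ ∈ Finset.Icc 1 q, ∀ a ∈ Finset.Icc 1 ϰ,
        ∀ f ∈ (Finset.Icc 1 ϰ).finsuppAntidiag F,
        ∑ j ∈ (Finset.Icc 1 q).erase a, Φ j (f + Finsupp.single a 1)
        = (∑ j ∈ (Finset.Icc 1 ϰ).erase a, Φ j (f + Finsupp.single a 1))
          + ((q - ϰ : ℕ) : S) * Φ (ϰ + 1) (f + Finsupp.single a 1) := by
      intro ϰ hϰ a ha f hf
      rw [Finset.mem_Icc] at hϰ
      have hs := support_add_single_subset (Finset.mem_finsuppAntidiag.1 hf).2 ha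
      have hsub : (Finset.Icc 1 ϰ).erase a ⊆ (Finset.Icc 1 q).erase a :=
        Finset.erase_subset_erase _ (Finset.Icc_subset_Icc_right hϰ.2)
      rw [← Finset.sum_sdiff hsub, add_comm]
      congr 1
      have hset : (Finset.Icc 1 q).erase a \ (Finset.Icc 1 ϰ).erase a = Finset.Ioc ϰ q := by
        ext i
        simp only [Finset.mem_sdiff, Finset.mem_erase, Finset.mem_Icc, Finset.mem_Ioc] at ha ⊢
        omega
      rw [hset]
      have hc : ∀ j ∈ Finset.Ioc ϰ q, Φ j (f + Finsupp.single a 1)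
          = Φ (ϰ + 1) (f + Finsupp.single a 1) := by
        intro j hj
        rw [Finset.mem_Ioc] at hj
        -- The transposed vertices are both unvisited, so the transposition leaves the departure
        -- numbers unchanged.
        have := hΦ (Equiv.swap j (ϰ + 1)) (Equiv.swap_apply_of_ne_of_ne (by omega) (by omega))
          (fun i => by
            rw [Equiv.swap_apply_def]
            simp only [Finset.mem_Icc]
            split_ifs <;> omega) j (f + Finsupp.single a 1)
        rw [Equiv.swap_apply_left] at this
        rw [← this]
        congr 1
        rw [Finsupp.mapDomain_congr (g := id), Finsupp.mapDomain_id]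
        intro i hi
        have := Finset.mem_Icc.1 (hs hi)
        exact Equiv.swap_apply_of_ne_of_ne (by omega) (by omega)
      rw [Finset.sum_congr rfl hc, Finset.sum_const, Nat.card_Ioc, nsmul_eq_mul]
    rw [Finset.sum_congr rfl fun ϰ hϰ => congrArg _ (hR ϰ hϰ)]
    simp only [mul_add, Finset.sum_add_distrib]
    have hL' : ∑ ϰ ∈ Finset.Icc 1 q, ((q - 1).descFactorial (ϰ - 1) : S) *
        ∑ a ∈ Finset.Icc 1 ϰ, ∑ f ∈ (Finset.Icc 1 ϰ).finsuppAntidiag F,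
          (walkNumber ϰ a f : S) * ∑ j ∈ (Finset.Icc 1 q).erase a, Φ j (f + Finsupp.single a 1)
        = (∑ ϰ ∈ Finset.Icc 1 q, ((q - 1).descFactorial (ϰ - 1) : S) *
            ∑ a ∈ Finset.Icc 1 ϰ, ∑ f ∈ (Finset.Icc 1 ϰ).finsuppAntidiag F,
            (walkNumber ϰ a f : S) * ∑ j ∈ (Finset.Icc 1 ϰ).erase a, Φ j (f + Finsupp.single a 1))
          + ∑ ϰ ∈ Finset.Icc 1 q, ((q - 1).descFactorial ϰ : S) *
            ∑ a ∈ Finset.Icc 1 ϰ, ∑ f ∈ (Finset.Icc 1 ϰ).finsuppAntidiag F,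
            (walkNumber ϰ a f : S) * Φ (ϰ + 1) (f + Finsupp.single a 1) := by
      rw [← Finset.sum_add_distrib]
      refine Finset.sum_congr rfl fun ϰ hϰ => ?_
      -- The falling factorial counts the labellings of the vertices discovered so far; a discovery
      -- multiplies it by `q - ϰ`.
      have hd : (q - 1).descFactorial ϰ = (q - ϰ) * (q - 1).descFactorial (ϰ - 1) := by
        rw [Finset.mem_Icc] at hϰ
        obtain ⟨k, rfl⟩ : ∃ k, ϰ = k + 1 := ⟨ϰ - 1, by omega⟩
        rw [Nat.descFactorial_succ, Nat.add_sub_cancel, Nat.sub_sub, add_comm 1 k]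
      rw [hd, Finset.sum_congr rfl fun a ha => Finset.sum_congr rfl fun f hf =>
        congrArg _ (hL ϰ hϰ a ha f hf)]
      push_cast
      simp only [mul_add, Finset.sum_add_distrib, Finset.mul_sum]
      congr 1
      refine Finset.sum_congr rfl fun a _ => Finset.sum_congr rfl fun f _ => ?_
      ring
    rw [hL']
    congr 1
    obtain ⟨n, rfl⟩ : ∃ n, q = n + 1 := ⟨q - 1, by omega⟩
    rw [Finset.sum_Icc_succ_top (by omega)]
    -- When all `q` vertices have been visited there is nothing left to discover.
    have h0 : (n + 1 - 1).descFactorial (n + 1) = 0 := Nat.descFactorial_eq_zero_iff_lt.2 (by omega)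
    rw [h0, Nat.cast_zero, zero_mul, add_zero]
    rw [← Finset.sum_subset (s₁ := Finset.Icc 2 (n + 1)) (s₂ := Finset.Icc 1 (n + 1))
      (Finset.Icc_subset_Icc_left (by omega))]
    · refine Finset.sum_bij' (fun ϰ _ => ϰ + 1) (fun ϰ _ => ϰ - 1) ?_ ?_ ?_ ?_ ?_
      · intro ϰ h; rw [Finset.mem_Icc] at h ⊢; omega
      · intro ϰ h; rw [Finset.mem_Icc] at h ⊢; omega
      · intro ϰ h; omega
      · intro ϰ h; rw [Finset.mem_Icc] at h; omega
      · intro ϰ h; simp only [Nat.add_sub_cancel]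
    · intro ϰ h h'
      obtain rfl : ϰ = 1 := by
        simp only [Finset.mem_Icc] at h h'; omega
      simp

end Words

end SparseHypergraph

end

noncomputable section

namespace SparseHypergraph

/-! ### Closed words in an arbitrary hyperedge -/

section Words

theorem wordSum_image {A : Type*} [AddCommMonoid A] {s : Finset ℕ} {x : ℕ} (hx : x ∈ s)
    {ε : ℕ → ℕ} (hε : Set.InjOn ε s) (F : ℕ) (Φ : ℕ → (ℕ →₀ ℕ) → A) :
    wordSum (s.image ε) (ε x) F Φ = wordSum s x F fun j f => Φ (ε j) (f.mapDomain ε) := by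
  induction F generalizing Φ with
  | zero => simp [wordSum]
  | succ F ih =>
    rw [wordSum, ih, wordSum]
    refine wordSum_congr hx F fun a ha f _ _ => ?_
    have h1 : (s.image ε).erase (ε a) = (s.erase a).image ε := by
      ext i
      simp only [Finset.mem_erase, Finset.mem_image]
      constructor
      · rintro ⟨h, j, hj, rfl⟩
        exact ⟨j, ⟨fun h' => h (h' ▸ rfl), hj⟩, rfl⟩
      · rintro ⟨j, ⟨h, hj⟩, rfl⟩
        exact ⟨fun h' => h (hε hj ha h'), j, hj, rfl⟩
    rw [h1, Finset.sum_image fun i hi j hj h => hε (Finset.mem_of_mem_erase hi)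
      (Finset.mem_of_mem_erase hj) h]
    simp only [Finsupp.mapDomain_add, Finsupp.mapDomain_single]

theorem exists_enumeration {e : Finset ℕ} {x q : ℕ} (hx : x ∈ e) (he : e.card = q) :
    ∃ ε : ℕ → ℕ, Set.InjOn ε (Finset.Icc 1 q) ∧ (Finset.Icc 1 q).image ε = e ∧ ε 1 = x := by
  have hq : 1 ≤ q := he ▸ Finset.card_pos.2 ⟨x, hx⟩
  have h1 : 1 ∈ Finset.Icc 1 q := Finset.mem_Icc.2 ⟨le_rfl, hq⟩
  let φ : {i // i ∈ Finset.Icc 1 q} ≃ {i // i ∈ e} :=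
    Finset.equivOfCardEq (by rw [he, Nat.card_Icc, Nat.add_sub_cancel])
  let ψ := φ.trans (Equiv.swap (φ ⟨1, h1⟩) ⟨x, hx⟩)
  refine ⟨fun n => if h : n ∈ Finset.Icc 1 q then ψ ⟨n, h⟩ else n, ?_, ?_, ?_⟩
  · intro i hi j hj hij
    rw [Finset.mem_coe] at hi hj
    simp only [hi, hj, dif_pos] at hij
    simpa using ψ.injective (Subtype.ext hij)
  · ext i
    rw [Finset.mem_image]
    constructor
    · rintro ⟨j, hj, rfl⟩
      simp only [hj, dif_pos]
      exact (ψ ⟨j, hj⟩).2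
    · intro hi
      refine ⟨ψ.symm ⟨i, hi⟩, (ψ.symm ⟨i, hi⟩).2, ?_⟩
      rw [dif_pos (ψ.symm ⟨i, hi⟩).2]
      simp
  · simp only [h1, dif_pos]
    simp [ψ]

/-- Summation over the closed words at `x` of a product over the vertices, where all vertices but
`x` carry the same function. -/
theorem wordSum_closed {S : Type*} [CommSemiring S] {e : Finset ℕ} {x q : ℕ} (hx : x ∈ e)
    (he : e.card = q) (A B : ℕ → S) (hB : B 0 = 1) (F : ℕ) :
    wordSum e x F (fun j f => if j = x then A (f x) * ∏ z ∈ e.erase x, B (f z) else 0)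
      = ∑ ϰ ∈ Finset.Icc 1 q, ((q - 1).descFactorial (ϰ - 1) : S) *
        ∑ f ∈ (Finset.Icc 1 ϰ).finsuppAntidiag F,
          (walkNumber ϰ 1 f : S) * (A (f 1) * ∏ i ∈ Finset.Icc 2 ϰ, B (f i)) := by
  have hq : 1 ≤ q := he ▸ Finset.card_pos.2 ⟨x, hx⟩
  have h1 : 1 ∈ Finset.Icc 1 q := Finset.mem_Icc.2 ⟨le_rfl, hq⟩
  obtain ⟨ε, hinj, rfl, rfl⟩ := exists_enumeration hx he
  rw [wordSum_image h1 hinj]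
  have hcongr : wordSum (Finset.Icc 1 q) 1 F (fun j f =>
      (fun (j : ℕ) (f : ℕ →₀ ℕ) => if j = ε 1 then
        A (f (ε 1)) * ∏ z ∈ ((Finset.Icc 1 q).image ε).erase (ε 1), B (f z) else 0) (ε j)
        (f.mapDomain ε))
      = wordSum (Finset.Icc 1 q) 1 F fun j f =>
        if j = 1 then A (f 1) * ∏ i ∈ Finset.Icc 2 q, B (f i) else 0 := by
    refine wordSum_congr h1 F fun j hj f hf _ => ?_
    have hv : ∀ i ∈ Finset.Icc 1 q, f.mapDomain ε (ε i) = f i := fun i hi =>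
      Finsupp.mapDomain_apply' _ _ (Finset.coe_subset.2 hf) hinj hi
    have hset : ((Finset.Icc 1 q).image ε).erase (ε 1) = (Finset.Icc 2 q).image ε := by
      ext i
      simp only [Finset.mem_erase, Finset.mem_image]
      constructor
      · rintro ⟨h, k, hk, rfl⟩
        refine ⟨k, ?_, rfl⟩
        have : k ≠ 1 := fun h' => h (h' ▸ rfl)
        rw [Finset.mem_Icc] at hk ⊢
        omega
      · rintro ⟨k, hk, rfl⟩
        have hk' : k ∈ Finset.Icc 1 q := Finset.Icc_subset_Icc_left (by omega) hk
        refine ⟨fun h => ?_, k, hk', rfl⟩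
        have := hinj hk' h1 h
        rw [Finset.mem_Icc] at hk
        omega
    have h2 : (Finset.Icc 2 q : Set ℕ) ⊆ Finset.Icc 1 q :=
      Finset.coe_subset.2 (Finset.Icc_subset_Icc_left (by omega))
    by_cases hj1 : j = 1
    · subst hj1
      simp only [if_true]
      rw [hv 1 h1, hset, Finset.prod_image (hinj.mono (by exact_mod_cast h2))]
      congr 1
      exact Finset.prod_congr rfl fun i hi => by
        rw [hv i (Finset.Icc_subset_Icc_left (by omega) hi)]
    · simp only [if_neg hj1, if_neg fun h => hj1 (hinj hj h1 h)]
  rw [hcongr, wordSum_eq_sum_walkNumber hq]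
  · refine Finset.sum_congr rfl fun ϰ hϰ => ?_
    rw [Finset.mem_Icc] at hϰ
    congr 1
    rw [Finset.sum_eq_single_of_mem 1 (Finset.mem_Icc.2 ⟨le_rfl, hϰ.1⟩)]
    · refine Finset.sum_congr rfl fun f hf => ?_
      rw [if_pos rfl]
      congr 2
      symm
      refine Finset.prod_subset (Finset.Icc_subset_Icc_right hϰ.2) fun i hi hi' => ?_
      have : f i = 0 := by
        by_contra h
        have := (Finset.mem_finsuppAntidiag.1 hf).2 (Finsupp.mem_support_iff.2 h)
        rw [Finset.mem_Icc] at hi hi' this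
        omega
      rw [this, hB]
    · intro j _ hj
      simp [hj]
  · intro τ hτ1 hτ j f
    have hm : ∀ i, f.mapDomain τ (τ i) = f i := fun i =>
      Finsupp.mapDomain_apply τ.injective f i
    have e1 : τ j = 1 ↔ j = 1 := by
      conv_lhs => rw [← hτ1]
      exact τ.injective.eq_iff
    have e2 : f.mapDomain τ 1 = f 1 := by conv_lhs => rw [← hτ1, hm]
    simp only [e1, e2]
    congr 2
    symm
    refine Finset.prod_equiv τ (fun i => ?_) fun i _ => by rw [hm]
    have h3 : ∀ i, i ∈ Finset.Icc 2 q ↔ i ∈ Finset.Icc 1 q ∧ i ≠ 1 := fun i => by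
      simp only [Finset.mem_Icc]; omega
    have e3 : τ i = 1 ↔ i = 1 := by
      conv_lhs => rw [← hτ1]
      exact τ.injective.eq_iff
    rw [h3, h3, hτ, ne_eq, ne_eq, e3]

end Words

end SparseHypergraph

end

noncomputable section

namespace SparseHypergraph

/-! ### The recurrence as a sum over words in a hyperedge -/

/-- The generating function of the closed walks at the root that leave the hyperedge of the first
step: `f` slots are filled with `r - f` excursions. -/
def rootSeries (S : ℕ → ℕ → ℝ) (r f : ℕ) : PowerSeries ℝ :=
  PowerSeries.mk fun u => if f ≤ r then (Nat.multichoose f (r - f) : ℝ) * S u (r - f) else 0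

/-- The generating function of the closed walks at another vertex of that hyperedge. -/
def childSeries (S : ℕ → ℕ → ℝ) (f : ℕ) : PowerSeries ℝ :=
  PowerSeries.mk fun u => ∑ v ∈ Finset.range (u / 2 + 1), (Nat.multichoose f v : ℝ) * S u v

theorem childSeries_zero {S : ℕ → ℕ → ℝ} (hS : ∀ u, S u 0 = if u = 0 then 1 else 0) :
    childSeries S 0 = 1 := by
  ext u
  rw [childSeries, PowerSeries.coeff_mk, Finset.sum_range_succ', PowerSeries.coeff_one]
  simp [hS]

theorem multichoose_eq_choose_pred {f : ℕ} (hf : 1 ≤ f) (v : ℕ) :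
    Nat.multichoose f v = (f + v - 1).choose (f - 1) := by
  rw [Nat.multichoose_eq, ← Nat.choose_symm (by omega)]
  congr 1
  omega

theorem coeff_mul_prod_Icc {ϰ : ℕ} (hϰ : 1 ≤ ϰ) (n : ℕ) (A : PowerSeries ℝ)
    (B : ℕ → PowerSeries ℝ) :
    PowerSeries.coeff n (A * ∏ i ∈ Finset.Icc 2 ϰ, B i)
      = ∑ u ∈ (Finset.Icc 1 ϰ).finsuppAntidiag n, PowerSeries.coeff (u 1) A *
          ∏ i ∈ Finset.Icc 2 ϰ, PowerSeries.coeff (u i) (B i) := by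
  have hset : Finset.Icc 1 ϰ = insert 1 (Finset.Icc 2 ϰ) := by
    ext i; simp only [Finset.mem_Icc, Finset.mem_insert]; omega
  have hn : 1 ∉ Finset.Icc 2 ϰ := by simp
  have h := PowerSeries.coeff_prod (fun i => if i = 1 then A else B i) n (Finset.Icc 1 ϰ)
  have hne : ∀ i ∈ Finset.Icc 2 ϰ, i ≠ 1 := fun i hi => by rw [Finset.mem_Icc] at hi; omega
  rw [hset, Finset.prod_insert hn, if_pos rfl,
    Finset.prod_congr rfl fun i hi => if_neg (hne i hi)] at h
  rw [h, hset]
  refine Finset.sum_congr rfl fun u _ => ?_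
  rw [Finset.prod_insert hn, if_pos rfl]
  congr 1
  exact Finset.prod_congr rfl fun i hi => by rw [if_neg (hne i hi)]

/-- A word with `ϰ` visited vertices has `(q - 1)! / (q - ϰ)!` labellings in `e`, which explains the
factor `1 / (q - ϰ)!` of the recurrence. By `hS` an unvisited vertex contributes the factor `1`. In
this form the recurrence can be compared term by term with the expansion of the walks. -/
theorem momentStep_eq_wordSum {q : ℕ} (p : ℝ) (X : ℕ → ℝ) {S : ℕ → ℕ → ℝ}
    (hS : ∀ u, S u 0 = if u = 0 then 1 else 0) (l r : ℕ) {e : Finset ℕ} {x : ℕ}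
    (hx : x ∈ e) (he : e.card = q) :
    momentStep q p X S l r = p / ((q - 1).factorial : ℝ) * ∑ F ∈ Finset.Icc 1 l, X F *
      wordSum e x F fun j f => if j = x then PowerSeries.coeff (l - F)
        (rootSeries S r (f x) * ∏ z ∈ e.erase x, childSeries S (f z)) else 0 := by
  have hd : ∀ ϰ ∈ Finset.Icc 1 q, ((q - 1).descFactorial (ϰ - 1) : ℝ)
      = ((q - 1).factorial : ℝ) * (1 / ((q - ϰ).factorial : ℝ)) := by
    intro ϰ hϰ
    rw [Finset.mem_Icc] at hϰ
    have h1 := Nat.factorial_mul_descFactorial (n := q - 1) (k := ϰ - 1) (by omega)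
    rw [show q - 1 - (ϰ - 1) = q - ϰ by omega] at h1
    have h2 : ((q - ϰ).factorial : ℝ) ≠ 0 := Nat.cast_ne_zero.2 (Nat.factorial_ne_zero _)
    rw [← h1]
    push_cast
    field_simp
  have hw : ∀ F ∈ Finset.Icc 1 l, (wordSum e x F fun j f => if j = x then
      PowerSeries.coeff (l - F) (rootSeries S r (f x) * ∏ z ∈ e.erase x, childSeries S (f z)) else 0)
      = ((q - 1).factorial : ℝ) * ∑ ϰ ∈ Finset.Icc 1 q,
        ∑ f ∈ (Finset.Icc 1 ϰ).finsuppAntidiag F with (∀ i ∈ Finset.Icc 1 ϰ, 1 ≤ f i) ∧ f 1 ≤ r,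
        1 / ((q - ϰ).factorial : ℝ) * (walkNumber ϰ 1 f : ℝ) *
        ∑ u ∈ (Finset.Icc 1 ϰ).finsuppAntidiag (l - F),
          ((r - 1).choose (f 1 - 1) : ℝ) * S (u 1) (r - f 1) *
            ∏ i ∈ Finset.Icc 2 ϰ, ∑ v ∈ Finset.range (u i / 2 + 1),
              ((f i + v - 1).choose (f i - 1) : ℝ) * S (u i) v := by
    intro F hF
    have h := congrArg (PowerSeries.coeff (R := ℝ) (l - F)) (wordSum_closed hx he (rootSeries S r)
      (childSeries S) (childSeries_zero hS) F)
    have h' := map_wordSum (e := e) (x := x) (PowerSeries.coeff (R := ℝ) (l - F)).toAddMonoidHom F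
      (fun j f => if j = x then rootSeries S r (f x) * ∏ z ∈ e.erase x, childSeries S (f z) else 0)
    simp only [LinearMap.toAddMonoidHom_coe] at h'
    rw [h'] at h
    simp only [apply_ite (PowerSeries.coeff (R := ℝ) (l - F)), map_zero] at h
    rw [h, map_sum, Finset.mul_sum]
    refine Finset.sum_congr rfl fun ϰ hϰ => ?_
    have hϰ1 := (Finset.mem_Icc.1 hϰ).1
    have h1 : 1 ∈ Finset.Icc 1 ϰ := Finset.mem_Icc.2 ⟨le_rfl, hϰ1⟩
    rw [← map_natCast (PowerSeries.C (R := ℝ)), PowerSeries.coeff_C_mul, hd ϰ hϰ, map_sum, mul_assoc,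
      Finset.mul_sum (a := 1 / ((q - ϰ).factorial : ℝ))]
    congr 1
    rw [Finset.sum_filter]
    refine Finset.sum_congr rfl fun f hf => ?_
    rw [← map_natCast (PowerSeries.C (R := ℝ)), PowerSeries.coeff_C_mul, coeff_mul_prod_Icc hϰ1]
    split_ifs with hfr
    · rw [mul_assoc]
      congr 2
      refine Finset.sum_congr rfl fun u _ => ?_
      rw [rootSeries, PowerSeries.coeff_mk, if_pos hfr.2, multichoose_eq_choose_pred (hfr.1 1 h1),
        Nat.add_sub_cancel' hfr.2]
      congr 1
      refine Finset.prod_congr rfl fun i hi => ?_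
      rw [childSeries, PowerSeries.coeff_mk]
      refine Finset.sum_congr rfl fun v _ => ?_
      rw [multichoose_eq_choose_pred (hfr.1 i (Finset.Icc_subset_Icc_left (by omega) hi))]
    -- The terms excluded from the recurrence vanish: either `walkNumber` is zero, or the root would
    -- have to be left more than `r` times.
    · by_cases hr : f 1 ≤ r
      · have hf0 : f ≠ 0 := by
          rintro rfl
          have := (Finset.mem_finsuppAntidiag.1 hf).1
          rw [Finset.mem_Icc] at hF
          simp at this
          omega
        have hK : walkNumber ϰ 1 f = 0 := by
          by_contra hK
          exact hfr ⟨walkNumber_closed_ne_zero hϰ1 hf0 hK, hr⟩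
        simp [hK]
      · rw [Finset.sum_eq_zero, mul_zero, mul_zero]
        intro u _
        rw [rootSeries, PowerSeries.coeff_mk, if_neg hr, zero_mul]
  have hq0 : ((q - 1).factorial : ℝ) ≠ 0 := Nat.cast_ne_zero.2 (Nat.factorial_ne_zero _)
  rw [momentStep, div_mul_eq_mul_div, mul_div_assoc, Finset.sum_div]
  congr 1
  refine Finset.sum_congr rfl fun F hF => ?_
  rw [hw F hF, mul_div_assoc]
  congr 1
  field_simp

end SparseHypergraph

end

noncomputable section

namespace SparseHypergraph

/-! ### Moments and weights of monomials in the hyperedge variables -/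

/-- Polynomials in the hyperedge variables `some e` and the departure marker `none`. -/
abbrev EdgePoly : Type := MvPolynomial (Option (Finset ℕ)) ℝ

/-- The variable of a hyperedge. -/
def edgeVar (e : Finset ℕ) : EdgePoly := MvPolynomial.X (some e)

/-- The variable that marks departures from a vertex. -/
def marker : EdgePoly := MvPolynomial.X none

/-- The polynomials that do not contain the variable `i`. -/
def freeOf (i : Option (Finset ℕ)) : Subring EdgePoly :=
  (MvPolynomial.supported ℝ {i}ᶜ).toSubring

theorem eq_zero_of_mem_supported {T : Set (Option (Finset ℕ))} {P : EdgePoly}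
    (hP : P ∈ MvPolynomial.supported ℝ T) {i : Option (Finset ℕ)} (hi : i ∉ T)
    {m : Option (Finset ℕ) →₀ ℕ} (hm : m ∈ P.support) : m i = 0 := by
  by_contra h
  exact hi (MvPolynomial.mem_supported.1 hP
    (MvPolynomial.mem_vars_iff_mem_support i |>.2 ⟨m, hm, Finsupp.mem_support_iff.2 h⟩))

theorem eq_zero_of_mem_freeOf {i : Option (Finset ℕ)} {P : EdgePoly} (hP : P ∈ freeOf i)
    {m : Option (Finset ℕ) →₀ ℕ} (hm : m ∈ P.support) : m i = 0 :=
  eq_zero_of_mem_supported hP (by simp) hm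

theorem edgeVar_mem_freeOf {i : Option (Finset ℕ)} {e : Finset ℕ} (h : some e ≠ i) :
    edgeVar e ∈ freeOf i :=
  (MvPolynomial.X_mem_supported (R := ℝ)).2 (by simpa using h)

theorem C_mem_freeOf (i : Option (Finset ℕ)) (a : ℝ) : MvPolynomial.C a ∈ freeOf i :=
  (MvPolynomial.supported ℝ {i}ᶜ).algebraMap_mem a

/-- The moment of order `F` of the product of a weight and an indicator. -/
def edgeMoment (c : ℝ) (X : ℕ → ℝ) (F : ℕ) : ℝ := if F = 0 then 1 else c * X F

/-- The moment of a monomial; the exponent of the marker is prescribed to be `r`. -/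
def monoMoment (H : Finset (Finset ℕ)) (c : ℝ) (X : ℕ → ℝ) (r : ℕ)
    (m : Option (Finset ℕ) →₀ ℕ) : ℝ :=
  if m none = r then ∏ e ∈ H, edgeMoment c X (m (some e)) else 0

/-- The linear functional on polynomials given by the moments of the monomials. -/
def momentFun (H : Finset (Finset ℕ)) (c : ℝ) (X : ℕ → ℝ) (r : ℕ) : EdgePoly →ₗ[ℝ] ℝ :=
  (MvPolynomial.basisMonomials (Option (Finset ℕ)) ℝ).constr ℝ (monoMoment H c X r)

/-! ### Independence and the marker under the moment functional -/

section Moments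

variable {H : Finset (Finset ℕ)} {c : ℝ} {X : ℕ → ℝ} {r : ℕ}

theorem momentFun_monomial (m : Option (Finset ℕ) →₀ ℕ) (a : ℝ) :
    momentFun H c X r (MvPolynomial.monomial m a) = a * monoMoment H c X r m := by
  have h : MvPolynomial.monomial m a
      = a • (MvPolynomial.basisMonomials (Option (Finset ℕ)) ℝ) m := by
    rw [MvPolynomial.coe_basisMonomials, MvPolynomial.smul_monomial, smul_eq_mul, mul_one]
  rw [h, map_smul, momentFun, Module.Basis.constr_basis, smul_eq_mul]

theorem momentFun_eq_sum (P : EdgePoly) :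
    momentFun H c X r P
      = ∑ m ∈ P.support, MvPolynomial.coeff m P * monoMoment H c X r m := by
  conv_lhs => rw [← MvPolynomial.support_sum_monomial_coeff P, map_sum]
  simp only [momentFun_monomial]

theorem momentFun_C_mul (a : ℝ) (P : EdgePoly) :
    momentFun H c X r (MvPolynomial.C a * P) = a * momentFun H c X r P := by
  rw [← MvPolynomial.smul_eq_C_mul, map_smul, smul_eq_mul]

theorem momentFun_one : momentFun H c X 0 1 = 1 := by
  rw [← MvPolynomial.C_1, ← MvPolynomial.monomial_zero', momentFun_monomial]
  simp [monoMoment, edgeMoment]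

/-- The variable of a hyperedge is independent of the others. -/
theorem momentFun_edgeVar_pow_mul {e : Finset ℕ} (he : e ∈ H) {F : ℕ} (hF : F ≠ 0) {Q : EdgePoly}
    (hQ : Q ∈ freeOf (some e)) :
    momentFun H c X r (edgeVar e ^ F * Q) = c * X F * momentFun H c X r Q := by
  conv_lhs => rw [← MvPolynomial.support_sum_monomial_coeff Q, Finset.mul_sum, map_sum]
  rw [momentFun_eq_sum, Finset.mul_sum]
  refine Finset.sum_congr rfl fun m hm => ?_
  have h0 := eq_zero_of_mem_freeOf hQ hm
  rw [edgeVar, MvPolynomial.X_pow_eq_monomial, MvPolynomial.monomial_mul, one_mul,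
    momentFun_monomial]
  have h1 : monoMoment H c X r (Finsupp.single (some e) F + m)
      = c * X F * monoMoment H c X r m := by
    have hn : (Finsupp.single (some e) F + m) none = m none := by simp
    simp only [monoMoment, hn]
    split_ifs with h
    · rw [← Finset.mul_prod_erase H _ he, ← Finset.mul_prod_erase H
        (fun e => edgeMoment c X (m (some e))) he]
      have h2 : ∏ e' ∈ H.erase e, edgeMoment c X
          ((Finsupp.single (some e) F + m : Option (Finset ℕ) →₀ ℕ) (some e'))
          = ∏ e' ∈ H.erase e, edgeMoment c X (m (some e')) :=
        Finset.prod_congr rfl fun e' he' => by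
          rw [Finsupp.add_apply, Finsupp.single_eq_of_ne (by simpa using Finset.ne_of_mem_erase he'), zero_add]
      rw [h2, Finsupp.add_apply, h0]
      simp [edgeMoment, hF]
    · simp
  rw [h1]
  ring

/-- The functional extracts the power of the marker. -/
theorem momentFun_marker_pow_mul (k : ℕ) {Q : EdgePoly} (hQ : Q ∈ freeOf none) :
    momentFun H c X r (marker ^ k * Q) = if k = r then momentFun H c X 0 Q else 0 := by
  conv_lhs => rw [← MvPolynomial.support_sum_monomial_coeff Q, Finset.mul_sum, map_sum]
  rw [momentFun_eq_sum, ← Finset.sum_filter_add_sum_filter_not _ (fun _ => k = r)]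
  have h0 : ∀ m ∈ Q.support, m none = 0 := fun m hm => eq_zero_of_mem_freeOf hQ hm
  have key : ∀ m ∈ Q.support, momentFun H c X r
      (marker ^ k * MvPolynomial.monomial m (MvPolynomial.coeff m Q))
      = if k = r then MvPolynomial.coeff m Q * monoMoment H c X 0 m else 0 := by
    intro m hm
    rw [marker, MvPolynomial.X_pow_eq_monomial, MvPolynomial.monomial_mul, one_mul,
      momentFun_monomial, monoMoment, monoMoment, if_pos (h0 m hm)]
    simp [h0 m hm]
  rw [Finset.sum_filter_add_sum_filter_not, Finset.sum_congr rfl key]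
  split_ifs
  · rfl
  · simp

end Moments

/-- The weight of an exponent, an upper bound for the moments. -/
def edgeWeight (c K : ℝ) (F : ℕ) : ℝ := if F = 0 then 1 else c * (K ^ F * F.factorial)

/-- The degree of a monomial in the variables of the hyperedges of `H`. -/
def edgeDegree (H : Finset (Finset ℕ)) (m : Option (Finset ℕ) →₀ ℕ) : ℕ := ∑ e ∈ H, m (some e)

/-- The weight of a monomial; monomials of degree greater than `D` are neglected. -/
def monoWeight (H : Finset (Finset ℕ)) (c K : ℝ) (D : ℕ) (m : Option (Finset ℕ) →₀ ℕ) : ℝ :=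
  if edgeDegree H m ≤ D then ∏ e ∈ H, edgeWeight c K (m (some e)) else 0

/-! ### Degree bounds and the cost of multiplication by a variable -/

section Weights

variable {H : Finset (Finset ℕ)} {c K : ℝ} {D : ℕ}

theorem edgeWeight_nonneg (hc : 0 ≤ c) (hK : 0 ≤ K) (F : ℕ) : 0 ≤ edgeWeight c K F := by
  unfold edgeWeight
  split_ifs <;> positivity

theorem monoWeight_nonneg (hc : 0 ≤ c) (hK : 0 ≤ K) : 0 ≤ monoWeight H c K D := fun m => by
  unfold monoWeight
  split_ifs
  · exact Finset.prod_nonneg fun e _ => edgeWeight_nonneg hc hK _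
  · exact le_rfl

theorem edgeDegree_add (m m' : Option (Finset ℕ) →₀ ℕ) :
    edgeDegree H (m + m') = edgeDegree H m + edgeDegree H m' := by
  simp [edgeDegree, Finset.sum_add_distrib]

/-- All monomials have degree at most `d` in the variables of `H`. -/
def EdgeDegreeLE (H : Finset (Finset ℕ)) (d : ℕ) (P : EdgePoly) : Prop :=
  ∀ m ∈ P.support, edgeDegree H m ≤ d

theorem EdgeDegreeLE.mono {d d' : ℕ} {P : EdgePoly} (h : EdgeDegreeLE H d P) (hd : d ≤ d') :
    EdgeDegreeLE H d' P := fun m hm => (h m hm).trans hd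

theorem EdgeDegreeLE.add {d : ℕ} {P Q : EdgePoly} (hP : EdgeDegreeLE H d P)
    (hQ : EdgeDegreeLE H d Q) : EdgeDegreeLE H d (P + Q) := fun m hm => by
  rcases Finset.mem_union.1 (MvPolynomial.support_add hm) with h | h
  exacts [hP m h, hQ m h]

theorem EdgeDegreeLE.neg {d : ℕ} {P : EdgePoly} (hP : EdgeDegreeLE H d P) :
    EdgeDegreeLE H d (-P) := fun m hm => hP m (by rwa [MvPolynomial.support_neg] at hm)

theorem EdgeDegreeLE.zero (d : ℕ) : EdgeDegreeLE H d 0 := fun m hm => by simp at hm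

theorem EdgeDegreeLE.sum {d : ℕ} {α : Type*} (s : Finset α) {P : α → EdgePoly}
    (h : ∀ i ∈ s, EdgeDegreeLE H d (P i)) : EdgeDegreeLE H d (∑ i ∈ s, P i) :=
  Finset.sum_induction _ _ (fun _ _ => EdgeDegreeLE.add) (EdgeDegreeLE.zero d) h

theorem EdgeDegreeLE.mul {d d' : ℕ} {P Q : EdgePoly} (hP : EdgeDegreeLE H d P)
    (hQ : EdgeDegreeLE H d' Q) : EdgeDegreeLE H (d + d') (P * Q) := fun m hm => by
  obtain ⟨a, ha, b, hb, rfl⟩ := Finset.mem_add.1 (MvPolynomial.support_mul P Q hm)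
  rw [edgeDegree_add]
  exact add_le_add (hP a ha) (hQ b hb)

theorem EdgeDegreeLE.C (a : ℝ) : EdgeDegreeLE H 0 (MvPolynomial.C a) := fun m hm => by
  have := MvPolynomial.support_monomial_subset (s := 0) (a := a) hm
  rw [Finset.mem_singleton] at this
  subst this
  simp [edgeDegree]

theorem EdgeDegreeLE.one : EdgeDegreeLE H 0 1 := EdgeDegreeLE.C 1

theorem EdgeDegreeLE.marker : EdgeDegreeLE H 0 marker := fun m hm => by
  have := MvPolynomial.support_monomial_subset (s := Finsupp.single none 1) (a := (1 : ℝ)) hm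
  rw [Finset.mem_singleton] at this
  subst this
  simp [edgeDegree]

theorem EdgeDegreeLE.edgeVar (e : Finset ℕ) : EdgeDegreeLE H 1 (edgeVar e) := fun m hm => by
  have := MvPolynomial.support_monomial_subset (s := Finsupp.single (some e) 1) (a := (1 : ℝ)) hm
  rw [Finset.mem_singleton] at this
  subst this
  simp only [edgeDegree, Finsupp.single_apply, Option.some_inj]
  rw [Finset.sum_ite_eq]
  split_ifs <;> simp

theorem EdgeDegreeLE.prod {α : Type*} (s : Finset α) {d : α → ℕ} {P : α → EdgePoly}
    (h : ∀ i ∈ s, EdgeDegreeLE H (d i) (P i)) : EdgeDegreeLE H (∑ i ∈ s, d i) (∏ i ∈ s, P i) := by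
  classical
  induction s using Finset.induction_on with
  | empty => simpa using EdgeDegreeLE.one
  | insert a s ha ih =>
    rw [Finset.sum_insert ha, Finset.prod_insert ha]
    exact (h a (Finset.mem_insert_self _ _)).mul (ih fun i hi => h i (Finset.mem_insert_of_mem hi))

/-- The power series whose `l`-th coefficient has degree at most `l`. -/
def gradedSeries (H : Finset (Finset ℕ)) : Subring (PowerSeries EdgePoly) where
  carrier := {F | ∀ l, EdgeDegreeLE H l (PowerSeries.coeff l F)}
  mul_mem' {F G} hF hG l := by
    rw [PowerSeries.coeff_mul]
    refine EdgeDegreeLE.sum _ fun a ha => ?_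
    rw [← Finset.HasAntidiagonal.mem_antidiagonal.1 ha]
    exact (hF _).mul (hG _)
  one_mem' l := by
    rw [PowerSeries.coeff_one]
    split_ifs
    exacts [EdgeDegreeLE.one.mono (Nat.zero_le _), EdgeDegreeLE.zero _]
  add_mem' {F G} hF hG l := by rw [map_add]; exact (hF l).add (hG l)
  zero_mem' l := by rw [map_zero]; exact EdgeDegreeLE.zero _
  neg_mem' {F} hF l := by rw [map_neg]; exact (hF l).neg

theorem C_mem_gradedSeries {P : EdgePoly} (h : EdgeDegreeLE H 0 P) :
    PowerSeries.C P ∈ gradedSeries H := fun l => by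
  rw [PowerSeries.coeff_C]
  split_ifs
  exacts [h.mono (Nat.zero_le _), EdgeDegreeLE.zero _]

theorem X_mul_edgeVar_mem_gradedSeries (e : Finset ℕ) :
    PowerSeries.X * PowerSeries.C (edgeVar e) ∈ gradedSeries H := fun l => by
  cases l with
  | zero => rw [PowerSeries.coeff_zero_X_mul]; exact EdgeDegreeLE.zero _
  | succ l =>
    rw [PowerSeries.coeff_succ_X_mul, PowerSeries.coeff_C]
    split_ifs
    exacts [(EdgeDegreeLE.edgeVar e).mono (by omega), EdgeDegreeLE.zero _]

theorem walkSeries_mem_gradedSeries {σ : ℕ → EdgePoly} (hσ : ∀ i, EdgeDegreeLE H 0 (σ i))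
    (H' : Finset (Finset ℕ)) (i j : ℕ) : walkSeries σ edgeVar H' i j ∈ gradedSeries H := fun l => by
  rw [coeff_walkSeries]
  induction l generalizing i with
  | zero =>
    rw [walkPoly]
    split_ifs
    exacts [EdgeDegreeLE.one, EdgeDegreeLE.zero _]
  | succ l ih =>
    rw [walkPoly, show l + 1 = 0 + (1 + l) by omega]
    exact (hσ i).mul (EdgeDegreeLE.sum _ fun e _ => (EdgeDegreeLE.edgeVar e).mul
      (EdgeDegreeLE.sum _ fun k _ => ih k))

theorem stepSeries_mem_gradedSeries {σ : ℕ → EdgePoly} (hσ : ∀ i, EdgeDegreeLE H 0 (σ i))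
    (H' : Finset (Finset ℕ)) (i j : ℕ) : stepSeries σ edgeVar H' i j ∈ gradedSeries H := by
  rw [stepSeries, stepSum, Finset.mul_sum]
  refine sum_mem fun e _ => ?_
  rw [← mul_assoc]
  exact mul_mem (X_mul_edgeVar_mem_gradedSeries e)
    (sum_mem fun k _ => walkSeries_mem_gradedSeries hσ H' k j)

/-- Admissible vertex weights: `0`, `1`, or the marker. -/
def IsVertexWeight (a : EdgePoly) : Prop := a = 0 ∨ a = 1 ∨ a = marker

theorem IsVertexWeight.edgeDegreeLE {a : EdgePoly} (h : IsVertexWeight a) :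
    EdgeDegreeLE H 0 a := by
  rcases h with rfl | rfl | rfl
  exacts [EdgeDegreeLE.zero 0, EdgeDegreeLE.one, EdgeDegreeLE.marker]

theorem isVertexWeight_update {a : EdgePoly} (h : IsVertexWeight a) (x i : ℕ) :
    IsVertexWeight (Function.update (1 : ℕ → EdgePoly) x a i) := by
  by_cases hi : i = x
  · subst hi; rwa [Function.update_self]
  · rw [Function.update_of_ne hi]; exact Or.inr (Or.inl rfl)

theorem returnSeries_mem_gradedSeries (H' : Finset (Finset ℕ)) (x : ℕ) :
    returnSeries edgeVar H' x ∈ gradedSeries H :=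
  stepSeries_mem_gradedSeries (fun i => (isVertexWeight_update (Or.inl rfl) x i).edgeDegreeLE) H' x x

theorem closedWalk_edgeDegreeLE (H' : Finset (Finset ℕ)) (x l r : ℕ) :
    EdgeDegreeLE H l (closedWalk edgeVar H' x l r) :=
  pow_mem (returnSeries_mem_gradedSeries H' x) r l

/-- The weight dominates the moment monomial by monomial. The degree hypothesis is essential,
because the norm ignores monomials of degree above `D`; `gradedSeries` is there to supply it. -/
theorem abs_momentFun_le (hc : 0 ≤ c) (hK : 0 ≤ K) {X : ℕ → ℝ}
    (hX : ∀ F, |X F| ≤ K ^ F * F.factorial) (r : ℕ) {P : EdgePoly} (hP : EdgeDegreeLE H D P) :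
    |momentFun H c X r P| ≤ wnorm (monoWeight H c K D) P := by
  rw [momentFun_eq_sum]
  refine (Finset.abs_sum_le_sum_abs _ _).trans (Finset.sum_le_sum fun m hm => ?_)
  rw [abs_mul]
  refine mul_le_mul_of_nonneg_left ?_ (abs_nonneg _)
  rw [monoMoment, monoWeight, if_pos (hP m hm)]
  split_ifs
  · rw [Finset.abs_prod]
    refine Finset.prod_le_prod (fun _ _ => abs_nonneg _) fun e _ => ?_
    unfold edgeMoment edgeWeight
    split_ifs
    · simp
    · rw [abs_mul, abs_of_nonneg hc]
      exact mul_le_mul_of_nonneg_left (hX _) hc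
  · rw [abs_zero]
    exact Finset.prod_nonneg fun e _ => edgeWeight_nonneg hc hK _

/-- The ratio of consecutive weights of one variable: a first occurrence costs `K * c`, and a
repetition costs `K * (F + 1)` by the factorial. -/
theorem monoWeight_add_edge_le (hc : 0 ≤ c) (hK : 0 ≤ K) {e : Finset ℕ} (he : e ∈ H)
    (m : Option (Finset ℕ) →₀ ℕ) :
    monoWeight H c K D (m + Finsupp.single (some e) 1)
      ≤ K * (if m (some e) = 0 then c else m (some e) + 1) * monoWeight H c K D m := by
  have hR : 0 ≤ K * (if m (some e) = 0 then c else m (some e) + 1) * monoWeight H c K D m := by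
    refine mul_nonneg (mul_nonneg hK ?_) (monoWeight_nonneg hc hK m)
    split_ifs <;> positivity
  by_cases hd : edgeDegree H (m + Finsupp.single (some e) 1) ≤ D
  · have hd' : edgeDegree H m ≤ D := by rw [edgeDegree_add] at hd; omega
    rw [monoWeight, if_pos hd, monoWeight, if_pos hd', ← Finset.mul_prod_erase H _ he,
      ← Finset.mul_prod_erase H (fun e => edgeWeight c K (m (some e))) he]
    have h2 : ∏ e' ∈ H.erase e, edgeWeight c K
        ((m + Finsupp.single (some e) 1 : Option (Finset ℕ) →₀ ℕ) (some e'))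
        = ∏ e' ∈ H.erase e, edgeWeight c K (m (some e')) :=
      Finset.prod_congr rfl fun e' he' => by
        rw [Finsupp.add_apply,
          Finsupp.single_eq_of_ne (by simpa using Finset.ne_of_mem_erase he'), add_zero]
    rw [h2, ← mul_assoc]
    refine mul_le_mul_of_nonneg_right (le_of_eq ?_)
      (Finset.prod_nonneg fun e _ => edgeWeight_nonneg hc hK _)
    rw [Finsupp.add_apply, Finsupp.single_eq_same]
    unfold edgeWeight
    rw [if_neg (Nat.succ_ne_zero _)]
    split_ifs with h
    · rw [h]; simp; ring
    · rw [Nat.factorial_succ]; push_cast; ring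
  · rw [monoWeight, if_neg hd]
    exact hR

theorem wnorm_monomial_mul_edgeVar (m : Option (Finset ℕ) →₀ ℕ) (e : Finset ℕ) :
    wnorm (monoWeight H c K D) (MvPolynomial.monomial m 1 * edgeVar e)
      = monoWeight H c K D (m + Finsupp.single (some e) 1) := by
  rw [edgeVar, MvPolynomial.X, MvPolynomial.monomial_mul, wnorm_monomial]
  simp

theorem mulBound_marker (hc : 0 ≤ c) (hK : 0 ≤ K) :
    MulBound (monoWeight H c K D) 1 marker := fun P => by
  refine wnorm_mul_le (monoWeight_nonneg hc hK) P _ 1 fun m _ => le_of_eq ?_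
  rw [marker, MvPolynomial.X, MvPolynomial.monomial_mul, wnorm_monomial]
  have h : ∀ e, (m + Finsupp.single none 1 : Option (Finset ℕ) →₀ ℕ) (some e) = m (some e) := by
    simp
  have hd : edgeDegree H (m + Finsupp.single none 1) = edgeDegree H m :=
    Finset.sum_congr rfl fun e _ => h e
  rw [mul_one, abs_one, one_mul, one_mul, monoWeight, monoWeight, hd,
    Finset.prod_congr rfl fun e _ => congrArg (edgeWeight c K) (h e)]

theorem IsVertexWeight.mulBound (hc : 0 ≤ c) (hK : 0 ≤ K) {a : EdgePoly} (h : IsVertexWeight a) :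
    MulBound (monoWeight H c K D) 1 a := by
  rcases h with rfl | rfl | rfl
  · exact MulBound.zero.mono (monoWeight_nonneg hc hK) zero_le_one
  · exact MulBound.one
  · exact mulBound_marker hc hK

/-- A new hyperedge variable costs a factor `c`. -/
theorem wnorm_mul_edgeVar_le_of_free (hc : 0 ≤ c) (hK : 0 ≤ K) {e : Finset ℕ} (he : e ∈ H)
    {P : EdgePoly} (hP : ∀ m ∈ P.support, m (some e) = 0) :
    wnorm (monoWeight H c K D) (P * edgeVar e) ≤ K * c * wnorm (monoWeight H c K D) P := by
  refine wnorm_mul_le (monoWeight_nonneg hc hK) P _ _ fun m hm => ?_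
  rw [wnorm_monomial_mul_edgeVar]
  refine (monoWeight_add_edge_le hc hK he m).trans (le_of_eq ?_)
  rw [if_pos (hP m hm)]

/-- One step of a walk. -/
theorem sum_wnorm_mul_edgeVar_le (hc : 0 ≤ c) (hK : 0 ≤ K) {s : Finset (Finset ℕ)} (hs : s ⊆ H)
    {p : ℝ} (hp : s.card * c ≤ p) (P : EdgePoly) :
    ∑ e ∈ s, wnorm (monoWeight H c K D) (P * edgeVar e)
      ≤ K * (2 * D + p) * wnorm (monoWeight H c K D) P := by
  have hp0 : 0 ≤ p := le_trans (by positivity) hp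
  refine sum_wnorm_mul_le (monoWeight_nonneg hc hK) s P edgeVar _ fun m _ => ?_
  have hw0 := monoWeight_nonneg (H := H) (D := D) hc hK m
  simp only [wnorm_monomial_mul_edgeVar]
  by_cases hd : edgeDegree H m ≤ D
  · have h1 : ∑ e ∈ s, (if m (some e) = 0 then c else (m (some e) : ℝ) + 1) ≤ 2 * D + p := by
      calc _ ≤ ∑ e ∈ s, (c + 2 * (m (some e) : ℝ)) := by
            refine Finset.sum_le_sum fun e _ => ?_
            split_ifs with h
            · rw [h]; simp
            · have : (1 : ℝ) ≤ m (some e) := by exact_mod_cast Nat.one_le_iff_ne_zero.2 h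
              linarith
        _ = s.card * c + 2 * ((∑ e ∈ s, m (some e) : ℕ) : ℝ) := by
            rw [Finset.sum_add_distrib, Finset.sum_const, nsmul_eq_mul, ← Finset.mul_sum]
            push_cast; ring
        _ ≤ p + 2 * D := by
            have : (∑ e ∈ s, m (some e)) ≤ D :=
              (Finset.sum_le_sum_of_subset hs).trans hd
            have : ((∑ e ∈ s, m (some e) : ℕ) : ℝ) ≤ D := by exact_mod_cast this
            linarith
        _ = _ := by ring
    calc _ ≤ ∑ e ∈ s, K * (if m (some e) = 0 then c else (m (some e) : ℝ) + 1)
            * monoWeight H c K D m :=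
          Finset.sum_le_sum fun e he => monoWeight_add_edge_le hc hK (hs he) m
      _ = K * (∑ e ∈ s, (if m (some e) = 0 then c else (m (some e) : ℝ) + 1))
            * monoWeight H c K D m := by rw [← Finset.sum_mul, Finset.mul_sum]
      _ ≤ _ := by gcongr
  -- Beyond degree `D` the products have weight zero; this truncation makes the bound hold for every
  -- polynomial.
  · rw [Finset.sum_eq_zero]
    · exact mul_nonneg (by positivity) hw0
    · intro e _
      rw [monoWeight, if_neg (by rw [edgeDegree_add]; omega)]

end Weights

end SparseHypergraph

end

noncomputable section

namespace SparseHypergraph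

/-! ### Estimates for the walk series -/

theorem card_edges_superset_le (N q : ℕ) {T : Finset ℕ} :
    ((hyperedges N q).filter (T ⊆ ·)).card ≤ N ^ (q - T.card) := by
  have h : ((hyperedges N q).filter (T ⊆ ·)).card
      ≤ ((Finset.range N).powersetCard (q - T.card)).card := by
    refine Finset.card_le_card_of_injOn (· \ T) (fun e he => ?_) fun e he e' he' h => ?_
    · rw [Finset.mem_coe, Finset.mem_filter, Finset.mem_powersetCard] at he
      rw [Finset.mem_coe, Finset.mem_powersetCard]
      exact ⟨Finset.sdiff_subset.trans he.1.1, by rw [Finset.card_sdiff_of_subset he.2, he.1.2]⟩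
    · rw [Finset.mem_coe, Finset.mem_filter] at he he'
      rw [← Finset.sdiff_union_of_subset he.2, ← Finset.sdiff_union_of_subset he'.2]
      exact congrArg (· ∪ T) h
  refine h.trans ?_
  rw [Finset.card_powersetCard, Finset.card_range]
  exact Nat.choose_le_pow _ _

theorem card_edge_erase_le {N q : ℕ} {e : Finset ℕ} (he : e ∈ hyperedges N q) (v : ℕ) :
    ((e.erase v).card : ℝ) ≤ q := by
  rw [← (Finset.mem_powersetCard.1 he).2]
  exact_mod_cast Finset.card_erase_le

/-- The probability of a hyperedge. -/
def edgeProb (q N : ℕ) (p : ℝ) : ℝ := p / (N : ℝ) ^ (q - 1)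

/-- The standing assumptions on the parameters. -/
structure IsScale (q N : ℕ) (p K : ℝ) : Prop where
  two_le : 2 ≤ q
  pos : 0 < p
  le : p ≤ N
  one_le : 1 ≤ K

/-- The weights of the monomials for the random hypergraph. -/
abbrev scaleWeight (q N : ℕ) (p K : ℝ) (D : ℕ) : (Option (Finset ℕ) →₀ ℕ) → ℝ :=
  monoWeight (hyperedges N q) (edgeProb q N p) K D

/-- The bound for one step of a walk. -/
def stepConst (q : ℕ) (p K : ℝ) (D : ℕ) : ℝ := q * K * (2 * D + p + 1)

/-- The bound for a walk series. -/
def walkConst (q : ℕ) (p K : ℝ) (D : ℕ) : ℝ := (D + 1) * stepConst q p K D ^ D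

namespace IsScale

variable {q N : ℕ} {p K : ℝ} (h : IsScale q N p K) {D : ℕ}

include h

theorem N_pos : (0 : ℝ) < N := h.pos.trans_le h.le

theorem N_ge : 1 ≤ N := by
  have := h.N_pos
  exact_mod_cast this

theorem K_nonneg : 0 ≤ K := zero_le_one.trans h.one_le

theorem prob_nonneg : 0 ≤ edgeProb q N p := div_nonneg h.pos.le (pow_nonneg h.N_pos.le _)

theorem weight_nonneg : 0 ≤ scaleWeight q N p K D := monoWeight_nonneg h.prob_nonneg h.K_nonneg

theorem pow_mul_prob : (N : ℝ) ^ (q - 1) * edgeProb q N p = p := by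
  have := h.N_pos
  rw [edgeProb]
  field_simp

theorem pow_mul_prob' : (N : ℝ) ^ (q - 2) * edgeProb q N p = p / N := by
  have h0 := h.N_pos
  have h1 : (N : ℝ) ^ (q - 1) = N ^ (q - 2) * N := by
    rw [← pow_succ]; congr 1; have := h.two_le; omega
  rw [edgeProb, h1]
  field_simp

theorem prob_le : edgeProb q N p ≤ p / N := by
  rw [← h.pow_mul_prob']
  refine le_mul_of_one_le_left h.prob_nonneg (one_le_pow₀ ?_)
  exact_mod_cast h.N_ge

theorem prob_le_one : edgeProb q N p ≤ 1 :=
  h.prob_le.trans ((div_le_one h.N_pos).2 h.le)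

theorem one_le_q : (1 : ℝ) ≤ q := by exact_mod_cast (by norm_num : 1 ≤ 2).trans h.two_le

/-- The summand `1` in `stepConst` is there for this bound, which makes its powers increasing even
if `D = 0` and `p` is small. -/
theorem one_le_stepConst : 1 ≤ stepConst q p K D := by
  have h1 := h.pos
  unfold stepConst
  exact one_le_mul_of_one_le_of_one_le (one_le_mul_of_one_le_of_one_le h.one_le_q h.one_le)
    (by linarith [(Nat.cast_nonneg D : (0 : ℝ) ≤ D)])

theorem one_le_walkConst : 1 ≤ walkConst q p K D :=
  one_le_mul_of_one_le_of_one_le (by simp) (one_le_pow₀ h.one_le_stepConst)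

theorem walkConst_nonneg : 0 ≤ walkConst q p K D := zero_le_one.trans h.one_le_walkConst

theorem card_mul_prob_le (v : ℕ) {H : Finset (Finset ℕ)} (hH : H ⊆ hyperedges N q) :
    ((H.filter (v ∈ ·)).card : ℝ) * edgeProb q N p ≤ p := by
  refine (mul_le_mul_of_nonneg_right ?_ h.prob_nonneg).trans_eq h.pow_mul_prob
  have h1 := card_edges_superset_le N q (T := {v})
  simp only [Finset.singleton_subset_iff, Finset.card_singleton] at h1
  exact_mod_cast (Finset.card_le_card (Finset.filter_subset_filter _ hH)).trans h1

theorem card_mul_prob_le' {v w : ℕ} (hvw : v ≠ w) {H : Finset (Finset ℕ)}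
    (hH : H ⊆ hyperedges N q) :
    ((H.filter (fun e => v ∈ e ∧ w ∈ e)).card : ℝ) * edgeProb q N p ≤ p / N := by
  rw [← h.pow_mul_prob']
  refine mul_le_mul_of_nonneg_right ?_ h.prob_nonneg
  have h1 := card_edges_superset_le N q (T := {v, w})
  simp only [Finset.insert_subset_iff, Finset.singleton_subset_iff, Finset.card_pair hvw] at h1
  exact_mod_cast (Finset.card_le_card (Finset.filter_subset_filter _ hH)).trans h1

theorem sum_step_le {H : Finset (Finset ℕ)} (hH : H ⊆ hyperedges N q) (v : ℕ) (P : EdgePoly) :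
    q * ∑ e ∈ H with v ∈ e, wnorm (scaleWeight q N p K D) (P * edgeVar e)
      ≤ stepConst q p K D * wnorm (scaleWeight q N p K D) P := by
  have h1 := sum_wnorm_mul_edgeVar_le (D := D) h.prob_nonneg h.K_nonneg
    ((Finset.filter_subset (v ∈ ·) H).trans hH) (h.card_mul_prob_le v hH) P
  have h0 := wnorm_nonneg (h.weight_nonneg (D := D)) P
  calc _ ≤ (q : ℝ) * (K * (2 * D + p) * wnorm (scaleWeight q N p K D) P) := by gcongr
    _ ≤ _ := by
      unfold stepConst
      have : 0 ≤ (q : ℝ) * K * wnorm (scaleWeight q N p K D) P :=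
        mul_nonneg (mul_nonneg (Nat.cast_nonneg _) h.K_nonneg) h0
      linarith

/-- A sum over one step from `v`, if the values at the endpoints are bounded. -/
theorem wnorm_step_le {H : Finset (Finset ℕ)} (hH : H ⊆ hyperedges N q) {κ : ℝ} (hκ : 0 ≤ κ)
    {g : ℕ → EdgePoly} (hg : ∀ k, MulBound (scaleWeight q N p K D) κ (g k)) (v : ℕ) :
    MulBound (scaleWeight q N p K D) (stepConst q p K D * κ)
      (∑ e ∈ H with v ∈ e, edgeVar e * ∑ k ∈ e.erase v, g k) := fun P => by
  have hw := h.weight_nonneg (D := D)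
  rw [Finset.mul_sum]
  calc _ ≤ ∑ e ∈ H with v ∈ e, κ * (q * wnorm (scaleWeight q N p K D) (P * edgeVar e)) := by
        refine (wnorm_sum_le hw _ _).trans (Finset.sum_le_sum fun e he => ?_)
        rw [← mul_assoc, Finset.mul_sum]
        refine (wnorm_sum_le hw _ _).trans ?_
        calc _ ≤ ∑ k ∈ e.erase v, κ * wnorm (scaleWeight q N p K D) (P * edgeVar e) :=
              Finset.sum_le_sum fun k _ => hg k _
          _ = (e.erase v).card * (κ * wnorm (scaleWeight q N p K D) (P * edgeVar e)) := by
              rw [Finset.sum_const, nsmul_eq_mul]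
          _ ≤ q * (κ * wnorm (scaleWeight q N p K D) (P * edgeVar e)) :=
              mul_le_mul_of_nonneg_right (card_edge_erase_le (hH (Finset.mem_filter.1 he).1) v)
                (mul_nonneg hκ (wnorm_nonneg hw _))
          _ = _ := by ring
    _ = κ * (q * ∑ e ∈ H with v ∈ e, wnorm (scaleWeight q N p K D) (P * edgeVar e)) := by
        rw [Finset.mul_sum, Finset.mul_sum]
    _ ≤ κ * (stepConst q p K D * wnorm (scaleWeight q N p K D) P) :=
        mul_le_mul_of_nonneg_left (h.sum_step_le hH v P) hκ
    _ = _ := by ring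

/-- Each of the `l` steps costs `stepConst`, whatever has been traversed before, and the vertex
weights cost nothing. The bound is independent of `N`, and it later yields Carleman's condition. -/
theorem mulBound_walkPoly {σ : ℕ → EdgePoly} (hσ : ∀ i, IsVertexWeight (σ i))
    {H : Finset (Finset ℕ)} (hH : H ⊆ hyperedges N q) (j l i : ℕ) :
    MulBound (scaleWeight q N p K D) (stepConst q p K D ^ l) (walkPoly σ edgeVar H j l i) := by
  have h1 := h.one_le_stepConst (D := D)
  induction l generalizing i with
  | zero =>
    rw [walkPoly, pow_zero]
    split_ifs
    exacts [MulBound.one, MulBound.zero.mono h.weight_nonneg zero_le_one]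
  | succ l ih =>
    rw [walkPoly, pow_succ']
    have h2 := (hσ i).mulBound (H := hyperedges N q) (D := D) h.prob_nonneg h.K_nonneg
    have h3 := h.wnorm_step_le hH (by positivity) ih i
    simpa using h2.mul (by positivity) h3

theorem seriesBound_of_coeff {G : PowerSeries EdgePoly}
    (hG : ∀ l, MulBound (scaleWeight q N p K D) (stepConst q p K D ^ l) (PowerSeries.coeff l G)) :
    SeriesBound (scaleWeight q N p K D) D (walkConst q p K D) G :=
  SeriesBound.of_coeff h.weight_nonneg fun l hl =>
    (hG l).mono h.weight_nonneg (pow_le_pow_right₀ h.one_le_stepConst hl)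

theorem seriesBound_walkSeries {σ : ℕ → EdgePoly} (hσ : ∀ i, IsVertexWeight (σ i))
    {H : Finset (Finset ℕ)} (hH : H ⊆ hyperedges N q) (i j : ℕ) :
    SeriesBound (scaleWeight q N p K D) D (walkConst q p K D) (walkSeries σ edgeVar H i j) :=
  h.seriesBound_of_coeff fun l => by
    rw [coeff_walkSeries]; exact h.mulBound_walkPoly hσ hH j l i

theorem seriesBound_stepSeries {σ : ℕ → EdgePoly} (hσ : ∀ i, IsVertexWeight (σ i))
    {H : Finset (Finset ℕ)} (hH : H ⊆ hyperedges N q) (i j : ℕ) :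
    SeriesBound (scaleWeight q N p K D) D (walkConst q p K D) (stepSeries σ edgeVar H i j) :=
  h.seriesBound_of_coeff fun l => by
    have h1 := h.one_le_stepConst (D := D)
    cases l with
    | zero =>
      rw [stepSeries, coeff_zero_stepSum]
      exact MulBound.zero.mono h.weight_nonneg (by simp)
    | succ l =>
      rw [stepSeries, coeff_succ_stepSum, pow_succ']
      exact h.wnorm_step_le hH (by positivity)
        (fun k => by rw [coeff_walkSeries]; exact h.mulBound_walkPoly hσ hH j l k) i

theorem seriesBound_returnSeries {H : Finset (Finset ℕ)} (hH : H ⊆ hyperedges N q) (x : ℕ) :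
    SeriesBound (scaleWeight q N p K D) D (walkConst q p K D) (returnSeries edgeVar H x) :=
  h.seriesBound_stepSeries (fun i => isVertexWeight_update (Or.inl rfl) x i) hH x x

theorem mulBound_closedWalk {H : Finset (Finset ℕ)} (hH : H ⊆ hyperedges N q) (x : ℕ) {l : ℕ}
    (hl : l ≤ D) (r : ℕ) :
    MulBound (scaleWeight q N p K D) (walkConst q p K D ^ r) (closedWalk edgeVar H x l r) :=
  ((h.seriesBound_returnSeries hH x).pow h.walkConst_nonneg r).coeff h.weight_nonneg hl

end IsScale

/-! #### Walks that hit a given vertex -/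

/-- The variables of the hyperedges of `H` through `w` are excluded. -/
def avoiding (H : Finset (Finset ℕ)) (w : ℕ) : Set (Option (Finset ℕ)) :=
  {i | ∀ e ∈ H, i = some e → w ∉ e}

theorem vertexWeight_mem_supported {a : EdgePoly} (ha : IsVertexWeight a)
    (H : Finset (Finset ℕ)) (w : ℕ) : a ∈ MvPolynomial.supported ℝ (avoiding H w) := by
  rcases ha with rfl | rfl | rfl
  · exact zero_mem _
  · exact one_mem _
  · exact (MvPolynomial.X_mem_supported (R := ℝ)).2 (by simp [avoiding])

namespace IsScale

variable {q N : ℕ} {p K : ℝ} (h : IsScale q N p K) {D : ℕ}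

include h

/-- The source of all factors `1 / N` for walks that must hit `w`. If the next hyperedge contains
`w`, it is new and joins `v` to `w`; there are at most `N ^ (q - 2)` of these, each of cost `K * c`,
and `N ^ (q - 2) * c = p / N`. Otherwise no hyperedge at `w` has been used yet, the step ends away
from `w`, and the induction hypothesis `ih` applies. -/
theorem wnorm_step_hit_le {σ : ℕ → EdgePoly} (hσ : ∀ i, IsVertexWeight (σ i))
    {H : Finset (Finset ℕ)} (hH : H ⊆ hyperedges N q) {w : ℕ} {l : ℕ} {C : ℝ} (hC : 0 ≤ C)
    (ih : ∀ k, k ≠ w → ∀ P ∈ MvPolynomial.supported ℝ (avoiding H w),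
      wnorm (scaleWeight q N p K D) (P * walkPoly σ edgeVar H w l k)
        ≤ C / N * wnorm (scaleWeight q N p K D) P)
    {v : ℕ} (hv : v ≠ w) {P : EdgePoly} (hP : P ∈ MvPolynomial.supported ℝ (avoiding H w)) :
    wnorm (scaleWeight q N p K D)
        (P * ∑ e ∈ H with v ∈ e, edgeVar e * ∑ k ∈ e.erase v, walkPoly σ edgeVar H w l k)
      ≤ (stepConst q p K D * C + stepConst q p K D ^ (l + 1)) / N
        * wnorm (scaleWeight q N p K D) P := by
  have hw := h.weight_nonneg (D := D)
  have h1 := h.one_le_stepConst (D := D)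
  have hN := h.N_pos
  have hP0 := wnorm_nonneg hw P
  set κ := stepConst q p K D
  set W := scaleWeight q N p K D
  rw [Finset.mul_sum]
  have hterm : ∀ e ∈ H.filter (v ∈ ·), wnorm W (P * (edgeVar e *
      ∑ k ∈ e.erase v, walkPoly σ edgeVar H w l k))
      ≤ C / N * (q * wnorm W (P * edgeVar e))
        + if w ∈ e then q * κ ^ l * (K * edgeProb q N p * wnorm W P) else 0 := by
    intro e he
    rw [Finset.mem_filter] at he
    have hcard := card_edge_erase_le (hH he.1) v
    have hPe := wnorm_nonneg hw (P * edgeVar e)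
    rw [← mul_assoc, Finset.mul_sum]
    refine (wnorm_sum_le hw _ _).trans ?_
    split_ifs with hwe
    · have hfree : wnorm W (P * edgeVar e) ≤ K * edgeProb q N p * wnorm W P :=
        wnorm_mul_edgeVar_le_of_free h.prob_nonneg h.K_nonneg (hH he.1) fun m hm =>
          eq_zero_of_mem_supported hP (fun hT => hT e he.1 rfl hwe) hm
      calc _ ≤ ∑ k ∈ e.erase v, κ ^ l * wnorm W (P * edgeVar e) :=
            Finset.sum_le_sum fun k _ => h.mulBound_walkPoly hσ hH w l k _
        _ = (e.erase v).card * (κ ^ l * wnorm W (P * edgeVar e)) := by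
            rw [Finset.sum_const, nsmul_eq_mul]
        _ ≤ q * (κ ^ l * (K * edgeProb q N p * wnorm W P)) := by gcongr
        _ = q * κ ^ l * (K * edgeProb q N p * wnorm W P) := by ring
        _ ≤ _ := le_add_of_nonneg_left (by positivity)
    · have hPe' : P * edgeVar e ∈ MvPolynomial.supported ℝ (avoiding H w) :=
        mul_mem hP ((MvPolynomial.X_mem_supported (R := ℝ)).2 fun e' _ hee' => by
          rwa [← Option.some.inj hee'])
      calc _ ≤ ∑ k ∈ e.erase v, C / N * wnorm W (P * edgeVar e) :=
            Finset.sum_le_sum fun k hk => ih k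
              (fun hkw => hwe (hkw ▸ Finset.mem_of_mem_erase hk)) _ hPe'
        _ = (e.erase v).card * (C / N * wnorm W (P * edgeVar e)) := by
            rw [Finset.sum_const, nsmul_eq_mul]
        _ ≤ q * (C / N * wnorm W (P * edgeVar e)) := by gcongr
        _ = _ := by ring
  refine (wnorm_sum_le hw _ _).trans ((Finset.sum_le_sum hterm).trans ?_)
  rw [Finset.sum_add_distrib, ← Finset.mul_sum, ← Finset.mul_sum, ← Finset.sum_filter,
    Finset.filter_filter, Finset.sum_const, nsmul_eq_mul]
  have e1 := h.sum_step_le (D := D) hH v P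
  have e2 := h.card_mul_prob_le' hv hH
  have e3 : q * K * p ≤ κ := by
    have h2 := h.pos
    have h3 := h.K_nonneg
    simp only [κ, stepConst]
    gcongr
    linarith [(Nat.cast_nonneg D : (0 : ℝ) ≤ D)]
  calc _ ≤ C / N * (κ * wnorm W P)
        + q * κ ^ l * K * wnorm W P * (((H.filter fun e => v ∈ e ∧ w ∈ e).card : ℝ)
          * edgeProb q N p) := by
        refine add_le_add (mul_le_mul_of_nonneg_left e1 (by positivity)) (le_of_eq (by ring))
    _ ≤ C / N * (κ * wnorm W P) + q * κ ^ l * K * wnorm W P * (p / N) := by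
        have h3 := h.K_nonneg
        gcongr
    _ = C / N * (κ * wnorm W P) + κ ^ l * (q * K * p) / N * wnorm W P := by ring
    _ ≤ C / N * (κ * wnorm W P) + κ ^ l * κ / N * wnorm W P := by gcongr
    _ = _ := by ring

/-- The factor `l` accounts for the position of the first step along a hyperedge through `w`. -/
theorem wnorm_walkPoly_hit_le {σ : ℕ → EdgePoly} (hσ : ∀ i, IsVertexWeight (σ i))
    {H : Finset (Finset ℕ)} (hH : H ⊆ hyperedges N q) {w : ℕ} (l : ℕ) {v : ℕ} (hv : v ≠ w)
    {P : EdgePoly} (hP : P ∈ MvPolynomial.supported ℝ (avoiding H w)) :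
    wnorm (scaleWeight q N p K D) (P * walkPoly σ edgeVar H w l v)
      ≤ l * stepConst q p K D ^ l / N * wnorm (scaleWeight q N p K D) P := by
  have h1 := h.one_le_stepConst (D := D)
  induction l generalizing v P with
  | zero => rw [walkPoly, if_neg hv]; simp
  | succ l ih =>
    rw [walkPoly, ← mul_assoc]
    have h2 := h.wnorm_step_hit_le hσ hH (l := l) (C := l * stepConst q p K D ^ l) (by positivity)
      (fun k hk P hP => ih hk hP) hv (mul_mem hP (vertexWeight_mem_supported (hσ v) H w))
    have h3 := (hσ v).mulBound (H := hyperedges N q) (D := D) h.prob_nonneg h.K_nonneg P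
    have hN := h.N_pos
    rw [one_mul] at h3
    refine h2.trans ?_
    have : stepConst q p K D * (l * stepConst q p K D ^ l) + stepConst q p K D ^ (l + 1)
        = ((l + 1 : ℕ) : ℝ) * stepConst q p K D ^ (l + 1) := by push_cast; ring
    rw [this]
    gcongr

theorem snorm_hit_le {P : EdgePoly} {G : PowerSeries EdgePoly}
    (hG : ∀ l, wnorm (scaleWeight q N p K D) (P * PowerSeries.coeff l G)
      ≤ l * stepConst q p K D ^ l / N * wnorm (scaleWeight q N p K D) P) :
    snorm (scaleWeight q N p K D) D (PowerSeries.C P * G)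
      ≤ D * walkConst q p K D / N * wnorm (scaleWeight q N p K D) P := by
  have h1 := h.one_le_stepConst (D := D)
  have hN := h.N_pos
  have hP0 := wnorm_nonneg (h.weight_nonneg (D := D)) P
  rw [snorm]
  calc _ ≤ ∑ k ∈ Finset.range (D + 1), D * stepConst q p K D ^ D / N
          * wnorm (scaleWeight q N p K D) P := by
        refine Finset.sum_le_sum fun k hk => ?_
        have hk' : k ≤ D := Nat.lt_succ_iff.1 (Finset.mem_range.1 hk)
        rw [PowerSeries.coeff_C_mul]
        refine (hG k).trans ?_
        gcongr
    _ = _ := by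
        rw [Finset.sum_const, Finset.card_range, nsmul_eq_mul, walkConst]
        push_cast
        ring

theorem snorm_walkSeries_hit_le {σ : ℕ → EdgePoly} (hσ : ∀ i, IsVertexWeight (σ i))
    {H : Finset (Finset ℕ)} (hH : H ⊆ hyperedges N q) {v w : ℕ} (hv : v ≠ w)
    {P : EdgePoly} (hP : P ∈ MvPolynomial.supported ℝ (avoiding H w)) :
    snorm (scaleWeight q N p K D) D (PowerSeries.C P * walkSeries σ edgeVar H v w)
      ≤ D * walkConst q p K D / N * wnorm (scaleWeight q N p K D) P :=
  h.snorm_hit_le fun l => by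
    rw [coeff_walkSeries]; exact h.wnorm_walkPoly_hit_le hσ hH l hv hP

theorem snorm_stepSeries_hit_le {σ : ℕ → EdgePoly} (hσ : ∀ i, IsVertexWeight (σ i))
    {H : Finset (Finset ℕ)} (hH : H ⊆ hyperedges N q) {v w : ℕ} (hv : v ≠ w)
    {P : EdgePoly} (hP : P ∈ MvPolynomial.supported ℝ (avoiding H w)) :
    snorm (scaleWeight q N p K D) D (PowerSeries.C P * stepSeries σ edgeVar H v w)
      ≤ D * walkConst q p K D / N * wnorm (scaleWeight q N p K D) P :=
  h.snorm_hit_le fun l => by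
    have h1 := h.one_le_stepConst (D := D)
    cases l with
    | zero => rw [stepSeries, coeff_zero_stepSum]; simp
    | succ l =>
      rw [stepSeries, coeff_succ_stepSum]
      simp only [coeff_walkSeries]
      refine (h.wnorm_step_hit_le hσ hH (l := l) (C := l * stepConst q p K D ^ l) (by positivity)
        (fun k hk P hP => h.wnorm_walkPoly_hit_le hσ hH l hk hP) hv hP).trans (le_of_eq ?_)
      push_cast
      ring

end IsScale

end SparseHypergraph

end

noncomputable section

namespace SparseHypergraph

/-! ### The walks that start along a given hyperedge -/

/-! ### Powers of matrices of power series -/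

section MatrixNorm

variable {ι n : Type*} [Fintype n] [DecidableEq n] {w : (ι →₀ ℕ) → ℝ} {D : ℕ}

theorem seriesBound_matrix_pow (hw : 0 ≤ w) {κ : ℝ} (hκ : 0 ≤ κ)
    {A : Matrix n n (PowerSeries (MvPolynomial ι ℝ))} (hA : ∀ i j, SeriesBound w D κ (A i j))
    (F : ℕ) (i j : n) : SeriesBound w D ((Fintype.card n * κ) ^ F) ((A ^ F) i j) := by
  induction F generalizing i j with
  | zero =>
    rw [pow_zero, pow_zero, Matrix.one_apply]
    split_ifs
    exacts [SeriesBound.one, SeriesBound.zero hw zero_le_one]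
  | succ F ih =>
    rw [pow_succ A, Matrix.mul_apply]
    refine (SeriesBound.sum hw Finset.univ fun k _ => (ih i k).mul hκ (hA k j)).mono hw (le_of_eq ?_)
    rw [Finset.sum_const, Finset.card_univ, nsmul_eq_mul]
    ring

theorem snorm_matrix_pow_sub_pow_le (hw : 0 ≤ w) {κ ε : ℝ} (hκ : 1 ≤ κ)
    {A B : Matrix n n (PowerSeries (MvPolynomial ι ℝ))} (hA : ∀ i j, SeriesBound w D κ (A i j))
    (hB : ∀ i j, SeriesBound w D κ (B i j)) (P : PowerSeries (MvPolynomial ι ℝ))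
    (hε : ∀ i j, snorm w D (P * (A i j - B i j)) ≤ ε) (F : ℕ) (i j : n) :
    snorm w D (P * ((A ^ F) i j - (B ^ F) i j)) ≤ F * (Fintype.card n * κ) ^ F * ε := by
  have hκ0 : 0 ≤ κ := zero_le_one.trans hκ
  have hε0 : 0 ≤ ε := (snorm_nonneg hw _).trans (hε i j)
  induction F generalizing i j with
  | zero => simp
  | succ F ih =>
    have e : P * ((A ^ (F + 1)) i j - (B ^ (F + 1)) i j)
        = ∑ k, (P * ((A ^ F) i k - (B ^ F) i k) * A k j
          + P * (A k j - B k j) * (B ^ F) i k) := by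
      rw [pow_succ, pow_succ, Matrix.mul_apply, Matrix.mul_apply, ← Finset.sum_sub_distrib,
        Finset.mul_sum]
      exact Finset.sum_congr rfl fun k _ => by ring
    rw [e]
    calc _ ≤ ∑ k : n, (κ * (F * (Fintype.card n * κ) ^ F * ε)
          + (Fintype.card n * κ) ^ F * ε) := by
          refine (snorm_sum_le hw _ _).trans (Finset.sum_le_sum fun k _ => ?_)
          refine (snorm_add_le hw _ _).trans (add_le_add ?_ ?_)
          · exact (hA k j _).trans (mul_le_mul_of_nonneg_left (ih i k) hκ0)
          · exact (seriesBound_matrix_pow hw hκ0 hB F i k _).trans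
              (mul_le_mul_of_nonneg_left (hε k j) (by positivity))
      _ = F * (Fintype.card n * κ) ^ (F + 1) * ε
          + Fintype.card n * (Fintype.card n * κ) ^ F * ε := by
          rw [Finset.sum_const, Finset.card_univ, nsmul_eq_mul]; ring
      _ ≤ F * (Fintype.card n * κ) ^ (F + 1) * ε
          + (Fintype.card n * κ) ^ (F + 1) * ε := by
          have : (Fintype.card n : ℝ) * (Fintype.card n * κ) ^ F * ε
              ≤ Fintype.card n * κ * (Fintype.card n * κ) ^ F * ε := by
            gcongr
            exact le_mul_of_one_le_right (Nat.cast_nonneg _) hκ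
          rw [pow_succ' ((Fintype.card n : ℝ) * κ) F]
          linarith
      _ = _ := by push_cast; ring

end MatrixNorm

/-- The vertex weights that mark the departures from `x`. -/
def markAt (x : ℕ) : ℕ → EdgePoly := Function.update 1 x marker

theorem isVertexWeight_markAt (x i : ℕ) : IsVertexWeight (markAt x i) :=
  isVertexWeight_update (Or.inr (Or.inr rfl)) x i

theorem isVertexWeight_one (i : ℕ) : IsVertexWeight ((1 : ℕ → EdgePoly) i) := Or.inr (Or.inl rfl)

/-- The closed walks at `z`, with marked departures if `z = x`. -/
def closedSeries (H : Finset (Finset ℕ)) (x z : ℕ) : PowerSeries EdgePoly :=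
  walkSeries (Function.update 1 z (markAt x z)) edgeVar H z z

theorem closedSeries_self (H : Finset (Finset ℕ)) (x : ℕ) :
    closedSeries H x x = walkSeries (markAt x) edgeVar H x x := by
  simp [closedSeries, markAt]

theorem closedSeries_of_ne (H : Finset (Finset ℕ)) {x z : ℕ} (h : z ≠ x) :
    closedSeries H x z = walkSeries 1 edgeVar H z z := by
  have h1 : markAt x z = 1 := by rw [markAt, Function.update_of_ne h]; rfl
  rw [closedSeries, h1]
  congr 1
  exact Function.update_eq_self z (1 : ℕ → EdgePoly)

/-- The empty walk gives the constant term `1`. This permits cancellation in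
`closedMatrix_pow_apply_self`. -/
theorem closedSeries_ne_zero (H : Finset (Finset ℕ)) (x z : ℕ) : closedSeries H x z ≠ 0 := by
  intro h
  have h1 := congrArg (PowerSeries.coeff (R := EdgePoly) 0) h
  rw [closedSeries, coeff_walkSeries, walkPoly, if_pos rfl, map_zero] at h1
  exact one_ne_zero h1

/-- The closed walks at `x` whose first step is along `e`. -/
def edgeSeries (H : Finset (Finset ℕ)) (e : Finset ℕ) (x : ℕ) : PowerSeries EdgePoly :=
  PowerSeries.X * PowerSeries.C (edgeVar e) *
    (PowerSeries.C marker * ∑ w ∈ e.erase x, walkSeries (markAt x) edgeVar H w x)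

/-- The departure weights of the words in `e`. -/
def wordWeight (H : Finset (Finset ℕ)) (x z : ℕ) : PowerSeries EdgePoly :=
  PowerSeries.C (markAt x z) * closedSeries H x z

/-- The main part of `edgeSeries`: all excursions from the vertices of `e` are closed. -/
def edgeMain (H : Finset (Finset ℕ)) (e : Finset ℕ) (x : {z // z ∈ e}) (D : ℕ) :
    PowerSeries EdgePoly :=
  ∑ F ∈ Finset.Icc 1 D, (PowerSeries.X * PowerSeries.C (edgeVar e)) ^ F *
    (departMatrix e (wordWeight (H.erase e) x) ^ F) x x

theorem walkSeries_markAt_self (H : Finset (Finset ℕ)) (x : ℕ) :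
    walkSeries (markAt x) edgeVar H x x = 1 + ∑ e ∈ H with x ∈ e, edgeSeries H e x := by
  rw [walkSeries_eq, if_pos rfl, stepSeries, stepSum]
  have h1 : markAt x x = marker := Function.update_self ..
  rw [h1]
  refine congrArg (1 + ·) ?_
  rw [Finset.mul_sum, Finset.mul_sum]
  refine Finset.sum_congr rfl fun e _ => ?_
  rw [edgeSeries]
  ring

/-- The diagonal part of the matrix of walk series. -/
def closedMatrix (H : Finset (Finset ℕ)) (e : Finset ℕ) (x : ℕ) :
    Matrix {z // z ∈ e} {z // z ∈ e} (PowerSeries EdgePoly) :=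
  Matrix.diagonal fun z => closedSeries H x z

theorem mul_mul_pow_comm {M : Type*} [Monoid M] (a b : M) (F : ℕ) :
    a * (b * a) ^ F = (a * b) ^ F * a := by
  induction F with
  | zero => simp
  | succ F ih => rw [pow_succ, ← mul_assoc, ih, pow_succ, mul_assoc, mul_assoc, mul_assoc]

/-- On the left the excursions follow the steps of the word, on the right they precede them. The two
products are conjugate by the diagonal matrix of excursions, so their diagonal entries agree. With
excursions before the steps, the number of slots at a vertex is its number of departures. -/
theorem closedMatrix_pow_apply_self (H : Finset (Finset ℕ)) (e : Finset ℕ) (x : {z // z ∈ e})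
    (F : ℕ) :
    ((departMatrix e (fun z => PowerSeries.C (markAt x z)) * closedMatrix H e x) ^ F) x x
      = (departMatrix e (wordWeight H x) ^ F) x x := by
  have h1 : closedMatrix H e x * departMatrix e (fun z => PowerSeries.C (markAt x z))
      = departMatrix e (wordWeight H x) := by
    ext1 z w
    rw [closedMatrix, Matrix.diagonal_mul]
    simp only [departMatrix, Matrix.of_apply, wordWeight]
    split_ifs
    · rw [mul_zero]
    · ring
  have h2 := mul_mul_pow_comm (closedMatrix H e x)
    (departMatrix e (fun z => PowerSeries.C (markAt x z))) F
  rw [h1] at h2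
  have h3 := congrFun (congrFun h2 x) x
  rw [closedMatrix, Matrix.diagonal_mul, Matrix.mul_diagonal,
    mul_comm (closedSeries H x x)] at h3
  exact mul_right_cancel₀ (closedSeries_ne_zero H x x) h3

theorem edgeSeries_eq_matrix (H : Finset (Finset ℕ)) (e : Finset ℕ) (x : {z // z ∈ e}) :
    edgeSeries H e x = ((PowerSeries.X * PowerSeries.C (edgeVar e)) •
      (departMatrix e (fun z => PowerSeries.C (markAt x z)) *
        edgeMatrix (markAt x) edgeVar e H)) x x := by
  rw [Matrix.smul_apply, Matrix.mul_apply]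
  simp only [edgeMatrix, Matrix.of_apply]
  rw [sum_departMatrix_mul e _ x (fun k => walkSeries (markAt x) edgeVar H k x), smul_eq_mul,
    edgeSeries]
  have h1 : markAt x x = marker := Function.update_self ..
  rw [h1]

/-- The remainder after `D` steps along `e` carries `X ^ (D + 1)` and is invisible in degree `l ≤
D`. -/
theorem coeff_edgeSeries {H : Finset (Finset ℕ)} {e : Finset ℕ} (he : e ∈ H) (x : {z // z ∈ e})
    {l D : ℕ} (hl : l ≤ D) :
    PowerSeries.coeff l (edgeSeries H e x) = PowerSeries.coeff l (∑ F ∈ Finset.Icc 1 D,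
      (PowerSeries.X * PowerSeries.C (edgeVar e)) ^ F *
        ((departMatrix e (fun z => PowerSeries.C (markAt x z)) *
          edgeMatrix (markAt x) edgeVar e (H.erase e)) ^ F) x x) := by
  rw [edgeSeries_eq_matrix, edge_walks_eq (markAt x) edgeVar he D, Matrix.add_apply, map_add,
    Matrix.smul_apply, smul_eq_mul, PowerSeries.coeff_X_pow_mul', if_neg (by omega), add_zero,
    Matrix.sum_apply]
  simp only [Matrix.smul_apply, smul_eq_mul]

namespace IsScale

variable {q N : ℕ} {p K : ℝ} (h : IsScale q N p K) {D : ℕ}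

theorem erase_subset_hyperedges {q N : ℕ} (e : Finset ℕ) :
    (hyperedges N q).erase e ⊆ hyperedges N q := Finset.erase_subset _ _

include h

theorem seriesBound_marker :
    SeriesBound (scaleWeight q N p K D) D 1 (PowerSeries.C marker) :=
  SeriesBound.C h.weight_nonneg (mulBound_marker h.prob_nonneg h.K_nonneg)

theorem seriesBound_markAt (x z : ℕ) :
    SeriesBound (scaleWeight q N p K D) D 1 (PowerSeries.C (markAt x z)) :=
  SeriesBound.C h.weight_nonneg ((isVertexWeight_markAt x z).mulBound h.prob_nonneg h.K_nonneg)

theorem mulBound_edgeVar {e : Finset ℕ} (he : e ∈ hyperedges N q) :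
    MulBound (scaleWeight q N p K D) (stepConst q p K D) (edgeVar e) := fun P => by
  have hw := h.weight_nonneg (D := D)
  obtain ⟨v, hv⟩ : e.Nonempty := by
    rw [← Finset.card_pos, (Finset.mem_powersetCard.1 he).2]
    have := h.two_le; omega
  refine le_trans ?_ (h.sum_step_le (D := D) (Finset.Subset.refl _) v P)
  refine le_trans ?_ (le_mul_of_one_le_left
    (Finset.sum_nonneg fun _ _ => wnorm_nonneg hw _) h.one_le_q)
  exact Finset.single_le_sum (f := fun e => wnorm (scaleWeight q N p K D) (P * edgeVar e))
    (fun _ _ => wnorm_nonneg hw _) (Finset.mem_filter.2 ⟨he, hv⟩)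

theorem wnorm_edgeVar_le {e : Finset ℕ} (he : e ∈ hyperedges N q) :
    wnorm (scaleWeight q N p K D) (edgeVar e) ≤ K * edgeProb q N p := by
  have h1 := wnorm_mul_edgeVar_le_of_free (D := D) h.prob_nonneg h.K_nonneg he (P := 1)
    fun m hm => by
      have := MvPolynomial.support_monomial_subset (s := 0) (a := (1 : ℝ)) hm
      rw [Finset.mem_singleton] at this
      simp [this]
  have h2 : wnorm (scaleWeight q N p K D) 1 ≤ 1 := by
    rw [← MvPolynomial.C_1, ← MvPolynomial.monomial_zero', wnorm_monomial]
    simp [monoWeight, edgeDegree, edgeWeight]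
  rw [one_mul] at h1
  exact h1.trans (mul_le_of_le_one_right (mul_nonneg h.K_nonneg h.prob_nonneg) h2)

/-- Only the first occurrence of `e` yields the small factor `c`; the repetitions are paid for as
ordinary steps. -/
theorem wnorm_edgeVar_pow_le {e : Finset ℕ} (he : e ∈ hyperedges N q) {F : ℕ} (hF : 1 ≤ F)
    (hFD : F ≤ D) : wnorm (scaleWeight q N p K D) (edgeVar e ^ F)
      ≤ stepConst q p K D ^ D * (K * edgeProb q N p) := by
  have h1 := h.one_le_stepConst (D := D)
  have h0 : 0 ≤ K * edgeProb q N p := mul_nonneg h.K_nonneg h.prob_nonneg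
  have key : ∀ F, wnorm (scaleWeight q N p K D) (edgeVar e ^ (F + 1))
      ≤ stepConst q p K D ^ F * (K * edgeProb q N p) := by
    intro F
    induction F with
    | zero => simpa using h.wnorm_edgeVar_le he
    | succ F ih =>
      rw [pow_succ (edgeVar e) (F + 1)]
      refine (h.mulBound_edgeVar he _).trans ?_
      rw [pow_succ' (stepConst q p K D) F, mul_assoc]
      exact mul_le_mul_of_nonneg_left ih (by positivity)
  obtain ⟨k, rfl⟩ : ∃ k, F = k + 1 := ⟨F - 1, by omega⟩
  refine (key k).trans (mul_le_mul_of_nonneg_right (pow_le_pow_right₀ h1 (by omega)) h0)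

theorem seriesBound_sum_erase {e : Finset ℕ} (he : e ∈ hyperedges N q) {κ : ℝ} (hκ : 0 ≤ κ)
    (z : ℕ) {g : ℕ → PowerSeries EdgePoly}
    (hg : ∀ k, SeriesBound (scaleWeight q N p K D) D κ (g k)) :
    SeriesBound (scaleWeight q N p K D) D (q * κ) (∑ k ∈ e.erase z, g k) := by
  refine (SeriesBound.sum h.weight_nonneg _ fun k _ => hg k).mono h.weight_nonneg ?_
  rw [Finset.sum_const, nsmul_eq_mul]
  exact mul_le_mul_of_nonneg_right (card_edge_erase_le he z) hκ

omit h in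
/-- Powers of the variable of `e` do not contain the variables of the other hyperedges. -/
theorem edgeVar_pow_mem_supported (q N : ℕ) (e : Finset ℕ) (F w : ℕ) :
    edgeVar e ^ F ∈ MvPolynomial.supported ℝ (avoiding ((hyperedges N q).erase e) w) := by
  refine pow_mem ((MvPolynomial.X_mem_supported (R := ℝ)).2 fun e' he' hee' => ?_) F
  exact absurd (Option.some.inj hee').symm (Finset.ne_of_mem_erase he')

/-- Away from `e`, the walks between the vertices of `e` are closed, up to a small error. -/
theorem snorm_edgeMatrix_sub_closedMatrix_le (e : Finset ℕ) (x : ℕ) (F : ℕ) (z w : {z // z ∈ e}) :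
    snorm (scaleWeight q N p K D) D (PowerSeries.C (edgeVar e ^ F) *
        (edgeMatrix (markAt x) edgeVar e ((hyperedges N q).erase e) z w
          - closedMatrix ((hyperedges N q).erase e) e x z w))
      ≤ 2 * D * walkConst q p K D ^ 2 / N
        * wnorm (scaleWeight q N p K D) (edgeVar e ^ F) := by
  have hκ := h.one_le_walkConst (D := D)
  have hN := h.N_pos
  have hP0 := wnorm_nonneg (h.weight_nonneg (D := D)) (edgeVar e ^ F)
  have hH := erase_subset_hyperedges (q := q) (N := N) e
  have hκ2 : walkConst q p K D ≤ 2 * walkConst q p K D ^ 2 := by nlinarith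
  rw [edgeMatrix, Matrix.of_apply, closedMatrix]
  by_cases hzw : z = w
  · subst hzw
    rw [Matrix.diagonal_apply_eq]
    by_cases hzx : (z : ℕ) = x
    · subst hzx
      rw [closedSeries_self, sub_self, mul_zero, snorm_zero]
      positivity
    -- Here the excursion at `z` is closed, and the marker at `x` matters only if it passes through
    -- `x`, which costs `1 / N`. The factor `2` bounds `marker - 1`.
    · rw [closedSeries_of_ne _ hzx, walkSeries_update (markAt x) edgeVar _ 1 x
        (fun i hi => by rw [markAt, Function.update_of_ne hi]) z z, add_sub_cancel_left, ← mul_assoc]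
      have b1 := h.snorm_walkSeries_hit_le (D := D) isVertexWeight_one hH hzx
        (edgeVar_pow_mem_supported q N e F x)
      have b2 : SeriesBound (scaleWeight q N p K D) D (1 + 1)
          (PowerSeries.C (markAt x x - (1 : ℕ → EdgePoly) x)) := by
        rw [map_sub, sub_eq_add_neg]
        refine (h.seriesBound_markAt x x).add h.weight_nonneg (SeriesBound.neg ?_)
        rw [Pi.one_apply, map_one]
        exact SeriesBound.one
      have b3 := b2.mul (zero_le_one.trans hκ) (h.seriesBound_stepSeries (D := D)
        (isVertexWeight_markAt x) hH x z)
      refine (b3 _).trans ((mul_le_mul_of_nonneg_left b1 (by positivity)).trans (le_of_eq ?_))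
      ring
  · rw [Matrix.diagonal_apply_ne _ hzw, sub_zero]
    refine (h.snorm_walkSeries_hit_le (isVertexWeight_markAt x) hH
      (fun h' => hzw (Subtype.ext h')) (edgeVar_pow_mem_supported q N e F w)).trans ?_
    have : (D : ℝ) * walkConst q p K D ≤ 2 * D * walkConst q p K D ^ 2 := by
      calc (D : ℝ) * walkConst q p K D ≤ D * (2 * walkConst q p K D ^ 2) := by gcongr
        _ = _ := by ring
    gcongr

omit h in
theorem departMatrix_mul_apply {S : Type*} [CommRing S] (e : Finset ℕ) (y : ℕ → S)
    (A : Matrix {z // z ∈ e} {z // z ∈ e} S) (z w : {z // z ∈ e}) :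
    (departMatrix e y * A) z w = y z * ∑ k ∈ Finset.univ.erase z, A k w := by
  rw [Matrix.mul_apply, Finset.mul_sum, ← Finset.sum_erase_add _ _ (Finset.mem_univ z)]
  simp only [departMatrix, Matrix.of_apply, if_true, zero_mul, add_zero]
  refine Finset.sum_congr rfl fun k hk => ?_
  rw [if_neg (Finset.ne_of_mem_erase hk).symm]

omit h in
theorem card_univ_erase_le {e : Finset ℕ} (he : e ∈ hyperedges N q) (z : {z // z ∈ e}) :
    (((Finset.univ : Finset {z // z ∈ e}).erase z).card : ℝ) ≤ q := by
  rw [← (Finset.mem_powersetCard.1 he).2, ← Fintype.card_coe e]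
  exact_mod_cast Finset.card_erase_le

theorem seriesBound_departMatrix_mul {e : Finset ℕ} (he : e ∈ hyperedges N q) (x : ℕ) {κ : ℝ}
    (hκ : 0 ≤ κ) {A : Matrix {z // z ∈ e} {z // z ∈ e} (PowerSeries EdgePoly)}
    (hA : ∀ z w, SeriesBound (scaleWeight q N p K D) D κ (A z w)) (z w : {z // z ∈ e}) :
    SeriesBound (scaleWeight q N p K D) D (q * κ)
      ((departMatrix e (fun z => PowerSeries.C (markAt x z)) * A) z w) := by
  rw [departMatrix_mul_apply]
  have h1 := (SeriesBound.sum h.weight_nonneg (Finset.univ.erase z) fun k _ => hA k w).mono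
    h.weight_nonneg (κ' := q * κ) (by
      rw [Finset.sum_const, nsmul_eq_mul]
      exact mul_le_mul_of_nonneg_right (card_univ_erase_le he z) hκ)
  simpa using (h.seriesBound_markAt x z).mul (by positivity) h1

theorem snorm_departMatrix_mul_le {e : Finset ℕ} (he : e ∈ hyperedges N q) (x : ℕ) {ε : ℝ}
    (hε : 0 ≤ ε) {A : Matrix {z // z ∈ e} {z // z ∈ e} (PowerSeries EdgePoly)}
    (P : PowerSeries EdgePoly)
    (hA : ∀ z w, snorm (scaleWeight q N p K D) D (P * A z w) ≤ ε) (z w : {z // z ∈ e}) :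
    snorm (scaleWeight q N p K D) D
      (P * (departMatrix e (fun z => PowerSeries.C (markAt x z)) * A) z w) ≤ q * ε := by
  rw [departMatrix_mul_apply, mul_comm (PowerSeries.C _), ← mul_assoc]
  refine (h.seriesBound_markAt x z _).trans ?_
  rw [one_mul, Finset.mul_sum]
  calc _ ≤ ∑ k ∈ Finset.univ.erase z, ε :=
        (snorm_sum_le h.weight_nonneg _ _).trans (Finset.sum_le_sum fun k _ => hA k w)
    _ ≤ _ := by
        rw [Finset.sum_const, nsmul_eq_mul]
        exact mul_le_mul_of_nonneg_right (card_univ_erase_le he z) hε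

end IsScale

/-- The constant in the estimate of `edgeSeries - edgeMain`. -/
def edgeConst (q : ℕ) (p K : ℝ) (D : ℕ) : ℝ :=
  D * (D * (q * (q * walkConst q p K D)) ^ D * (q * (2 * D * walkConst q p K D ^ 2)))
    * (stepConst q p K D ^ D * K)

namespace IsScale

variable {q N : ℕ} {p K : ℝ} (h : IsScale q N p K) {D : ℕ}

include h

/-- Two independent gains: the factor `c` from the variable of `e`, and the factor `1 / N` from an
excursion that is not closed or picks up a mark at `x`. Summed over the hyperedges at `x`, an error
`c / N` remains `O(1 / N)`. -/
theorem wnorm_edgeSeries_sub_edgeMain_le {e : Finset ℕ} (he : e ∈ hyperedges N q)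
    (x : {z // z ∈ e}) {l : ℕ} (hl : l ≤ D) :
    wnorm (scaleWeight q N p K D) (PowerSeries.coeff l (edgeSeries (hyperedges N q) e x)
        - PowerSeries.coeff l (edgeMain (hyperedges N q) e x D))
      ≤ edgeConst q p K D * edgeProb q N p / N := by
  have hw := h.weight_nonneg (D := D)
  have hκ := h.one_le_walkConst (D := D)
  have hs := h.one_le_stepConst (D := D)
  have hN := h.N_pos
  have hc := h.prob_nonneg
  have hK := h.K_nonneg
  have hq := h.one_le_q
  have hH := erase_subset_hyperedges (q := q) (N := N) e
  have hcard : (Fintype.card {z // z ∈ e} : ℝ) = q := by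
    rw [Fintype.card_coe, (Finset.mem_powersetCard.1 he).2]
  set M := departMatrix e (fun z => PowerSeries.C (markAt x z))
  set A := M * edgeMatrix (markAt x) edgeVar e ((hyperedges N q).erase e)
  set B := M * closedMatrix ((hyperedges N q).erase e) e x
  have e1 : PowerSeries.coeff l (edgeSeries (hyperedges N q) e x)
      - PowerSeries.coeff l (edgeMain (hyperedges N q) e x D)
      = PowerSeries.coeff l (∑ F ∈ Finset.Icc 1 D,
        (PowerSeries.X * PowerSeries.C (edgeVar e)) ^ F * ((A ^ F) x x - (B ^ F) x x)) := by
    rw [coeff_edgeSeries he x hl, edgeMain, ← map_sub, ← Finset.sum_sub_distrib]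
    congr 1
    refine Finset.sum_congr rfl fun F _ => ?_
    rw [mul_sub, closedMatrix_pow_apply_self]
  have hA : ∀ z w, SeriesBound (scaleWeight q N p K D) D (q * walkConst q p K D) (A z w) :=
    h.seriesBound_departMatrix_mul he x (by positivity) fun z w =>
      h.seriesBound_walkSeries (isVertexWeight_markAt x) hH z w
  have hB : ∀ z w, SeriesBound (scaleWeight q N p K D) D (q * walkConst q p K D) (B z w) :=
    h.seriesBound_departMatrix_mul he x (by positivity) fun z w => by
      rw [closedMatrix, Matrix.diagonal_apply]
      split_ifs
      · exact h.seriesBound_walkSeries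
          (isVertexWeight_update (isVertexWeight_markAt x z) z) hH z z
      · exact SeriesBound.zero hw (by positivity)
  have hterm : ∀ F ∈ Finset.Icc 1 D, snorm (scaleWeight q N p K D) D
      ((PowerSeries.X * PowerSeries.C (edgeVar e)) ^ F * ((A ^ F) x x - (B ^ F) x x))
      ≤ D * (q * (q * walkConst q p K D)) ^ D * (q * (2 * D * walkConst q p K D ^ 2 / N
        * (stepConst q p K D ^ D * (K * edgeProb q N p)))) := by
    intro F hF
    rw [Finset.mem_Icc] at hF
    have b1 := h.wnorm_edgeVar_pow_le he hF.1 hF.2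
    have b2 : ∀ z w, snorm (scaleWeight q N p K D) D
        (PowerSeries.C (edgeVar e ^ F) * (A z w - B z w))
        ≤ q * (2 * D * walkConst q p K D ^ 2 / N
        * (stepConst q p K D ^ D * (K * edgeProb q N p))) := by
      intro z w
      have e2 : A z w - B z w
          = (M * (edgeMatrix (markAt x) edgeVar e ((hyperedges N q).erase e)
            - closedMatrix ((hyperedges N q).erase e) e x)) z w := by
        rw [mul_sub, Matrix.sub_apply]
      rw [e2]
      refine h.snorm_departMatrix_mul_le he x (by positivity) _ (fun z w => ?_) z w
      rw [Matrix.sub_apply]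
      refine (h.snorm_edgeMatrix_sub_closedMatrix_le e x F z w).trans ?_
      gcongr
    have b3 := snorm_matrix_pow_sub_pow_le hw
      (one_le_mul_of_one_le_of_one_le hq hκ) hA hB _ b2 F x x
    rw [mul_pow, mul_assoc, mul_comm, ← map_pow]
    have b4 := (SeriesBound.X hw (D := D)).pow zero_le_one F
      (PowerSeries.C (edgeVar e ^ F) * ((A ^ F) x x - (B ^ F) x x))
    rw [one_pow, one_mul] at b4
    refine b4.trans (b3.trans ?_)
    rw [hcard]
    have hqq : 1 ≤ q * (q * walkConst q p K D) :=
      one_le_mul_of_one_le_of_one_le hq (one_le_mul_of_one_le_of_one_le hq hκ)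
    gcongr
    · exact hF.2
    · exact hF.2
  rw [e1]
  calc _ ≤ _ := wnorm_coeff_le hw _ hl
    _ ≤ ∑ F ∈ Finset.Icc 1 D, D * (q * (q * walkConst q p K D)) ^ D *
        (q * (2 * D * walkConst q p K D ^ 2 / N
        * (stepConst q p K D ^ D * (K * edgeProb q N p)))) :=
        (snorm_sum_le hw _ _).trans (Finset.sum_le_sum hterm)
    _ = _ := by
        rw [Finset.sum_const, Nat.card_Icc, Nat.add_sub_cancel, nsmul_eq_mul, edgeConst]
        ring

/-! #### Removal of a hyperedge -/

/-- Even though `e` is already present in the prefactor, a walk from `y ∉ e` must first reach a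
vertex of `e` by other hyperedges, and this costs `1 / N`. -/
theorem snorm_returnSeries_sub_le_of_notMem {e : Finset ℕ} (he : e ∈ hyperedges N q) {y : ℕ}
    (hy : y ∉ e) (F : ℕ) :
    snorm (scaleWeight q N p K D) D (PowerSeries.C (edgeVar e ^ F) *
        (returnSeries edgeVar (hyperedges N q) y
          - returnSeries edgeVar ((hyperedges N q).erase e) y))
      ≤ q * (stepConst q p K D * (q * walkConst q p K D)) * (D * walkConst q p K D / N
        * wnorm (scaleWeight q N p K D) (edgeVar e ^ F)) := by
  have hw := h.weight_nonneg (D := D)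
  have hκ := h.walkConst_nonneg (D := D)
  have hs := zero_le_one.trans (h.one_le_stepConst (D := D))
  have hH := erase_subset_hyperedges (q := q) (N := N) e
  have hσ : ∀ i, IsVertexWeight (Function.update (1 : ℕ → EdgePoly) y 0 i) :=
    isVertexWeight_update (Or.inl rfl) y
  rw [returnSeries, returnSeries, stepSeries_eq_erase _ _ _ he, if_neg hy, add_zero,
    add_sub_cancel_left, Finset.mul_sum]
  refine (snorm_sum_le hw _ _).trans ?_
  calc _ ≤ ∑ z ∈ e, (stepConst q p K D * (q * walkConst q p K D)) * (D * walkConst q p K D / N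
        * wnorm (scaleWeight q N p K D) (edgeVar e ^ F)) := by
        refine Finset.sum_le_sum fun z hz => ?_
        have hyz : y ≠ z := fun h' => hy (h' ▸ hz)
        rw [← mul_assoc]
        have b1 := h.snorm_stepSeries_hit_le (D := D) hσ hH hyz (edgeVar_pow_mem_supported q N e F z)
        have b2 : SeriesBound (scaleWeight q N p K D) D (stepConst q p K D * (q * walkConst q p K D))
            (PowerSeries.C (Function.update (1 : ℕ → EdgePoly) y 0 z) *
              (PowerSeries.X * PowerSeries.C (edgeVar e)) *
              ∑ w ∈ e.erase z, walkSeries (Function.update 1 y 0) edgeVar (hyperedges N q) w y) := by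
          have b3 := SeriesBound.C (D := D) hw
            ((hσ z).mulBound (H := hyperedges N q) (D := D) h.prob_nonneg h.K_nonneg)
          have b4 := SeriesBound.C (D := D) hw (h.mulBound_edgeVar (D := D) he)
          have b5 := h.seriesBound_sum_erase he hκ z fun k =>
            h.seriesBound_walkSeries (D := D) hσ (Finset.Subset.refl _) k y
          have b6 := (b3.mul (by positivity) ((SeriesBound.X hw).mul hs b4)).mul (by positivity) b5
          simpa using b6
        exact (b2 _).trans (mul_le_mul_of_nonneg_left b1 (by positivity))
    _ = _ := by
        rw [Finset.sum_const, (Finset.mem_powersetCard.1 he).2, nsmul_eq_mul]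
        ring

/-- Without a prefactor the position of `y` is irrelevant: a walk affected by the removal uses the
variable of `e`, which alone has norm at most `K * c`. -/
theorem snorm_returnSeries_sub_le {e : Finset ℕ} (he : e ∈ hyperedges N q) (y : ℕ) :
    snorm (scaleWeight q N p K D) D (returnSeries edgeVar (hyperedges N q) y
          - returnSeries edgeVar ((hyperedges N q).erase e) y)
      ≤ 2 * (q * walkConst q p K D) ^ 2 * (K * edgeProb q N p) := by
  have hw := h.weight_nonneg (D := D)
  have hκ1 := h.one_le_walkConst (D := D)
  have hκ := h.walkConst_nonneg (D := D)
  have hH := erase_subset_hyperedges (q := q) (N := N) e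
  set σ : ℕ → EdgePoly := Function.update (1 : ℕ → EdgePoly) y 0
  have hσ : ∀ i, IsVertexWeight (σ i) := isVertexWeight_update (Or.inl rfl) y
  have hS : ∀ z, SeriesBound (scaleWeight q N p K D) D (q * walkConst q p K D)
      (∑ w ∈ e.erase z, walkSeries σ edgeVar (hyperedges N q) w y) := fun z =>
    h.seriesBound_sum_erase he hκ z fun k => h.seriesBound_walkSeries hσ (Finset.Subset.refl _) k y
  have e1 : returnSeries edgeVar (hyperedges N q) y
      - returnSeries edgeVar ((hyperedges N q).erase e) y
      = PowerSeries.C (edgeVar e) * (PowerSeries.X *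
        ((∑ z ∈ e, stepSeries σ edgeVar ((hyperedges N q).erase e) y z * (PowerSeries.C (σ z) *
            ∑ w ∈ e.erase z, walkSeries σ edgeVar (hyperedges N q) w y))
          + if y ∈ e then ∑ w ∈ e.erase y, walkSeries σ edgeVar (hyperedges N q) w y else 0)) := by
    rw [show returnSeries edgeVar (hyperedges N q) y
        = stepSeries σ edgeVar (hyperedges N q) y y from rfl,
      show returnSeries edgeVar ((hyperedges N q).erase e) y
        = stepSeries σ edgeVar ((hyperedges N q).erase e) y y from rfl,
      stepSeries_eq_erase σ _ _ he, add_assoc, add_sub_cancel_left,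
      mul_add, mul_add, Finset.mul_sum, Finset.mul_sum]
    refine congrArg₂ (· + ·) ((Finset.sum_congr rfl fun z _ => ?_).trans (Finset.mul_sum ..).symm) ?_
    · generalize (∑ w ∈ e.erase z, walkSeries σ edgeVar (hyperedges N q) w y) = s
      ring
    · split_ifs
      · rw [← Finset.mul_sum]
        generalize (∑ w ∈ e.erase y, walkSeries σ edgeVar (hyperedges N q) w y) = s
        ring
      · simp
  have b1 : SeriesBound (scaleWeight q N p K D) D (2 * (q * walkConst q p K D) ^ 2)
      (PowerSeries.X *
        ((∑ z ∈ e, stepSeries σ edgeVar ((hyperedges N q).erase e) y z * (PowerSeries.C (σ z) *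
            ∑ w ∈ e.erase z, walkSeries σ edgeVar (hyperedges N q) w y))
          + if y ∈ e then ∑ w ∈ e.erase y, walkSeries σ edgeVar (hyperedges N q) w y else 0)) := by
    have b2 := SeriesBound.sum hw e fun z _ => (h.seriesBound_stepSeries hσ hH y z).mul
      (by positivity) ((SeriesBound.C (D := D) hw ((hσ z).mulBound (H := hyperedges N q) (D := D)
        h.prob_nonneg h.K_nonneg)).mul (by positivity) (hS z))
    rw [Finset.sum_const, (Finset.mem_powersetCard.1 he).2, nsmul_eq_mul] at b2
    have b3 : SeriesBound (scaleWeight q N p K D) D (q * walkConst q p K D)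
        (if y ∈ e then ∑ w ∈ e.erase y, walkSeries σ edgeVar (hyperedges N q) w y else 0) := by
      split_ifs
      exacts [hS y, SeriesBound.zero hw (by positivity)]
    have b4 := (SeriesBound.X hw).mul (by positivity) (b2.add hw b3)
    refine b4.mono hw ?_
    have h1 : 1 ≤ q * walkConst q p K D := one_le_mul_of_one_le_of_one_le h.one_le_q hκ1
    have h2 : q * walkConst q p K D ≤ (q * walkConst q p K D) ^ 2 := by nlinarith
    calc _ = (q * walkConst q p K D) ^ 2 + q * walkConst q p K D := by ring
      _ ≤ _ := by linarith
  rw [e1]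
  refine (b1 _).trans (mul_le_mul_of_nonneg_left ?_ (by positivity))
  rw [snorm_C]
  exact h.wnorm_edgeVar_le he

end IsScale

end SparseHypergraph

end

noncomputable section

namespace SparseHypergraph

/-! ### Products of closed walks at several vertices -/

/-- A linear combination of the closed walks at `y` with `k` steps, sorted by the number of
returns. -/
def vertexFactor (H : Finset (Finset ℕ)) (V : ℕ) (a : ℕ → ℝ) (k y : ℕ) : EdgePoly :=
  ∑ v ∈ Finset.range (V + 1), MvPolynomial.C (a v) * closedWalk edgeVar H y k v

theorem vertexFactor_edgeDegreeLE {H : Finset (Finset ℕ)} (H' : Finset (Finset ℕ)) (V : ℕ)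
    (a : ℕ → ℝ) (k y : ℕ) : EdgeDegreeLE H k (vertexFactor H' V a k y) :=
  EdgeDegreeLE.sum _ fun v _ => by
    simpa using (EdgeDegreeLE.C (H := H) (a v)).mul (closedWalk_edgeDegreeLE H' y k v)

theorem prod_vertexFactor_edgeDegreeLE {H : Finset (Finset ℕ)} (H' : Finset (Finset ℕ)) (V : ℕ)
    (a : ℕ → ℕ → ℝ) (k : ℕ → ℕ) (Y : Finset ℕ) :
    EdgeDegreeLE H (∑ y ∈ Y, k y) (∏ y ∈ Y, vertexFactor H' V (a y) (k y) y) :=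
  EdgeDegreeLE.prod Y fun y _ => vertexFactor_edgeDegreeLE H' V (a y) (k y) y

theorem vertexFactor_mem {H : Finset (Finset ℕ)} {i : Option (Finset ℕ)}
    (hi : ∀ e ∈ H, some e ≠ i) (V : ℕ) (a : ℕ → ℝ) (k y : ℕ) :
    vertexFactor H V a k y ∈ freeOf i :=
  sum_mem fun v _ => mul_mem (C_mem_freeOf i _)
    (closedWalk_mem (freeOf i) (fun e he => edgeVar_mem_freeOf (hi e he)) y k v)

/-- The bound for one factor. -/
def factorConst (q : ℕ) (p K : ℝ) (D V : ℕ) (A : ℝ) : ℝ :=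
  1 + (V + 1) * (A * walkConst q p K D ^ V)

/-- The bound for the variation of a product of at most `n` factors. -/
def prodConst (q : ℕ) (p K : ℝ) (D V : ℕ) (A : ℝ) (n : ℕ) : ℝ :=
  n * factorConst q p K D V A ^ n * ((V + 1) * (A * (V * walkConst q p K D ^ V)))

namespace IsScale

variable {q N : ℕ} {p K : ℝ} (h : IsScale q N p K) {D V : ℕ} {A : ℝ}

include h

theorem one_le_factorConst (hA : 0 ≤ A) : 1 ≤ factorConst q p K D V A := by
  have := h.walkConst_nonneg (D := D)
  rw [factorConst]
  exact le_add_of_nonneg_right (by positivity)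

theorem prodConst_nonneg (hA : 0 ≤ A) (n : ℕ) : 0 ≤ prodConst q p K D V A n := by
  have h1 := h.walkConst_nonneg (D := D)
  have h2 := h.one_le_factorConst (D := D) (V := V) hA
  rw [prodConst]
  positivity

theorem mulBound_vertexFactor {H : Finset (Finset ℕ)} (hH : H ⊆ hyperedges N q) {a : ℕ → ℝ}
    (ha : ∀ v, |a v| ≤ A) {k : ℕ} (hk : k ≤ D) (y : ℕ) :
    MulBound (scaleWeight q N p K D) (factorConst q p K D V A) (vertexFactor H V a k y) := by
  have hw := h.weight_nonneg (D := D)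
  have hκ := h.one_le_walkConst (D := D)
  have hA : 0 ≤ A := (abs_nonneg _).trans (ha 0)
  refine (MulBound.sum hw (Finset.range (V + 1)) (κ := fun _ => A * walkConst q p K D ^ V)
    fun v hv => ?_).mono hw ?_
  · have h1 := (MulBound.C (w := scaleWeight q N p K D) (a v)).mul (by positivity)
      (h.mulBound_closedWalk hH y hk v)
    refine h1.mono hw (mul_le_mul (ha v) (pow_le_pow_right₀ hκ ?_) (by positivity) hA)
    exact Nat.lt_succ_iff.1 (Finset.mem_range.1 hv)
  · rw [Finset.sum_const, Finset.card_range, nsmul_eq_mul, factorConst]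
    push_cast
    linarith

theorem mulBound_prod_vertexFactor {H : Finset (Finset ℕ)} (hH : H ⊆ hyperedges N q)
    {a : ℕ → ℕ → ℝ} (ha : ∀ y v, |a y v| ≤ A) {k : ℕ → ℕ} {Y : Finset ℕ}
    (hk : ∀ y ∈ Y, k y ≤ D) {n : ℕ} (hn : Y.card ≤ n) :
    MulBound (scaleWeight q N p K D) (factorConst q p K D V A ^ n)
      (∏ y ∈ Y, vertexFactor H V (a y) (k y) y) := by
  have hA : 0 ≤ A := (abs_nonneg _).trans (ha 0 0)
  have h1 := h.one_le_factorConst (D := D) (V := V) hA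
  exact (MulBound.prod Y (zero_le_one.trans h1) fun y hy =>
    h.mulBound_vertexFactor hH (ha y) (hk y hy) y).mono h.weight_nonneg (pow_le_pow_right₀ h1 hn)

theorem wnorm_mul_vertexFactor_sub_le {H H' : Finset (Finset ℕ)} (hH : H ⊆ hyperedges N q)
    (hH' : H' ⊆ hyperedges N q) {a : ℕ → ℝ} (ha : ∀ v, |a v| ≤ A) {k : ℕ} (hk : k ≤ D) {y : ℕ}
    {P : EdgePoly} {ε : ℝ} (hε : snorm (scaleWeight q N p K D) D (PowerSeries.C P *
      (returnSeries edgeVar H y - returnSeries edgeVar H' y)) ≤ ε) :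
    wnorm (scaleWeight q N p K D) (P * (vertexFactor H V a k y - vertexFactor H' V a k y))
      ≤ (V + 1) * (A * (V * walkConst q p K D ^ V * ε)) := by
  have hw := h.weight_nonneg (D := D)
  have hκ := h.one_le_walkConst (D := D)
  have hA : 0 ≤ A := (abs_nonneg _).trans (ha 0)
  have hε0 : 0 ≤ ε := (snorm_nonneg hw _).trans hε
  have e1 : P * (vertexFactor H V a k y - vertexFactor H' V a k y)
      = ∑ v ∈ Finset.range (V + 1), MvPolynomial.C (a v) * PowerSeries.coeff k (PowerSeries.C P *
        (returnSeries edgeVar H y ^ v - returnSeries edgeVar H' y ^ v)) := by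
    rw [vertexFactor, vertexFactor, ← Finset.sum_sub_distrib, Finset.mul_sum]
    refine Finset.sum_congr rfl fun v _ => ?_
    rw [PowerSeries.coeff_C_mul, map_sub, closedWalk, closedWalk]
    ring
  rw [e1]
  calc _ ≤ ∑ v ∈ Finset.range (V + 1), A * (V * walkConst q p K D ^ V * ε) := by
        refine (wnorm_sum_le hw _ _).trans (Finset.sum_le_sum fun v hv => ?_)
        have hv' : v ≤ V := Nat.lt_succ_iff.1 (Finset.mem_range.1 hv)
        rw [wnorm_C_mul]
        refine mul_le_mul (ha v) ?_ (wnorm_nonneg hw _) hA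
        refine (wnorm_coeff_le hw _ hk).trans ((snorm_mul_pow_sub_pow_le hw hκ _
          (h.seriesBound_returnSeries hH y) (h.seriesBound_returnSeries hH' y) hε v).trans ?_)
        gcongr
    _ = _ := by
        rw [Finset.sum_const, Finset.card_range, nsmul_eq_mul]
        push_cast
        ring

theorem wnorm_mul_prod_vertexFactor_sub_le {H H' : Finset (Finset ℕ)} (hH : H ⊆ hyperedges N q)
    (hH' : H' ⊆ hyperedges N q) {a : ℕ → ℕ → ℝ} (ha : ∀ y v, |a y v| ≤ A) {k : ℕ → ℕ}
    {Y : Finset ℕ} (hk : ∀ y ∈ Y, k y ≤ D) {n : ℕ} (hn : Y.card ≤ n) {P : EdgePoly} {ε : ℝ}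
    (hε0 : 0 ≤ ε) (hε : ∀ y ∈ Y, snorm (scaleWeight q N p K D) D (PowerSeries.C P *
      (returnSeries edgeVar H y - returnSeries edgeVar H' y)) ≤ ε) :
    wnorm (scaleWeight q N p K D) (P * (∏ y ∈ Y, vertexFactor H V (a y) (k y) y
        - ∏ y ∈ Y, vertexFactor H' V (a y) (k y) y)) ≤ prodConst q p K D V A n * ε := by
  have hκ := h.walkConst_nonneg (D := D)
  have hA : 0 ≤ A := (abs_nonneg _).trans (ha 0 0)
  have h1 := h.one_le_factorConst (D := D) (V := V) hA
  refine (wnorm_mul_prod_sub_prod_le h.weight_nonneg Y h1 P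
    (fun y hy => h.mulBound_vertexFactor hH (ha y) (hk y hy) y)
    (fun y hy => h.mulBound_vertexFactor hH' (ha y) (hk y hy) y)
    fun y hy => h.wnorm_mul_vertexFactor_sub_le hH hH' (ha y) (hk y hy) (hε y hy)).trans ?_
  calc _ ≤ n * factorConst q p K D V A ^ n
        * ((V + 1) * (A * (V * walkConst q p K D ^ V * ε))) := by gcongr
    _ = _ := by rw [prodConst]; ring

/-! #### The contribution of one hyperedge -/

theorem wnorm_coeff_edgeSeries_le {e : Finset ℕ} (he : e ∈ hyperedges N q) (x : ℕ) {l : ℕ}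
    (hl : l ≤ D) :
    wnorm (scaleWeight q N p K D) (PowerSeries.coeff l (edgeSeries (hyperedges N q) e x))
      ≤ q * walkConst q p K D * (K * edgeProb q N p) := by
  have hw := h.weight_nonneg (D := D)
  have hκ := h.walkConst_nonneg (D := D)
  refine (wnorm_coeff_le hw _ hl).trans ?_
  have b1 := (SeriesBound.X (D := D) hw).mul (by positivity) (h.seriesBound_marker.mul
    (by positivity) (h.seriesBound_sum_erase he hκ x fun k =>
      h.seriesBound_walkSeries (isVertexWeight_markAt x) (Finset.Subset.refl _) k x))
  have b2 := b1 (PowerSeries.C (edgeVar e))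
  rw [snorm_C, one_mul, one_mul] at b2
  rw [edgeSeries, mul_comm PowerSeries.X, mul_assoc]
  exact b2.trans (mul_le_mul_of_nonneg_left (h.wnorm_edgeVar_le he) (by positivity))

/-- The excursions act as bounded multiplication operators, so only the norm of `edgeVar e ^ F * R`
counts. With `R` a difference of products, its smallness in the presence of `e` is preserved. -/
theorem wnorm_coeff_edgeMain_mul_le {e : Finset ℕ} (he : e ∈ hyperedges N q) (x : {z // z ∈ e})
    {l : ℕ} (hl : l ≤ D) {R : EdgePoly} {ε : ℝ}
    (hε : ∀ F ∈ Finset.Icc 1 D, wnorm (scaleWeight q N p K D) (edgeVar e ^ F * R) ≤ ε) :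
    wnorm (scaleWeight q N p K D) (PowerSeries.coeff l (edgeMain (hyperedges N q) e x D) * R)
      ≤ D * ((q * walkConst q p K D) ^ D * ε) := by
  have hw := h.weight_nonneg (D := D)
  have hκ1 := h.one_le_walkConst (D := D)
  have hκ := h.walkConst_nonneg (D := D)
  have hH := erase_subset_hyperedges (q := q) (N := N) e
  have hqκ : 1 ≤ q * walkConst q p K D := one_le_mul_of_one_le_of_one_le h.one_le_q hκ1
  have hcard : (Fintype.card {z // z ∈ e} : ℝ) = q := by
    rw [Fintype.card_coe, (Finset.mem_powersetCard.1 he).2]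
  have hentry : ∀ z w, SeriesBound (scaleWeight q N p K D) D (walkConst q p K D)
      (departMatrix e (wordWeight ((hyperedges N q).erase e) x) z w) := by
    intro z w
    simp only [departMatrix, Matrix.of_apply]
    split_ifs
    · exact SeriesBound.zero hw hκ
    · have := (h.seriesBound_markAt x z).mul hκ (h.seriesBound_walkSeries (D := D)
        (isVertexWeight_update (isVertexWeight_markAt x z) z) hH z z)
      simpa [wordWeight, closedSeries] using this
  have e1 : PowerSeries.coeff l (edgeMain (hyperedges N q) e x D) * R
      = PowerSeries.coeff l (∑ F ∈ Finset.Icc 1 D, PowerSeries.C (edgeVar e ^ F * R) *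
        (PowerSeries.X ^ F *
          (departMatrix e (wordWeight ((hyperedges N q).erase e) x) ^ F) x x)) := by
    rw [← PowerSeries.coeff_mul_C, edgeMain, Finset.sum_mul]
    refine congrArg _ (Finset.sum_congr rfl fun F _ => ?_)
    rw [map_mul, map_pow, mul_pow]
    ring
  rw [e1]
  calc _ ≤ ∑ F ∈ Finset.Icc 1 D, (q * walkConst q p K D) ^ D * ε := by
        refine (wnorm_coeff_le hw _ hl).trans ((snorm_sum_le hw _ _).trans
          (Finset.sum_le_sum fun F hF => ?_))
        have b1 := ((SeriesBound.X (D := D) hw).pow zero_le_one F).mul (by positivity)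
          (seriesBound_matrix_pow hw hκ hentry F x x)
        refine (b1 _).trans ?_
        rw [one_pow, one_mul, snorm_C, hcard]
        exact mul_le_mul (pow_le_pow_right₀ hqκ (Finset.mem_Icc.1 hF).2) (hε F hF)
          (wnorm_nonneg hw _) (by positivity)
    _ = _ := by rw [Finset.sum_const, Nat.card_Icc, Nat.add_sub_cancel, nsmul_eq_mul]

end IsScale

/-- The constant in `IsScale.abs_momentFun_edgeSeries_sub_le`. -/
def goodEdgeConst (q : ℕ) (p K : ℝ) (D V : ℕ) (A : ℝ) (n : ℕ) : ℝ :=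
  factorConst q p K D V A ^ n * edgeConst q p K D
    + D * ((q * walkConst q p K D) ^ D * (prodConst q p K D V A n *
      (q * (stepConst q p K D * (q * walkConst q p K D)) * (D * walkConst q p K D *
        (stepConst q p K D ^ D * K)))))

theorem coeff_edgeMain_edgeDegreeLE {H : Finset (Finset ℕ)} (H' : Finset (Finset ℕ))
    (e : Finset ℕ) (x : {z // z ∈ e}) (D l : ℕ) :
    EdgeDegreeLE H l (PowerSeries.coeff l (edgeMain H' e x D)) := by
  have hmark : ∀ z, EdgeDegreeLE H 0 (markAt x z) := fun z =>
    (isVertexWeight_markAt x z).edgeDegreeLE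
  have hword : ∀ z, wordWeight (H'.erase e) x z ∈ gradedSeries H := fun z =>
    mul_mem (C_mem_gradedSeries (hmark z)) (walkSeries_mem_gradedSeries
      (fun i => (isVertexWeight_update (isVertexWeight_markAt x z) z i).edgeDegreeLE) _ z z)
  have hpow : ∀ (F : ℕ) (i j : {z // z ∈ e}),
      (departMatrix e (wordWeight (H'.erase e) x) ^ F) i j ∈ gradedSeries H := by
    intro F
    induction F with
    | zero =>
      intro i j
      rw [pow_zero, Matrix.one_apply]
      split_ifs
      exacts [one_mem _, zero_mem _]
    | succ F ih =>
      intro i j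
      rw [pow_succ, Matrix.mul_apply]
      refine sum_mem fun k _ => mul_mem (ih i k) ?_
      simp only [departMatrix, Matrix.of_apply]
      split_ifs
      exacts [zero_mem _, hword _]
  have : edgeMain H' e x D ∈ gradedSeries H :=
    sum_mem fun F _ => mul_mem (pow_mem (X_mul_edgeVar_mem_gradedSeries e) F) (hpow F x x)
  exact this l

theorem coeff_edgeSeries_edgeDegreeLE {H : Finset (Finset ℕ)} (H' : Finset (Finset ℕ))
    (e : Finset ℕ) (x l : ℕ) :
    EdgeDegreeLE H l (PowerSeries.coeff l (edgeSeries H' e x)) := by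
  have : edgeSeries H' e x ∈ gradedSeries H :=
    mul_mem (X_mul_edgeVar_mem_gradedSeries e) (mul_mem (C_mem_gradedSeries EdgeDegreeLE.marker)
      (sum_mem fun w _ => walkSeries_mem_gradedSeries
        (fun i => (isVertexWeight_markAt x i).edgeDegreeLE) _ w x))
  exact this l

namespace IsScale

variable {q N : ℕ} {p K : ℝ} (h : IsScale q N p K) {D V : ℕ} {A : ℝ} {X : ℕ → ℝ}
  (hX : ∀ F, |X F| ≤ K ^ F * F.factorial)

include h hX

/-- The crude bound of order `c`, sufficient for the few hyperedges that also meet `Y`. -/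
theorem abs_momentFun_edgeSeries_le {a : ℕ → ℕ → ℝ}
    (ha : ∀ y v, |a y v| ≤ A) {k : ℕ → ℕ} {Y : Finset ℕ} {l : ℕ}
    (hk : l + ∑ y ∈ Y, k y ≤ D) {n : ℕ} (hn : Y.card ≤ n) {e : Finset ℕ}
    (he : e ∈ hyperedges N q) (x r : ℕ) :
    |momentFun (hyperedges N q) (edgeProb q N p) X r
      (PowerSeries.coeff l (edgeSeries (hyperedges N q) e x)
        * ∏ y ∈ Y, vertexFactor (hyperedges N q) V (a y) (k y) y)|
      ≤ factorConst q p K D V A ^ n * (q * walkConst q p K D * K) * edgeProb q N p := by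
  have hA : 0 ≤ A := (abs_nonneg _).trans (ha 0 0)
  have hf := h.one_le_factorConst (D := D) (V := V) hA
  have hkY : ∀ y ∈ Y, k y ≤ D := fun y hy =>
    (Finset.single_le_sum (f := k) (fun _ _ => Nat.zero_le _) hy).trans (by omega)
  refine (abs_momentFun_le h.prob_nonneg h.K_nonneg hX r
    (((coeff_edgeSeries_edgeDegreeLE _ e x l).mul
      (prod_vertexFactor_edgeDegreeLE _ V a k Y)).mono hk)).trans ?_
  refine (h.mulBound_prod_vertexFactor (Finset.Subset.refl _) ha hkY hn _).trans ?_
  refine (mul_le_mul_of_nonneg_left (h.wnorm_coeff_edgeSeries_le he x (by omega))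
    (by positivity)).trans (le_of_eq (by ring))

/-- If `e` avoids the other vertices, its contribution factorizes up to a small error. -/
theorem abs_momentFun_edgeSeries_sub_le {a : ℕ → ℕ → ℝ}
    (ha : ∀ y v, |a y v| ≤ A) {k : ℕ → ℕ} {Y : Finset ℕ} {l : ℕ}
    (hk : l + ∑ y ∈ Y, k y ≤ D) {n : ℕ} (hn : Y.card ≤ n) {e : Finset ℕ}
    (he : e ∈ hyperedges N q) (heY : ∀ y ∈ Y, y ∉ e) (x : {z // z ∈ e}) (r : ℕ) :
    |momentFun (hyperedges N q) (edgeProb q N p) X r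
        (PowerSeries.coeff l (edgeSeries (hyperedges N q) e x)
          * ∏ y ∈ Y, vertexFactor (hyperedges N q) V (a y) (k y) y)
      - momentFun (hyperedges N q) (edgeProb q N p) X r
        (PowerSeries.coeff l (edgeMain (hyperedges N q) e x D)
          * ∏ y ∈ Y, vertexFactor ((hyperedges N q).erase e) V (a y) (k y) y)|
      ≤ goodEdgeConst q p K D V A n * edgeProb q N p / N := by
  have hA : 0 ≤ A := (abs_nonneg _).trans (ha 0 0)
  have hf := h.one_le_factorConst (D := D) (V := V) hA
  have hκ := h.walkConst_nonneg (D := D)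
  have hs := zero_le_one.trans (h.one_le_stepConst (D := D))
  have hN := h.N_pos
  have hc := h.prob_nonneg
  have hK := h.K_nonneg
  have hw := h.weight_nonneg (D := D)
  have hpc := h.prodConst_nonneg (D := D) (V := V) hA n
  have hH := erase_subset_hyperedges (q := q) (N := N) e
  have hkY : ∀ y ∈ Y, k y ≤ D := fun y hy =>
    (Finset.single_le_sum (f := k) (fun _ _ => Nat.zero_le _) hy).trans (by omega)
  set T := PowerSeries.coeff l (edgeSeries (hyperedges N q) e x)
  set M := PowerSeries.coeff l (edgeMain (hyperedges N q) e x D)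
  set Q := ∏ y ∈ Y, vertexFactor (hyperedges N q) V (a y) (k y) y
  set Q' := ∏ y ∈ Y, vertexFactor ((hyperedges N q).erase e) V (a y) (k y) y
  have hdT : EdgeDegreeLE (hyperedges N q) D (T * Q) :=
    ((coeff_edgeSeries_edgeDegreeLE _ e x l).mul
      (prod_vertexFactor_edgeDegreeLE _ V a k Y)).mono hk
  have hdM : EdgeDegreeLE (hyperedges N q) D (M * Q') :=
    ((coeff_edgeMain_edgeDegreeLE _ e x D l).mul
      (prod_vertexFactor_edgeDegreeLE _ V a k Y)).mono hk
  rw [← map_sub]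
  refine (abs_momentFun_le h.prob_nonneg h.K_nonneg hX r
    (by rw [sub_eq_add_neg]; exact hdT.add hdM.neg)).trans ?_
  -- First the excursions from `e` are closed, then `e` is removed from the walks at the vertices of
  -- `Y`.
  have e1 : T * Q - M * Q' = (T - M) * Q + M * (Q - Q') := by ring
  rw [e1]
  refine (wnorm_add_le hw _ _).trans ?_
  have b1 : wnorm (scaleWeight q N p K D) ((T - M) * Q)
      ≤ factorConst q p K D V A ^ n * (edgeConst q p K D * edgeProb q N p / N) :=
    (h.mulBound_prod_vertexFactor (Finset.Subset.refl _) ha hkY hn _).trans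
      (mul_le_mul_of_nonneg_left (h.wnorm_edgeSeries_sub_edgeMain_le he x (by omega))
        (by positivity))
  have b2 : wnorm (scaleWeight q N p K D) (M * (Q - Q'))
      ≤ D * ((q * walkConst q p K D) ^ D * (prodConst q p K D V A n *
        (q * (stepConst q p K D * (q * walkConst q p K D)) * (D * walkConst q p K D / N
          * (stepConst q p K D ^ D * (K * edgeProb q N p)))))) := by
    refine h.wnorm_coeff_edgeMain_mul_le he x (by omega) fun F hF => ?_
    rw [Finset.mem_Icc] at hF
    refine h.wnorm_mul_prod_vertexFactor_sub_le (Finset.Subset.refl _) hH ha hkY hn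
      (by positivity) fun y hy => ?_
    refine (h.snorm_returnSeries_sub_le_of_notMem he (heY y hy) F).trans ?_
    gcongr
    exact h.wnorm_edgeVar_pow_le he hF.1 hF.2
  refine (add_le_add b1 b2).trans (le_of_eq ?_)
  rw [goodEdgeConst]
  ring

/-- Removal of one hyperedge changes the moments only slightly. -/
theorem abs_momentFun_prod_erase_sub_le {a : ℕ → ℕ → ℝ}
    (ha : ∀ y v, |a y v| ≤ A) {k : ℕ → ℕ} {Y : Finset ℕ}
    (hk : ∑ y ∈ Y, k y ≤ D) {n : ℕ} (hn : Y.card ≤ n) {e : Finset ℕ}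
    (he : e ∈ hyperedges N q) (r : ℕ) :
    |momentFun (hyperedges N q) (edgeProb q N p) X r
        (∏ y ∈ Y, vertexFactor (hyperedges N q) V (a y) (k y) y)
      - momentFun (hyperedges N q) (edgeProb q N p) X r
        (∏ y ∈ Y, vertexFactor ((hyperedges N q).erase e) V (a y) (k y) y)|
      ≤ prodConst q p K D V A n * (2 * (q * walkConst q p K D) ^ 2 * (K * p)) / N := by
  have hA : 0 ≤ A := (abs_nonneg _).trans (ha 0 0)
  have hκ := h.walkConst_nonneg (D := D)
  have hK := h.K_nonneg
  have hp := h.pos.le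
  have hN := h.N_pos
  have hpc := h.prodConst_nonneg (D := D) (V := V) hA n
  have hH := erase_subset_hyperedges (q := q) (N := N) e
  have hkY : ∀ y ∈ Y, k y ≤ D := fun y hy =>
    (Finset.single_le_sum (f := k) (fun _ _ => Nat.zero_le _) hy).trans hk
  rw [← map_sub]
  refine (abs_momentFun_le h.prob_nonneg h.K_nonneg hX r (D := D) ?_).trans ?_
  · rw [sub_eq_add_neg]
    exact ((prod_vertexFactor_edgeDegreeLE _ V a k Y).mono hk).add
      ((prod_vertexFactor_edgeDegreeLE _ V a k Y).mono hk).neg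
  have b1 := h.wnorm_mul_prod_vertexFactor_sub_le (V := V) (Finset.Subset.refl _) hH ha hkY hn
    (P := 1) (ε := 2 * (q * walkConst q p K D) ^ 2 * (K * (p / N))) (by positivity) fun y _ => by
      rw [map_one, one_mul]
      refine (h.snorm_returnSeries_sub_le he y).trans ?_
      gcongr
      exact h.prob_le
  rw [one_mul] at b1
  exact b1.trans (le_of_eq (by ring))

end IsScale

end SparseHypergraph

end

noncomputable section

namespace SparseHypergraph

/-! ### Evaluation of the main part of a hyperedge -/

/-- The limit of the expectation of `vertexFactor`. -/
def limitFactor (S : ℕ → ℕ → ℝ) (V : ℕ) (a : ℕ → ℝ) (k : ℕ) : ℝ :=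
  ∑ v ∈ Finset.range (V + 1), a v * S k v

/-- The coefficients of the vertex factor at `z` that belongs to a word with departure numbers `f`
and excursions of total length `u`. -/
def wordCoeff (x r : ℕ) (f u : ℕ →₀ ℕ) (z v : ℕ) : ℝ :=
  if z = x then (if f x + v = r then (Nat.multichoose (f x) v : ℝ) else 0)
  else if 2 * v ≤ u z then (Nat.multichoose (f z) v : ℝ) else 0

theorem multichoose_le_two_pow (n k : ℕ) : Nat.multichoose n k ≤ 2 ^ (n + k) := by
  rw [Nat.multichoose_eq]
  exact (Nat.choose_le_two_pow _ _).trans (Nat.pow_le_pow_right (by norm_num) (by omega))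

/-- The cut-offs in `wordCoeff` force `v ≤ D` whenever the coefficient is nonzero, which makes the
bound uniform in `v`. -/
theorem abs_wordCoeff_le {x r : ℕ} {f u : ℕ →₀ ℕ} {d D : ℕ} (hf : ∀ z, f z ≤ d)
    (hr : r ≤ D) (hu : ∀ z, u z ≤ D) (z v : ℕ) : |wordCoeff x r f u z v| ≤ 2 ^ (d + D) := by
  have key : ∀ z, v ≤ D → (Nat.multichoose (f z) v : ℝ) ≤ 2 ^ (d + D) := fun z hv => by
    have h1 := (multichoose_le_two_pow (f z) v).trans
      (Nat.pow_le_pow_right (by norm_num) (add_le_add (hf z) hv))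
    exact_mod_cast h1
  rw [abs_of_nonneg (by unfold wordCoeff; split_ifs <;> positivity), wordCoeff]
  split_ifs with h1 h2 h2
  · exact key x (by omega)
  · positivity
  · exact key z (by have := hu z; omega)
  · positivity

/-- The marker collects the `f` departures along the hyperedge and the `v` departures on the
excursions. -/
theorem coeff_wordWeight_pow_root (H : Finset (Finset ℕ)) (x f u : ℕ) {V : ℕ} (hV : u / 2 ≤ V) :
    PowerSeries.coeff u (wordWeight H x x ^ f) = ∑ v ∈ Finset.range (V + 1),
      (MvPolynomial.C (Nat.multichoose f v : ℝ) * (marker ^ (f + v) *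
        closedWalk edgeVar H x u v)) := by
  have h1 : markAt x x = marker := Function.update_self ..
  rw [wordWeight, closedSeries, h1, mul_pow, ← map_pow, PowerSeries.coeff_C_mul,
    coeff_walkSeries_pow edgeVar H x marker f u hV, Finset.mul_sum]
  refine Finset.sum_congr rfl fun v _ => ?_
  rw [pow_add, map_natCast]
  ring

theorem coeff_wordWeight_pow_of_ne (H : Finset (Finset ℕ)) {x z : ℕ} (hz : z ≠ x) (f u : ℕ) {V : ℕ}
    (hV : u / 2 ≤ V) :
    PowerSeries.coeff u (wordWeight H x z ^ f)
      = vertexFactor H V (fun v => if 2 * v ≤ u then (Nat.multichoose f v : ℝ) else 0) u z := by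
  have h1 : markAt x z = 1 := by rw [markAt, Function.update_of_ne hz]; rfl
  rw [wordWeight, closedSeries, h1, map_one, one_mul,
    coeff_walkSeries_pow edgeVar H z 1 f u hV, vertexFactor]
  refine Finset.sum_congr rfl fun v _ => ?_
  rw [one_pow, one_mul]
  split_ifs with h2
  · rw [map_natCast]
  · rw [closedWalk_eq_zero edgeVar H z (by omega), mul_zero, mul_zero]

section Evaluation

variable {H : Finset (Finset ℕ)} {c : ℝ} {X : ℕ → ℝ} {r : ℕ} {e : Finset ℕ} {x : ℕ}

/-- The variable of `e` splits off as `c * X F`, since the excursions and `Q` do not contain it. The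
prescribed exponent `r` of the marker selects `f x + v = r` at the root; this is the constraint
built into `wordCoeff`. -/
theorem momentFun_edgeVar_pow_mul_coeff_prod (he : e ∈ H) (hx : x ∈ e) {F : ℕ} (hF : F ≠ 0)
    (f : ℕ →₀ ℕ) {n V : ℕ} (hV : n ≤ V) {Q : EdgePoly} (hQ : Q ∈ freeOf none)
    (hQe : Q ∈ freeOf (some e)) :
    momentFun H c X r (edgeVar e ^ F *
        (PowerSeries.coeff n (∏ z ∈ e, wordWeight (H.erase e) x z ^ f z) * Q))
      = c * X F * ∑ u ∈ e.finsuppAntidiag n, momentFun H c X 0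
        ((∏ z ∈ e, vertexFactor (H.erase e) V (wordCoeff x r f u z) (u z) z) * Q) := by
  have hfree : ∀ e' ∈ H.erase e, some e' ≠ some e := fun e' h' h'' =>
    Finset.ne_of_mem_erase h' (Option.some.inj h'')
  have hnone : ∀ e' ∈ H.erase e, some e' ≠ none := fun _ _ => by simp
  have hmark : marker ∈ freeOf (some e) := (MvPolynomial.X_mem_supported (R := ℝ)).2 (by simp)
  rw [PowerSeries.coeff_prod, Finset.sum_mul, Finset.mul_sum, map_sum, Finset.mul_sum]
  refine Finset.sum_congr rfl fun u hu => ?_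
  have hun : ∀ z ∈ e, u z / 2 ≤ V := fun z hz => by
    have h1 : ∑ i ∈ e, u i = n := (Finset.mem_finsuppAntidiag.1 hu).1
    have h2 := Finset.single_le_sum (f := fun i => u i) (fun _ _ => Nat.zero_le _) hz
    omega
  set R := (∏ z ∈ e.erase x, vertexFactor (H.erase e) V (wordCoeff x r f u z) (u z) z) * Q
  have hR : R ∈ freeOf none :=
    mul_mem (prod_mem fun z _ => vertexFactor_mem hnone V _ _ z) hQ
  have hRe : R ∈ freeOf (some e) :=
    mul_mem (prod_mem fun z _ => vertexFactor_mem hfree V _ _ z) hQe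
  have e1 : ∏ z ∈ e, PowerSeries.coeff (u z) (wordWeight (H.erase e) x z ^ f z)
      = (∑ v ∈ Finset.range (V + 1), (MvPolynomial.C (Nat.multichoose (f x) v : ℝ) *
          (marker ^ (f x + v) * closedWalk edgeVar (H.erase e) x (u x) v)))
        * ∏ z ∈ e.erase x, vertexFactor (H.erase e) V (wordCoeff x r f u z) (u z) z := by
    rw [← Finset.mul_prod_erase e _ hx, coeff_wordWeight_pow_root _ _ _ _ (hun x hx)]
    refine congrArg _ (Finset.prod_congr rfl fun z hz => ?_)
    have hzx := Finset.ne_of_mem_erase hz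
    rw [coeff_wordWeight_pow_of_ne _ hzx _ _ (hun z (Finset.mem_of_mem_erase hz))]
    congr 1
    funext v
    rw [wordCoeff, if_neg hzx]
  have e3 : (∏ z ∈ e, vertexFactor (H.erase e) V (wordCoeff x r f u z) (u z) z) * Q
      = ∑ v ∈ Finset.range (V + 1), MvPolynomial.C (wordCoeff x r f u x v) *
        (closedWalk edgeVar (H.erase e) x (u x) v * R) := by
    rw [← Finset.mul_prod_erase e _ hx, mul_assoc, vertexFactor, Finset.sum_mul]
    exact Finset.sum_congr rfl fun v _ => mul_assoc _ _ _
  rw [e1, e3, mul_assoc, Finset.sum_mul, Finset.mul_sum, map_sum, map_sum, Finset.mul_sum]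
  refine Finset.sum_congr rfl fun v _ => ?_
  have hcw : ∀ i, (∀ e' ∈ H.erase e, some e' ≠ i) →
      closedWalk edgeVar (H.erase e) x (u x) v ∈ freeOf i := fun i hi =>
    closedWalk_mem (freeOf i) (fun e' he' => edgeVar_mem_freeOf (hi e' he')) _ _ _
  have e2 : edgeVar e ^ F * (MvPolynomial.C (Nat.multichoose (f x) v : ℝ) *
      (marker ^ (f x + v) * closedWalk edgeVar (H.erase e) x (u x) v) * R)
      = MvPolynomial.C (Nat.multichoose (f x) v : ℝ) * (edgeVar e ^ F * (marker ^ (f x + v) *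
        (closedWalk edgeVar (H.erase e) x (u x) v * R))) := by ring
  rw [e2, momentFun_C_mul, momentFun_edgeVar_pow_mul he hF (mul_mem (pow_mem hmark _)
    (mul_mem (hcw _ hfree) hRe)), momentFun_marker_pow_mul _ (mul_mem (hcw _ hnone) hR),
    momentFun_C_mul, wordCoeff, if_pos rfl]
  split_ifs <;> ring

theorem momentFun_coeff_edgeMain_mul (he : e ∈ H) (hx : x ∈ e) {l D V : ℕ} (hl : l ≤ D)
    (hV : l ≤ V) {Q : EdgePoly} (hQ : Q ∈ freeOf none) (hQe : Q ∈ freeOf (some e)) :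
    momentFun H c X r (PowerSeries.coeff l (edgeMain H e ⟨x, hx⟩ D) * Q)
      = c * ∑ F ∈ Finset.Icc 1 l, X F * wordSum e x F fun j f => if j = x then
        ∑ u ∈ e.finsuppAntidiag (l - F), momentFun H c X 0
          ((∏ z ∈ e, vertexFactor (H.erase e) V (wordCoeff x r f u z) (u z) z) * Q) else 0 := by
  have e1 : PowerSeries.coeff l (edgeMain H e ⟨x, hx⟩ D) * Q = ∑ F ∈ Finset.Icc 1 l,
      edgeVar e ^ F * (PowerSeries.coeff (l - F)
        ((departMatrix e (wordWeight (H.erase e) x) ^ F) ⟨x, hx⟩ ⟨x, hx⟩) * Q) := by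
    rw [edgeMain, map_sum, Finset.sum_mul]
    symm
    refine Finset.sum_subset_zero_on_sdiff (Finset.Icc_subset_Icc_right hl) (fun F hF => ?_)
      fun F hF => ?_
    · rw [Finset.mem_sdiff, Finset.mem_Icc, Finset.mem_Icc] at hF
      rw [mul_pow, mul_assoc, PowerSeries.coeff_X_pow_mul', if_neg (by omega), zero_mul]
    · rw [Finset.mem_Icc] at hF
      rw [mul_pow, mul_assoc, PowerSeries.coeff_X_pow_mul', if_pos hF.2, ← map_pow,
        PowerSeries.coeff_C_mul, mul_assoc]
  rw [e1, map_sum, Finset.mul_sum]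
  refine Finset.sum_congr rfl fun F hF => ?_
  rw [Finset.mem_Icc] at hF
  rw [departMatrix_pow_apply_self]
  have h1 := map_wordSum (e := e) (x := x) ((momentFun H c X r).toAddMonoidHom.comp
    ((AddMonoidHom.mulLeft (edgeVar e ^ F)).comp ((AddMonoidHom.mulRight Q).comp
      (PowerSeries.coeff (R := EdgePoly) (l - F)).toAddMonoidHom))) F
    fun j f => if j = x then ∏ z ∈ e, wordWeight (H.erase e) x z ^ f z else 0
  simp only [AddMonoidHom.comp_apply, LinearMap.toAddMonoidHom_coe, AddMonoidHom.coe_mulLeft,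
    AddMonoidHom.mulRight_apply] at h1
  rw [h1, ← mul_assoc]
  have h2 := map_wordSum (e := e) (x := x) (AddMonoidHom.mulLeft (c * X F)) F
    fun j f => if j = x then ∑ u ∈ e.finsuppAntidiag (l - F), momentFun H c X 0
      ((∏ z ∈ e, vertexFactor (H.erase e) V (wordCoeff x r f u z) (u z) z) * Q) else 0
  simp only [AddMonoidHom.coe_mulLeft] at h2
  rw [h2]
  refine wordSum_congr hx F fun j _ f _ _ => ?_
  split_ifs
  · exact momentFun_edgeVar_pow_mul_coeff_prod he hx (by omega) f (by omega) hQ hQe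
  · simp

/-- The deterministic counterpart of `momentFun_edgeVar_pow_mul_coeff_prod`: the same coefficients
`wordCoeff` appear, with `S` in place of the expected closed walks. -/
theorem coeff_rootSeries_mul_prod (S : ℕ → ℕ → ℝ) (hx : x ∈ e) (f : ℕ →₀ ℕ) {n V : ℕ}
    (hV : n ≤ V) (hr : r ≤ V) :
    PowerSeries.coeff n (rootSeries S r (f x) * ∏ z ∈ e.erase x, childSeries S (f z))
      = ∑ u ∈ e.finsuppAntidiag n, ∏ z ∈ e, limitFactor S V (wordCoeff x r f u z) (u z) := by
  have e1 : rootSeries S r (f x) * ∏ z ∈ e.erase x, childSeries S (f z)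
      = ∏ z ∈ e, if z = x then rootSeries S r (f x) else childSeries S (f z) := by
    rw [← Finset.mul_prod_erase e _ hx, if_pos rfl]
    refine congrArg _ (Finset.prod_congr rfl fun z hz => ?_)
    rw [if_neg (Finset.ne_of_mem_erase hz)]
  rw [e1, PowerSeries.coeff_prod]
  refine Finset.sum_congr rfl fun u hu => Finset.prod_congr rfl fun z hz => ?_
  have huz : u z ≤ V := by
    have h1 : ∑ i ∈ e, u i = n := (Finset.mem_finsuppAntidiag.1 hu).1
    have h2 := Finset.single_le_sum (f := fun i => u i) (fun _ _ => Nat.zero_le _) hz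
    omega
  by_cases hzx : z = x
  · subst hzx
    rw [if_pos rfl, rootSeries, PowerSeries.coeff_mk, limitFactor]
    simp only [wordCoeff, if_true]
    split_ifs with h1
    · rw [Finset.sum_eq_single (r - f z)]
      · rw [if_pos (by omega)]
      · intro v _ hv
        rw [if_neg (by omega), zero_mul]
      · intro h2
        exact absurd (Finset.mem_range.2 (by omega)) h2
    · exact (Finset.sum_eq_zero fun v _ => by rw [if_neg (by omega), zero_mul]).symm
  · rw [if_neg hzx, childSeries, PowerSeries.coeff_mk, limitFactor]
    refine Finset.sum_subset_zero_on_sdiff (Finset.range_subset_range.2 (by omega))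
      (fun v hv => ?_) fun v hv => ?_
    · rw [Finset.mem_sdiff, Finset.mem_range, Finset.mem_range] at hv
      rw [wordCoeff, if_neg hzx, if_neg (by omega), zero_mul]
    · rw [Finset.mem_range] at hv
      rw [wordCoeff, if_neg hzx, if_pos (by omega)]

/-- The closed walks at `x` with `r` returns, as a sum over the hyperedge of the first step. -/
theorem momentFun_closedWalk_mul {l : ℕ} (hl : 1 ≤ l) {V : ℕ} (hlV : l ≤ V) (hr : r ≤ V)
    {Q : EdgePoly} (hQ : Q ∈ freeOf none) :
    momentFun H c X 0 (closedWalk edgeVar H x l r * Q)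
      = ∑ e ∈ H with x ∈ e,
        momentFun H c X r (PowerSeries.coeff l (edgeSeries H e x) * Q) := by
  have h1 := congrArg (PowerSeries.coeff (R := EdgePoly) l) (walkSeries_markAt_self H x)
  rw [coeff_walkSeries, markAt, coeff_walkSeries_self edgeVar H x marker l (V := V) (by omega),
    map_add, PowerSeries.coeff_one, if_neg (by omega), zero_add, map_sum] at h1
  rw [← map_sum, ← Finset.sum_mul, ← h1, Finset.sum_mul, map_sum]
  have hnone : ∀ e' ∈ H, edgeVar e' ∈ freeOf none := fun _ _ => edgeVar_mem_freeOf (by simp)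
  have h2 : ∀ v, momentFun H c X r (marker ^ v * closedWalk edgeVar H x l v * Q)
      = if v = r then momentFun H c X 0 (closedWalk edgeVar H x l v * Q) else 0 := fun v => by
    rw [mul_assoc, momentFun_marker_pow_mul _ (mul_mem (closedWalk_mem _ hnone x l v) hQ)]
  simp only [h2]
  rw [Finset.sum_ite_eq', if_pos (Finset.mem_range.2 (by omega))]

end Evaluation

end SparseHypergraph

end

noncomputable section

namespace SparseHypergraph

/-! ### Counting the hyperedges of a vertex -/

theorem card_edges_mem {N q x : ℕ} (hq : 1 ≤ q) (hx : x ∈ Finset.range N) :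
    ((hyperedges N q).filter (x ∈ ·)).card = (N - 1).choose (q - 1) := by
  have hN : 1 ≤ N := by have := Finset.mem_range.1 hx; omega
  have h1 : (hyperedges N q).filter (fun e => ¬ x ∈ e)
      = ((Finset.range N).erase x).powersetCard q := by
    ext e
    simp only [Finset.mem_filter, Finset.mem_powersetCard, Finset.subset_erase]
    tauto
  have h2 := Finset.card_filter_add_card_filter_not (s := hyperedges N q) (fun e => x ∈ e)
  rw [h1, Finset.card_powersetCard, Finset.card_powersetCard, Finset.card_erase_of_mem hx,
    Finset.card_range] at h2
  obtain ⟨M, rfl⟩ : ∃ M, N = M + 1 := ⟨N - 1, by omega⟩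
  obtain ⟨m, rfl⟩ : ∃ m, q = m + 1 := ⟨q - 1, by omega⟩
  rw [Nat.choose_succ_succ'] at h2
  simp only [Nat.add_sub_cancel] at h2 ⊢
  omega

/-- The quantity is the falling factorial of `N - 1` of length `q - 1` divided by `N ^ (q - 1)`,
hence at most `1` and close to `1`. -/
theorem IsScale.abs_card_edges_sub_le {q N : ℕ} {p K : ℝ} (h : IsScale q N p K) {x : ℕ}
    (hx : x ∈ Finset.range N) :
    |(((hyperedges N q).filter (x ∈ ·)).card : ℝ) * edgeProb q N p *
      (((q - 1).factorial : ℝ) / p) - 1| ≤ q ^ 2 / N := by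
  have hq := h.two_le
  have hp := h.pos
  have hN := h.N_pos
  have hN1 := h.N_ge
  rw [card_edges_mem (by omega) hx, edgeProb]
  have e1 : (((N - 1).choose (q - 1) : ℕ) : ℝ) * (p / (N : ℝ) ^ (q - 1)) *
      (((q - 1).factorial : ℝ) / p) = ((N - 1).descFactorial (q - 1) : ℝ) / (N : ℝ) ^ (q - 1) := by
    rw [Nat.descFactorial_eq_factorial_mul_choose]
    push_cast
    field_simp
  rw [e1]
  have hup : ((N - 1).descFactorial (q - 1) : ℝ) / (N : ℝ) ^ (q - 1) ≤ 1 := by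
    rw [div_le_one (by positivity)]
    have h1 : (N - 1).descFactorial (q - 1) ≤ N ^ (q - 1) :=
      (Nat.descFactorial_le_pow _ _).trans (Nat.pow_le_pow_left (by omega) _)
    exact_mod_cast h1
  have hlow : 1 - (q : ℝ) ^ 2 / N ≤ ((N - 1).descFactorial (q - 1) : ℝ) / (N : ℝ) ^ (q - 1) := by
    -- For `N < q` there may be no hyperedge at all, but then `q ^ 2 / N ≥ 1` and the bound is
    -- trivial.
    by_cases hNq : N < q
    · have h1 : 1 ≤ (q : ℝ) ^ 2 / N := by
        rw [one_le_div hN]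
        have h2 : (N : ℝ) ≤ q := by exact_mod_cast hNq.le
        have h3 := h.one_le_q
        nlinarith
      have h4 : 0 ≤ ((N - 1).descFactorial (q - 1) : ℝ) / (N : ℝ) ^ (q - 1) := by positivity
      linarith
    · have h1 := Nat.pow_sub_le_descFactorial (N - 1) (q - 1)
      have h2 : ((N - 1 + 1 - (q - 1) : ℕ) : ℝ) = N - (q - 1) := by
        rw [Nat.cast_sub (by omega), Nat.cast_sub (by omega)]
        push_cast [Nat.cast_sub hN1]
        ring
      have h3 : ((N : ℝ) - (q - 1)) ^ (q - 1) ≤ ((N - 1).descFactorial (q - 1) : ℝ) := by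
        rw [← h2]; exact_mod_cast h1
      have hqN : (q : ℝ) ≤ N := by exact_mod_cast not_lt.1 hNq
      -- Bernoulli's inequality: `(1 - (q - 1) / N) ^ (q - 1) ≥ 1 - (q - 1) ^ 2 / N`.
      have h4 := one_add_mul_le_pow (a := -((q - 1) / N : ℝ)) (by
        have : ((q : ℝ) - 1) / N ≤ 1 := by rw [div_le_one hN]; linarith
        linarith) (q - 1)
      have h5 : (1 + -((q - 1) / N : ℝ)) ^ (q - 1)
          ≤ ((N - 1).descFactorial (q - 1) : ℝ) / (N : ℝ) ^ (q - 1) := by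
        rw [le_div_iff₀ (by positivity), ← mul_pow]
        refine le_trans (le_of_eq ?_) h3
        congr 1
        field_simp
        ring
      refine le_trans ?_ (h4.trans h5)
      rw [Nat.cast_sub (by omega), Nat.cast_one]
      have h6 : ((q : ℝ) - 1) * (q - 1) / N ≤ (q : ℝ) ^ 2 / N := by
        have := h.one_le_q
        gcongr
        nlinarith
      have h7 : ((q : ℝ) - 1) * -((q - 1) / N : ℝ) = - (((q : ℝ) - 1) * (q - 1) / N) := by ring
      rw [h7]
      linarith
  rw [abs_le]
  constructor
  · linarith
  · have : (0 : ℝ) ≤ (q : ℝ) ^ 2 / N := by positivity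
    linarith

/-- The bound for the number of terms in `IsScale.abs_momentFun_edgeMain_sub_le`. -/
def wordBound (q : ℕ) (K : ℝ) (D : ℕ) : ℝ :=
  ∑ F ∈ Finset.Icc 1 D, K ^ F * F.factorial * ((q : ℝ) ^ F * 2 ^ (q + D))

theorem card_finsuppAntidiag_le {q D n : ℕ} {e : Finset ℕ} (he : e.card = q) (hn : n ≤ D) :
    ((e.finsuppAntidiag n).card : ℝ) ≤ 2 ^ (q + D) := by
  rw [Finset.card_finsuppAntidiag_nat_eq_choose, he]
  have h1 : (q + n - 1).choose n ≤ 2 ^ (q + D) :=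
    (Nat.choose_le_two_pow _ _).trans (Nat.pow_le_pow_right (by norm_num) (by omega))
  exact_mod_cast h1

theorem finsupp_apply_le_degree (f : ℕ →₀ ℕ) (z : ℕ) : f z ≤ f.degree :=
  Finsupp.le_degree z f

/-- The contribution of one hyperedge to the recurrence. -/
theorem IsScale.abs_momentFun_edgeMain_sub_le {q N : ℕ} {p K : ℝ} (h : IsScale q N p K) {D V : ℕ}
    {X : ℕ → ℝ} (hX : ∀ F, |X F| ≤ K ^ F * F.factorial) {S : ℕ → ℕ → ℝ}
    (hS : ∀ u, S u 0 = if u = 0 then 1 else 0) {e : Finset ℕ} (he : e ∈ hyperedges N q) {x : ℕ}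
    (hx : x ∈ e) {l r : ℕ} (hl : l ≤ D) (hlV : l ≤ V) (hr : r ≤ V) {Q : EdgePoly}
    (hQ : Q ∈ freeOf none) (hQe : Q ∈ freeOf (some e)) {Λ ε : ℝ} (hε0 : 0 ≤ ε)
    (hε : ∀ F ∈ Finset.Icc 1 l, ∀ f : ℕ →₀ ℕ, f.degree = F → ∀ u ∈ e.finsuppAntidiag (l - F),
      |momentFun (hyperedges N q) (edgeProb q N p) X 0
        ((∏ z ∈ e, vertexFactor ((hyperedges N q).erase e) V (wordCoeff x r f u z) (u z) z) * Q)
        - (∏ z ∈ e, limitFactor S V (wordCoeff x r f u z) (u z)) * Λ| ≤ ε) :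
    |momentFun (hyperedges N q) (edgeProb q N p) X r
        (PowerSeries.coeff l (edgeMain (hyperedges N q) e ⟨x, hx⟩ D) * Q)
      - edgeProb q N p * ((((q - 1).factorial : ℝ) / p) * (momentStep q p X S l r * Λ))|
      ≤ edgeProb q N p * (wordBound q K D * ε) := by
  have hcard := (Finset.mem_powersetCard.1 he).2
  have hp := h.pos
  have hK := h.K_nonneg
  have e1 : (((q - 1).factorial : ℝ) / p) * (momentStep q p X S l r * Λ)
      = ∑ F ∈ Finset.Icc 1 l, X F * wordSum e x F fun j f => if j = x then
        ∑ u ∈ e.finsuppAntidiag (l - F),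
          (∏ z ∈ e, limitFactor S V (wordCoeff x r f u z) (u z)) * Λ else 0 := by
    rw [momentStep_eq_wordSum p X hS l r hx hcard]
    have h0 : ((q - 1).factorial : ℝ) / p * (p / ((q - 1).factorial : ℝ)) = 1 := by
      have := Nat.factorial_ne_zero (q - 1)
      field_simp
    rw [mul_assoc (p / _), ← mul_assoc, h0, one_mul, Finset.sum_mul]
    refine Finset.sum_congr rfl fun F hF => ?_
    rw [Finset.mem_Icc] at hF
    rw [mul_assoc]
    refine congrArg (X F * ·) ?_
    have h1 := map_wordSum (e := e) (x := x) (AddMonoidHom.mulRight Λ) F fun j f =>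
      if j = x then PowerSeries.coeff (l - F)
        (rootSeries S r (f x) * ∏ z ∈ e.erase x, childSeries S (f z)) else 0
    simp only [AddMonoidHom.mulRight_apply] at h1
    rw [h1]
    refine wordSum_congr hx F fun j _ f _ _ => ?_
    split_ifs
    · rw [coeff_rootSeries_mul_prod S hx f (V := V) (by omega) hr, Finset.sum_mul]
    · rw [zero_mul]
  rw [momentFun_coeff_edgeMain_mul he hx hl hlV hQ hQe, e1, ← mul_sub, abs_mul,
    abs_of_nonneg h.prob_nonneg]
  refine mul_le_mul_of_nonneg_left ?_ h.prob_nonneg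
  rw [← Finset.sum_sub_distrib]
  calc _ ≤ ∑ F ∈ Finset.Icc 1 l, K ^ F * F.factorial * ((q : ℝ) ^ F * 2 ^ (q + D)) * ε := by
        refine (Finset.abs_sum_le_sum_abs _ _).trans (Finset.sum_le_sum fun F hF => ?_)
        rw [← mul_sub, wordSum_sub, abs_mul, mul_assoc]
        refine mul_le_mul (hX F) ?_ (abs_nonneg _) (by positivity)
        refine (abs_wordSum_le hx F (ε := 2 ^ (q + D) * ε) (by positivity)
          fun j _ f _ hf => ?_).trans_eq (by rw [hcard, mul_assoc])
        split_ifs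
        · rw [← Finset.sum_sub_distrib]
          refine (Finset.abs_sum_le_sum_abs _ _).trans
            ((Finset.sum_le_card_nsmul _ _ ε fun u hu => hε F hF f hf u hu).trans ?_)
          rw [nsmul_eq_mul]
          exact mul_le_mul_of_nonneg_right (card_finsuppAntidiag_le hcard (by omega)) hε0
        · rw [sub_self, abs_zero]; positivity
    _ ≤ ∑ F ∈ Finset.Icc 1 D, K ^ F * F.factorial * ((q : ℝ) ^ F * 2 ^ (q + D)) * ε :=
        Finset.sum_le_sum_of_subset_of_nonneg (Finset.Icc_subset_Icc_right hl)
          fun _ _ _ => by positivity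
    _ = _ := by rw [wordBound, Finset.sum_mul]

end SparseHypergraph

end

noncomputable section

namespace SparseHypergraph

/-! ### Asymptotic factorization of the moments -/

theorem momentArray_zero_left (q : ℕ) (p : ℝ) (X : ℕ → ℝ) (r : ℕ) :
    momentArray q p X 0 r = if r = 0 then 1 else 0 := by
  split_ifs with h
  · rw [h, momentArray_zero_right, if_pos rfl]
  · rw [momentArray_eq_momentStep _ _ _ _ _ (by omega), momentStep]
    simp

/-- A bound for the entries of the array in a finite window. -/
def arrayBound (S : ℕ → ℕ → ℝ) (D V : ℕ) : ℝ :=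
  ∑ k ∈ Finset.range (D + 1), ∑ v ∈ Finset.range (V + 1), |S k v|

theorem arrayBound_nonneg (S : ℕ → ℕ → ℝ) (D V : ℕ) : 0 ≤ arrayBound S D V :=
  Finset.sum_nonneg fun _ _ => Finset.sum_nonneg fun _ _ => abs_nonneg _

theorem abs_le_arrayBound (S : ℕ → ℕ → ℝ) {D V k v : ℕ} (hk : k ≤ D) (hv : v ≤ V) :
    |S k v| ≤ arrayBound S D V :=
  (Finset.single_le_sum (f := fun v => |S k v|) (fun _ _ => abs_nonneg _)
    (Finset.mem_range.2 (Nat.lt_succ_of_le hv))).trans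
  (Finset.single_le_sum (f := fun k => ∑ v ∈ Finset.range (V + 1), |S k v|)
    (fun _ _ => Finset.sum_nonneg fun _ _ => abs_nonneg _)
    (Finset.mem_range.2 (Nat.lt_succ_of_le hk)))

theorem abs_limitFactor_le (S : ℕ → ℕ → ℝ) {D V k : ℕ} {A : ℝ} {a : ℕ → ℝ} (ha : ∀ v, |a v| ≤ A)
    (hk : k ≤ D) : |limitFactor S V a k| ≤ (V + 1) * (A * arrayBound S D V) := by
  refine (Finset.abs_sum_le_sum_abs _ _).trans ((Finset.sum_le_card_nsmul _ _
    (A * arrayBound S D V) fun v hv => ?_).trans (le_of_eq ?_))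
  · rw [abs_mul]
    exact mul_le_mul (ha v) (abs_le_arrayBound S hk (Nat.lt_succ_iff.1 (Finset.mem_range.1 hv)))
      (abs_nonneg _) ((abs_nonneg _).trans (ha v))
  · rw [Finset.card_range, nsmul_eq_mul]; push_cast; rfl

theorem abs_prod_limitFactor_le (S : ℕ → ℕ → ℝ) {D V : ℕ} {A : ℝ} {a : ℕ → ℕ → ℝ}
    (ha : ∀ y v, |a y v| ≤ A) {k : ℕ → ℕ} {Y : Finset ℕ} (hk : ∀ y ∈ Y, k y ≤ D) {n : ℕ}
    (hn : Y.card ≤ n) :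
    |∏ y ∈ Y, limitFactor S V (a y) (k y)| ≤ (1 + (V + 1) * (A * arrayBound S D V)) ^ n := by
  have hA : 0 ≤ A := (abs_nonneg _).trans (ha 0 0)
  have h0 := arrayBound_nonneg S D V
  rw [Finset.abs_prod]
  refine (Finset.prod_le_prod (g := fun _ => 1 + (V + 1) * (A * arrayBound S D V))
    (fun _ _ => abs_nonneg _) fun y hy =>
    (abs_limitFactor_le S (ha y) (hk y hy)).trans (by linarith)).trans ?_
  rw [Finset.prod_const]
  exact pow_le_pow_right₀ (by linarith [show 0 ≤ (V + 1) * (A * arrayBound S D V) by positivity]) hn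

/-- The expectations of products of closed walks at distinct vertices, with `L` steps in total,
factorize up to an error of order `1 / N`. -/
def FactorizesUpTo (q : ℕ) (p : ℝ) (X : ℕ → ℝ) (V L : ℕ) : Prop :=
  ∀ (n : ℕ) (A : ℝ), ∃ C : ℝ, 0 ≤ C ∧ ∀ N : ℕ, p ≤ N → ∀ Y ⊆ Finset.range N, Y.card ≤ n →
    ∀ k : ℕ → ℕ, ∑ y ∈ Y, k y ≤ L → ∀ a : ℕ → ℕ → ℝ, (∀ y v, |a y v| ≤ A) →
      |momentFun (hyperedges N q) (edgeProb q N p) X 0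
          (∏ y ∈ Y, vertexFactor (hyperedges N q) V (a y) (k y) y)
        - ∏ y ∈ Y, limitFactor (momentArray q p X) V (a y) (k y)| ≤ C / N

/-! ### Induction on the total number of steps -/

section Induction

variable {q : ℕ} {p K : ℝ} {X : ℕ → ℝ} {D V : ℕ}

theorem prod_union_ite {M : Type*} [CommMonoid M] {e Y : Finset ℕ} (hY : ∀ y ∈ Y, y ∉ e)
    (g g' : ℕ → M) : ∏ y ∈ e ∪ Y, (if y ∈ e then g y else g' y) = (∏ z ∈ e, g z) * ∏ y ∈ Y, g' y := by
  rw [Finset.prod_union (Finset.disjoint_right.2 hY)]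
  exact congrArg₂ (· * ·) (Finset.prod_congr rfl fun z hz => if_pos hz)
    (Finset.prod_congr rfl fun y hy => if_neg (hY y hy))

theorem sum_union_ite {e Y : Finset ℕ} (hY : ∀ y ∈ Y, y ∉ e)
    (g g' : ℕ → ℕ) : ∑ y ∈ e ∪ Y, (if y ∈ e then g y else g' y) = (∑ z ∈ e, g z) + ∑ y ∈ Y, g' y := by
  rw [Finset.sum_union (Finset.disjoint_right.2 hY)]
  exact congrArg₂ (· + ·) (Finset.sum_congr rfl fun z hz => if_pos hz)
    (Finset.sum_congr rfl fun y hy => if_neg (hY y hy))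

/-- After a word of `F ≥ 1` steps at most `L` steps are left, distributed over the distinct vertices
of `e ∪ Y`, so the induction hypothesis applies to them. It concerns the full hypergraph; putting
`e` back costs `O(1 / N)`. -/
theorem exists_word_bound (h2 : 2 ≤ q) (hp : 0 < p) (hK : 1 ≤ K)
    (hX : ∀ F, |X F| ≤ K ^ F * F.factorial) (hDV : D ≤ V) {L : ℕ} (hL : L + 1 ≤ D)
    (ih : FactorizesUpTo q p X V L) (n : ℕ) (A : ℝ) :
    ∃ C : ℝ, 0 ≤ C ∧ ∀ N : ℕ, p ≤ N → ∀ Y ⊆ Finset.range N, Y.card ≤ n → ∀ k : ℕ → ℕ,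
      ∀ l, l + ∑ y ∈ Y, k y ≤ L + 1 → ∀ a : ℕ → ℕ → ℝ, (∀ y v, |a y v| ≤ A) →
      ∀ e ∈ hyperedges N q, (∀ y ∈ Y, y ∉ e) → ∀ x r, r ≤ V → ∀ F ∈ Finset.Icc 1 l,
      ∀ f : ℕ →₀ ℕ, f.degree = F → ∀ u ∈ e.finsuppAntidiag (l - F),
      |momentFun (hyperedges N q) (edgeProb q N p) X 0
        ((∏ z ∈ e, vertexFactor ((hyperedges N q).erase e) V (wordCoeff x r f u z) (u z) z)
          * ∏ y ∈ Y, vertexFactor ((hyperedges N q).erase e) V (a y) (k y) y)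
        - (∏ z ∈ e, limitFactor (momentArray q p X) V (wordCoeff x r f u z) (u z))
          * ∏ y ∈ Y, limitFactor (momentArray q p X) V (a y) (k y)| ≤ C / N := by
  -- The vertices of `e` join `Y`, and the coefficients `wordCoeff` join `a`; therefore
  -- factorization is assumed for all `n` and `A` at once.
  obtain ⟨C₁, hC₁, ih⟩ := ih (n + q) (max A (2 ^ (V + V)))
  refine ⟨C₁ + |prodConst q p K D V (max A (2 ^ (V + V))) (n + q)
    * (2 * (q * walkConst q p K D) ^ 2 * (K * p))|, by positivity, ?_⟩
  intro N hN Y hY hn k l hl a ha e he heY x r hr F hF f hf u hu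
  rw [Finset.mem_Icc] at hF
  have h : IsScale q N p K := ⟨h2, hp, hN, hK⟩
  have hNpos := h.N_pos
  obtain ⟨heN, hecard⟩ := Finset.mem_powersetCard.1 he
  have hun : ∑ z ∈ e, u z = l - F := (Finset.mem_finsuppAntidiag.1 hu).1
  have hsupp := (Finset.mem_finsuppAntidiag.1 hu).2
  have huz : ∀ z, u z ≤ V := fun z => by
    by_cases hz : z ∈ e
    · have := Finset.single_le_sum (f := fun z => u z) (fun _ _ => Nat.zero_le _) hz
      omega
    · rw [Finsupp.notMem_support_iff.1 fun h' => hz (hsupp h')]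
      exact Nat.zero_le _
  set a' : ℕ → ℕ → ℝ := fun y => if y ∈ e then wordCoeff x r f u y else a y
  set k' : ℕ → ℕ := fun y => if y ∈ e then u y else k y
  have ha' : ∀ y v, |a' y v| ≤ max A (2 ^ (V + V)) := fun y v => by
    by_cases hy : y ∈ e
    · simp only [a', if_pos hy]
      refine (abs_wordCoeff_le (d := V) (fun z => ?_) hr huz y v).trans (le_max_right _ _)
      have := finsupp_apply_le_degree f z
      omega
    · simp only [a', if_neg hy]
      exact (ha y v).trans (le_max_left _ _)
  have hcard : (e ∪ Y).card ≤ n + q := (Finset.card_union_le _ _).trans (by omega)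
  have hsum : ∑ y ∈ e ∪ Y, k' y ≤ L := by
    rw [sum_union_ite heY, hun]; omega
  have e1 : ∀ H : Finset (Finset ℕ), ∏ y ∈ e ∪ Y, vertexFactor H V (a' y) (k' y) y
      = (∏ z ∈ e, vertexFactor H V (wordCoeff x r f u z) (u z) z)
          * ∏ y ∈ Y, vertexFactor H V (a y) (k y) y := fun H => by
    rw [← prod_union_ite heY]
    refine Finset.prod_congr rfl fun y _ => ?_
    by_cases hy : y ∈ e
    · simp only [a', k', if_pos hy]
    · simp only [a', k', if_neg hy]
  have e2 : ∏ y ∈ e ∪ Y, limitFactor (momentArray q p X) V (a' y) (k' y)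
      = (∏ z ∈ e, limitFactor (momentArray q p X) V (wordCoeff x r f u z) (u z))
          * ∏ y ∈ Y, limitFactor (momentArray q p X) V (a y) (k y) := by
    rw [← prod_union_ite heY]
    refine Finset.prod_congr rfl fun y _ => ?_
    by_cases hy : y ∈ e
    · simp only [a', k', if_pos hy]
    · simp only [a', k', if_neg hy]
  have b1 := ih N hN (e ∪ Y) (Finset.union_subset heN hY) hcard k' hsum a' ha'
  have b2 := h.abs_momentFun_prod_erase_sub_le (D := D) (V := V) hX ha' (k := k') (Y := e ∪ Y)
    (by omega) hcard he 0
  rw [abs_sub_comm] at b2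
  rw [← e1, ← e2, add_div]
  refine (abs_sub_le _ _ _).trans ((add_le_add b2 b1).trans ?_)
  rw [add_comm]
  gcongr
  exact le_abs_self _

/-- The walk at `x` is split by the hyperedge of its first step. A hyperedge that avoids `Y`
contributes `c * T` up to `O(c / N)`, where `T` does not depend on it; those that meet `Y` are too
rare to matter; and the number of hyperedges at `x` turns the sum of `c * T` into the recurrence. -/
theorem exists_root_bound (h2 : 2 ≤ q) (hp : 0 < p) (hK : 1 ≤ K)
    (hX : ∀ F, |X F| ≤ K ^ F * F.factorial) (hDV : D ≤ V) {L : ℕ} (hL : L + 1 ≤ D)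
    (ih : FactorizesUpTo q p X V L) (n : ℕ) {A : ℝ} (hA : 0 ≤ A) :
    ∃ C : ℝ, 0 ≤ C ∧ ∀ N : ℕ, p ≤ N → ∀ Y ⊆ Finset.range N, Y.card ≤ n → ∀ k : ℕ → ℕ,
      ∀ l, 1 ≤ l → l + ∑ y ∈ Y, k y ≤ L + 1 → ∀ a : ℕ → ℕ → ℝ, (∀ y v, |a y v| ≤ A) →
      ∀ x ∈ Finset.range N, x ∉ Y → ∀ r, 1 ≤ r → r ≤ V →
      |momentFun (hyperedges N q) (edgeProb q N p) X 0
        (closedWalk edgeVar (hyperedges N q) x l r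
          * ∏ y ∈ Y, vertexFactor (hyperedges N q) V (a y) (k y) y)
        - momentArray q p X l r * ∏ y ∈ Y, limitFactor (momentArray q p X) V (a y) (k y)|
      ≤ C / N := by
  obtain ⟨C₁, hC₁, hword⟩ := exists_word_bound h2 hp hK hX hDV hL ih n A
  set S := momentArray q p X with hSdef
  set M := arrayBound S D V * (1 + (V + 1) * (A * arrayBound S D V)) ^ n with hM
  set G := |goodEdgeConst q p K D V A n| + |wordBound q K D| * C₁
  set B := |factorConst q p K D V A ^ n * (q * walkConst q p K D * K)|
    + ((q - 1).factorial / p) * M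
  have hS0 := arrayBound_nonneg S D V
  have hM0 : 0 ≤ M := by positivity
  have hG0 : 0 ≤ G := by positivity
  have hB0 : 0 ≤ B := by positivity
  -- The three summands come from the hyperedges that avoid `Y`, from those through `x` and one of
  -- at most `n` vertices of `Y`, and from the count of the hyperedges at `x`.
  refine ⟨p * G + n * (p * B) + q ^ 2 * M, by positivity, ?_⟩
  intro N hN Y hY hn k l hl1 hl a ha x hx hxY r hr1 hr
  have h : IsScale q N p K := ⟨h2, hp, hN, hK⟩
  have hNpos := h.N_pos
  have hc := h.prob_nonneg
  set c := edgeProb q N p with hcdef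
  have hS : ∀ u, S u 0 = if u = 0 then 1 else 0 := momentArray_zero_right q p X
  have hkY : ∀ y ∈ Y, k y ≤ D := fun y hy =>
    (Finset.single_le_sum (f := k) (fun _ _ => Nat.zero_le _) hy).trans (by omega)
  set Λ := ∏ y ∈ Y, limitFactor S V (a y) (k y)
  set Q := ∏ y ∈ Y, vertexFactor (hyperedges N q) V (a y) (k y) y with hQdef
  have hSΛ : |S l r * Λ| ≤ M := by
    rw [abs_mul]
    exact mul_le_mul (abs_le_arrayBound S (by omega) hr) (abs_prod_limitFactor_le S ha hkY hn)
      (abs_nonneg _) hS0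
  -- Normalized so that `E.card * c * T` is close to `S l r * Λ`.
  set T := ((q - 1).factorial / p : ℝ) * (S l r * Λ)
  have hT : |T| ≤ ((q - 1).factorial / p) * M := by
    rw [abs_mul, abs_of_nonneg (by positivity)]
    gcongr
  have hQ : Q ∈ freeOf none :=
    prod_mem fun y _ => vertexFactor_mem (fun _ _ => by simp) V _ _ y
  rw [momentFun_closedWalk_mul hl1 (by omega) hr hQ]
  set E := (hyperedges N q).filter (x ∈ ·)
  set t : Finset ℕ → ℝ := fun e => momentFun (hyperedges N q) c X r
    (PowerSeries.coeff l (edgeSeries (hyperedges N q) e x) * Q)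
  have hterm : ∀ e ∈ E, |t e - c * T| ≤ c * (G / N) + ∑ y ∈ Y, if y ∈ e then c * B else 0 := by
    intro e heE
    obtain ⟨he, hxe⟩ := Finset.mem_filter.1 heE
    by_cases heY : ∀ y ∈ Y, y ∉ e
    · have hsum0 : ∑ y ∈ Y, (if y ∈ e then c * B else 0) = 0 :=
        Finset.sum_eq_zero fun y hy => if_neg (heY y hy)
      rw [hsum0, add_zero]
      have b1 := h.abs_momentFun_edgeSeries_sub_le (D := D) (V := V) hX ha (k := k) (Y := Y) (l := l)
        (by omega) hn he heY ⟨x, hxe⟩ r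
      have b2 := h.abs_momentFun_edgeMain_sub_le (D := D) (V := V) hX hS he hxe (l := l) (r := r)
        (Q := ∏ y ∈ Y, vertexFactor ((hyperedges N q).erase e) V (a y) (k y) y)
        (Λ := Λ) (ε := C₁ / N) (by omega) (by omega) hr
        (prod_mem fun y _ => vertexFactor_mem (fun _ _ => by simp) V _ _ y)
        (prod_mem fun y _ => vertexFactor_mem (fun e' h' h'' =>
          Finset.ne_of_mem_erase h' (Option.some.inj h'')) V _ _ y) (by positivity)
        (hword N hN Y hY hn k l hl a ha e he heY x r hr)
      rw [← momentArray_eq_momentStep q p X l r hr1] at b2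
      refine (abs_sub_le _ _ _).trans ((add_le_add b1 b2).trans ?_)
      rw [← hcdef]
      calc _ = c * ((goodEdgeConst q p K D V A n + wordBound q K D * C₁) / N) := by ring
        _ ≤ _ := by
          gcongr
          exact add_le_add (le_abs_self _) (mul_le_mul_of_nonneg_right (le_abs_self _) hC₁)
    · push Not at heY
      obtain ⟨y, hy, hye⟩ := heY
      have b1 := h.abs_momentFun_edgeSeries_le (D := D) (V := V) hX ha (k := k) (Y := Y) (l := l)
        (by omega) hn he x r
      have b2 : c * B ≤ ∑ y ∈ Y, if y ∈ e then c * B else 0 := by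
        have := Finset.single_le_sum (f := fun y => if y ∈ e then c * B else 0)
          (fun y _ => by split_ifs <;> positivity) hy
        simpa [hye] using this
      have b3 : |t e - c * T| ≤ c * B := by
        rw [sub_eq_add_neg]
        refine (abs_add_le _ _).trans ?_
        rw [abs_neg, abs_mul, abs_of_nonneg hc, mul_add]
        refine add_le_add (b1.trans ?_) (mul_le_mul_of_nonneg_left hT hc)
        rw [mul_comm]
        exact mul_le_mul_of_nonneg_left (le_abs_self _) hc
      have : 0 ≤ c * (G / N) := by positivity
      linarith
  have hEc : (E.card : ℝ) * c ≤ p := h.card_mul_prob_le x (Finset.Subset.refl _)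
  -- After exchanging the sums, each `y ≠ x` shares with `x` hyperedges of total probability at most
  -- `p / N`.
  have hbad : ∑ e ∈ E, ∑ y ∈ Y, (if y ∈ e then c * B else 0) ≤ n * (p * B) / N := by
    rw [Finset.sum_comm]
    calc _ ≤ ∑ y ∈ Y, p / N * B := Finset.sum_le_sum fun y hy => by
          have hyx : x ≠ y := fun h' => hxY (h' ▸ hy)
          rw [← Finset.sum_filter, Finset.sum_const, nsmul_eq_mul, ← mul_assoc]
          refine mul_le_mul_of_nonneg_right ?_ hB0
          rw [Finset.filter_filter]
          exact h.card_mul_prob_le' hyx (Finset.Subset.refl _)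
      _ ≤ n * (p / N * B) := by
          rw [Finset.sum_const, nsmul_eq_mul]
          gcongr
      _ = _ := by ring
  have hsum : |∑ e ∈ E, t e - E.card * c * T| ≤ p * (G / N) + n * (p * B) / N := by
    have e1 : ∑ e ∈ E, t e - E.card * c * T = ∑ e ∈ E, (t e - c * T) := by
      rw [Finset.sum_sub_distrib, Finset.sum_const, nsmul_eq_mul, mul_assoc]
    rw [e1]
    refine (Finset.abs_sum_le_sum_abs _ _).trans ((Finset.sum_le_sum hterm).trans ?_)
    rw [Finset.sum_add_distrib, Finset.sum_const, nsmul_eq_mul, ← mul_assoc]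
    gcongr
  have hcount : |(E.card : ℝ) * c * T - S l r * Λ| ≤ q ^ 2 / N * M := by
    have e1 : (E.card : ℝ) * c * T - S l r * Λ
        = (E.card * c * ((q - 1).factorial / p) - 1) * (S l r * Λ) := by ring
    rw [e1, abs_mul]
    exact mul_le_mul (h.abs_card_edges_sub_le hx) hSΛ (abs_nonneg _) (by positivity)
  refine (abs_sub_le _ _ _).trans ((add_le_add hsum hcount).trans (le_of_eq ?_))
  ring

/-- Some vertex carries a nonempty walk. Its factor is expanded by the number of returns, and that
vertex serves as the root for `exists_root_bound`. -/
theorem factorizesUpTo_succ (h2 : 2 ≤ q) (hp : 0 < p) (hK : 1 ≤ K)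
    (hX : ∀ F, |X F| ≤ K ^ F * F.factorial) (hDV : D ≤ V) {L : ℕ} (hL : L + 1 ≤ D)
    (ih : FactorizesUpTo q p X V L) : FactorizesUpTo q p X V (L + 1) := by
  intro n A
  by_cases hA : 0 ≤ A
  swap
  · exact ⟨0, le_rfl, fun N _ Y _ _ k _ a ha => absurd ((abs_nonneg _).trans (ha 0 0)) hA⟩
  obtain ⟨C₀, hC₀, ih₀⟩ := ih n A
  obtain ⟨C₁, hC₁, hroot⟩ := exists_root_bound h2 hp hK hX hDV hL ih n hA
  refine ⟨C₀ + (V + 1) * (A * C₁), by positivity, ?_⟩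
  intro N hN Y hY hn k hk a ha
  have hNpos : (0 : ℝ) < N := hp.trans_le hN
  by_cases h0 : ∑ y ∈ Y, k y ≤ L
  · refine (ih₀ N hN Y hY hn k h0 a ha).trans ?_
    gcongr
    exact le_add_of_nonneg_right (by positivity)
  obtain ⟨x, hx, hkx⟩ : ∃ x ∈ Y, 1 ≤ k x := by
    by_contra! hcon
    exact h0 (by rw [Finset.sum_eq_zero fun y hy => by have := hcon y hy; omega]; omega)
  have hterm : ∀ v ∈ Finset.range (V + 1),
      |momentFun (hyperedges N q) (edgeProb q N p) X 0
        (MvPolynomial.C (a x v) * closedWalk edgeVar (hyperedges N q) x (k x) v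
          * ∏ y ∈ Y.erase x, vertexFactor (hyperedges N q) V (a y) (k y) y)
        - a x v * momentArray q p X (k x) v
          * ∏ y ∈ Y.erase x, limitFactor (momentArray q p X) V (a y) (k y)| ≤ A * (C₁ / N) := by
    intro v hv
    rw [mul_assoc, momentFun_C_mul, mul_assoc, ← mul_sub, abs_mul]
    refine mul_le_mul (ha x v) ?_ (abs_nonneg _) hA
    by_cases hv0 : v = 0
    · subst hv0
      -- A nonempty closed walk has at least one return, so both sides vanish.
      rw [closedWalk_zero_right, momentArray_zero_right, if_neg (by omega), if_neg (by omega),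
        zero_mul, zero_mul, map_zero, sub_zero, abs_zero]
      positivity
    · exact hroot N hN (Y.erase x) ((Finset.erase_subset _ _).trans hY)
        (Finset.card_erase_le.trans hn) k (k x) hkx
        (by rw [Finset.add_sum_erase Y k hx]; exact hk) a ha x (hY hx)
        (Finset.notMem_erase x Y) v (by omega)
        (Nat.lt_succ_iff.1 (Finset.mem_range.1 hv))
  rw [← Finset.mul_prod_erase Y _ hx, ← Finset.mul_prod_erase Y _ hx, vertexFactor, limitFactor,
    Finset.sum_mul, Finset.sum_mul, map_sum, ← Finset.sum_sub_distrib]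
  calc _ ≤ ∑ v ∈ Finset.range (V + 1), A * (C₁ / N) :=
        (Finset.abs_sum_le_sum_abs _ _).trans (Finset.sum_le_sum hterm)
    _ = (V + 1) * (A * C₁) / N := by
        rw [Finset.sum_const, Finset.card_range, nsmul_eq_mul]; push_cast; ring
    _ ≤ _ := by
        gcongr
        exact le_add_of_nonneg_left hC₀

theorem factorizesUpTo_zero : FactorizesUpTo q p X V 0 := by
  intro n A
  refine ⟨0, le_rfl, fun N _ Y _ _ k hk a _ => ?_⟩
  have hk0 : ∀ y ∈ Y, k y = 0 := fun y hy =>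
    Nat.le_zero.1 ((Finset.single_le_sum (f := k) (fun _ _ => Nat.zero_le _) hy).trans hk)
  have e1 : ∏ y ∈ Y, vertexFactor (hyperedges N q) V (a y) (k y) y
      = MvPolynomial.C (∏ y ∈ Y, limitFactor (momentArray q p X) V (a y) (k y)) * 1 := by
    rw [map_prod, mul_one]
    refine Finset.prod_congr rfl fun y hy => ?_
    rw [vertexFactor, limitFactor, map_sum, hk0 y hy]
    refine Finset.sum_congr rfl fun v _ => ?_
    rw [closedWalk_zero_left, momentArray_zero_left, map_mul]
    split_ifs <;> simp
  rw [e1, momentFun_C_mul, momentFun_one, mul_one, sub_self, abs_zero, zero_div]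

theorem factorizesUpTo (h2 : 2 ≤ q) (hp : 0 < p) (hK : 1 ≤ K)
    (hX : ∀ F, |X F| ≤ K ^ F * F.factorial) {L : ℕ} (hLV : L ≤ V) :
    FactorizesUpTo q p X V L := by
  induction L with
  | zero => exact factorizesUpTo_zero
  | succ L ih => exact factorizesUpTo_succ h2 hp hK hX hLV le_rfl (ih (by omega))

end Induction

end SparseHypergraph

end

noncomputable section

namespace SparseHypergraph

/-! ### Spectral moments as polynomials in the hyperedge variables -/

theorem trace_pow_eq_sum_eigenvalues {n : Type*} [Fintype n] [DecidableEq n] {A : Matrix n n ℝ}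
    (hA : A.IsHermitian) (t : ℕ) : (A ^ t).trace = ∑ j, hA.eigenvalues j ^ t := by
  conv_lhs => rw [hA.spectral_theorem, ← map_pow, Unitary.conjStarAlgAut_apply,
    Matrix.trace_mul_comm, ← mul_assoc, Unitary.coe_star_mul_self, one_mul, Matrix.diagonal_pow,
    Matrix.trace_diagonal]
  rfl

theorem integral_pow_countingMeasure {N : ℕ} {A : Matrix (Fin N) (Fin N) ℝ} (hA : A.IsHermitian)
    (t : ℕ) : ∫ x, x ^ t ∂(countingMeasure hA) = (N : ℝ)⁻¹ * (A ^ t).trace := by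
  rw [countingMeasure, integral_smul_measure, integral_finsetSum_measure,
    trace_pow_eq_sum_eigenvalues hA, smul_eq_mul, ENNReal.toReal_inv, ENNReal.toReal_natCast]
  · simp
  · exact fun j _ => integrable_dirac (by finiteness)

theorem map_walkPoly {R S : Type*} [CommRing R] [CommRing S] (g : R →+* S) (b : Finset ℕ → R)
    (H : Finset (Finset ℕ)) (j l i : ℕ) :
    g (walkPoly 1 b H j l i) = walkPoly 1 (fun e => g (b e)) H j l i := by
  induction l generalizing i with
  | zero => rw [walkPoly, walkPoly]; split_ifs <;> simp
  | succ l ih =>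
    rw [walkPoly, walkPoly]
    simp only [Pi.one_apply, one_mul, map_sum, map_mul, ih]

theorem walkPoly_congr {R : Type*} [CommRing R] {b b' : Finset ℕ → R} {H : Finset (Finset ℕ)}
    (hb : ∀ e ∈ H, b e = b' e) (j l i : ℕ) : walkPoly 1 b H j l i = walkPoly 1 b' H j l i := by
  induction l generalizing i with
  | zero => rfl
  | succ l ih =>
    rw [walkPoly, walkPoly]
    refine congrArg _ (Finset.sum_congr rfl fun e he => ?_)
    rw [hb e (Finset.mem_filter.1 he).1]
    simp only [ih]

theorem adjMatrix_pow_apply (N q : ℕ) (a d : Finset ℕ → ℝ) (t : ℕ) (i j : Fin N) :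
    (adjMatrix N q a d ^ t) i j
      = walkPoly 1 (fun e => a e * d e) (hyperedges N q) (j : ℕ) t (i : ℕ) := by
  induction t generalizing i with
  | zero =>
    rw [pow_zero, Matrix.one_apply, walkPoly]
    simp only [Fin.ext_iff]
  | succ t ih =>
    have h0 : ∀ m : Fin N, adjMatrix N q a d i m * (adjMatrix N q a d ^ t) m j
        = ∑ e ∈ hyperedges N q, (if (i : ℕ) ∈ e ∧ (m : ℕ) ∈ e ∧ i ≠ m then a e * d e else 0) *
          walkPoly 1 (fun e => a e * d e) (hyperedges N q) (j : ℕ) t (m : ℕ) := fun m => by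
      rw [ih m, ← Finset.sum_mul]; rfl
    rw [pow_succ', Matrix.mul_apply, walkPoly, Pi.one_apply, one_mul,
      Finset.sum_congr rfl fun m _ => h0 m, Finset.sum_comm, Finset.sum_filter]
    refine Finset.sum_congr rfl fun e he => ?_
    have heN := (Finset.mem_powersetCard.1 he).1
    split_ifs with hi
    · rw [Finset.mul_sum]
      have h1 : ∑ m : Fin N, (if (i : ℕ) ∈ e ∧ (m : ℕ) ∈ e ∧ i ≠ m then a e * d e else 0) *
          walkPoly 1 (fun e => a e * d e) (hyperedges N q) (j : ℕ) t (m : ℕ)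
          = ∑ m ∈ Finset.range N, if m ∈ e.erase i then a e * d e *
            walkPoly 1 (fun e => a e * d e) (hyperedges N q) (j : ℕ) t m else 0 := by
        rw [Finset.sum_range]
        refine Finset.sum_congr rfl fun m _ => ?_
        by_cases hm : (m : ℕ) ∈ e.erase i
        · rw [if_pos hm, if_pos]
          rw [Finset.mem_erase] at hm
          exact ⟨hi, hm.2, fun h' => hm.1 (by rw [h'])⟩
        · rw [if_neg hm, if_neg, zero_mul]
          rintro ⟨_, h2, h3⟩
          exact hm (Finset.mem_erase.2 ⟨fun h' => h3 (Fin.ext h'.symm), h2⟩)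
      rw [h1, ← Finset.sum_filter, Finset.filter_mem_eq_inter,
        Finset.inter_eq_right.2 ((Finset.erase_subset _ _).trans heN)]
    · exact Finset.sum_eq_zero fun m _ => by rw [if_neg fun h' => hi h'.1, zero_mul]

/-- The closed walks of length `t` at `x`, as a polynomial in the hyperedge variables. -/
abbrev loopPoly (H : Finset (Finset ℕ)) (t x : ℕ) : EdgePoly := walkPoly 1 edgeVar H x t x

/-- The trace of the `t`-th power of the matrix, as a polynomial in the hyperedge variables. -/
def tracePoly (N q t : ℕ) : EdgePoly := ∑ x ∈ Finset.range N, loopPoly (hyperedges N q) t x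

/-- The values of the variables. -/
def edgeValue (H : Finset (Finset ℕ)) (b : Finset ℕ → ℝ) : Option (Finset ℕ) → ℝ
  | none => 1
  | some e => if e ∈ H then b e else 1

theorem integral_pow_countingMeasure_adjMatrix (N q : ℕ) (a d : Finset ℕ → ℝ) (t : ℕ) :
    ∫ x, x ^ t ∂(countingMeasure (adjMatrix_isHermitian N q a d)) = (N : ℝ)⁻¹ *
      MvPolynomial.eval (edgeValue (hyperedges N q) fun e => a e * d e) (tracePoly N q t) := by
  rw [integral_pow_countingMeasure, Matrix.trace]
  congr 1
  simp only [Matrix.diag_apply, adjMatrix_pow_apply]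
  rw [tracePoly, map_sum, Finset.sum_range]
  refine Finset.sum_congr rfl fun i _ => ?_
  rw [map_walkPoly]
  exact walkPoly_congr (fun e he => by simp [edgeVar, edgeValue, he]) _ _ _

theorem loopPoly_mem_freeOf_none (H : Finset (Finset ℕ)) (t x : ℕ) :
    loopPoly H t x ∈ freeOf none :=
  walkPoly_mem _ (fun _ => one_mem _) (fun _ _ => edgeVar_mem_freeOf (by simp)) _ _ _

theorem tracePoly_mem_freeOf_none (N q t : ℕ) : tracePoly N q t ∈ freeOf none :=
  sum_mem fun x _ => loopPoly_mem_freeOf_none _ t x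

/-! ### Expectations -/

/-- The mixed moments of the variables `b e`, `e ∈ H`, are those of independent products of a
weight and an indicator. -/
def HasEdgeMoments (H : Finset (Finset ℕ)) (c : ℝ) (X : ℕ → ℝ) {Ω : Type*} [MeasurableSpace Ω]
    (μ : Measure Ω) (b : Finset ℕ → Ω → ℝ) : Prop :=
  ∀ m : Finset ℕ → ℕ, Integrable (fun ω => ∏ e ∈ H, b e ω ^ m e) μ ∧
    ∫ ω, ∏ e ∈ H, b e ω ^ m e ∂μ = ∏ e ∈ H, edgeMoment c X (m e)

section Expectation

variable {H : Finset (Finset ℕ)} {c : ℝ} {X : ℕ → ℝ} {Ω : Type*} [MeasurableSpace Ω]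
  {μ : Measure Ω} {b : Finset ℕ → Ω → ℝ}

/-- The value `1` of the marker and of the variables outside `H` makes their exponents irrelevant,
in accordance with `monoMoment`, a product over `H` only. -/
theorem prod_edgeValue_pow (β : Finset ℕ → ℝ) (m : Option (Finset ℕ) →₀ ℕ) :
    (m.prod fun i k => edgeValue H β i ^ k) = ∏ e ∈ H, β e ^ m (some e) := by
  classical
  rw [Finsupp.prod_of_support_subset m (s := m.support ∪ H.image some)
    Finset.subset_union_left _ (fun _ _ => pow_zero _)]
  have h1 : ∏ e ∈ H, β e ^ m (some e)
      = ∏ i ∈ H.image some, edgeValue H β i ^ m i := by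
    rw [Finset.prod_image fun e _ e' _ h => Option.some.inj h]
    exact Finset.prod_congr rfl fun e he => by rw [edgeValue, if_pos he]
  rw [h1]
  refine (Finset.prod_subset Finset.subset_union_right fun i _ hi => ?_).symm
  cases i with
  | none => rw [edgeValue, one_pow]
  | some e =>
    rw [edgeValue, if_neg fun he => hi (Finset.mem_image_of_mem _ he), one_pow]

theorem HasEdgeMoments.integrable_eval (hb : HasEdgeMoments H c X μ b) (P : EdgePoly) :
    Integrable (fun ω => MvPolynomial.eval (edgeValue H fun e => b e ω) P) μ := by
  have h1 : ∀ ω, MvPolynomial.eval (edgeValue H fun e => b e ω) P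
      = ∑ m ∈ P.support, MvPolynomial.coeff m P * ∏ e ∈ H, b e ω ^ m (some e) := fun ω => by
    rw [MvPolynomial.eval_eq]
    exact Finset.sum_congr rfl fun m _ => by rw [← prod_edgeValue_pow]; rfl
  simp only [h1]
  exact integrable_finsetSum _ fun m _ => (hb fun e => m (some e)).1.const_mul _

theorem HasEdgeMoments.integral_eval (hb : HasEdgeMoments H c X μ b) {P : EdgePoly}
    (hP : P ∈ freeOf none) :
    ∫ ω, MvPolynomial.eval (edgeValue H fun e => b e ω) P ∂μ = momentFun H c X 0 P := by
  have h1 : ∀ ω, MvPolynomial.eval (edgeValue H fun e => b e ω) P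
      = ∑ m ∈ P.support, MvPolynomial.coeff m P * ∏ e ∈ H, b e ω ^ m (some e) := fun ω => by
    rw [MvPolynomial.eval_eq]
    exact Finset.sum_congr rfl fun m _ => by rw [← prod_edgeValue_pow]; rfl
  simp only [h1]
  rw [integral_finsetSum _ fun m _ => (hb fun e => m (some e)).1.const_mul _, momentFun_eq_sum]
  refine Finset.sum_congr rfl fun m hm => ?_
  rw [integral_const_mul, (hb fun e => m (some e)).2, monoMoment,
    if_pos (eq_zero_of_mem_freeOf hP hm)]

end Expectation

theorem edgeProb_nonneg {q N : ℕ} {p : ℝ} (hp : 0 < p) : 0 ≤ edgeProb q N p := by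
  rw [edgeProb]; positivity

theorem edgeProb_le_one {q N : ℕ} {p : ℝ} (hq : 2 ≤ q) (hp : 0 < p) (hN : p ≤ N) :
    edgeProb q N p ≤ 1 := IsScale.prob_le_one (K := 1) ⟨hq, hp, hN, le_rfl⟩

/-! ### Realizations of the moment functional by random variables -/

section Model

variable {ν : Measure ℝ} [IsProbabilityMeasure ν] (hν : ∀ k : ℕ, Integrable (fun x : ℝ => x ^ k) ν)

theorem weightMoment_zero : weightMoment ν 0 = 1 := by
  simp [weightMoment]

include hν

/-- A realization of the products of the weights and the indicators on a finite product space. -/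
theorem exists_hasEdgeMoments (H : Finset (Finset ℕ)) {c : ℝ} (hc : 0 ≤ c) (hc1 : c ≤ 1) :
    ∃ (μ : Measure ({e // e ∈ H} → ℝ)) (b : Finset ℕ → ({e // e ∈ H} → ℝ) → ℝ),
      HasEdgeMoments H c (weightMoment ν) μ b := by
  classical
  -- The law of a weight times an independent indicator of probability `c`.
  set ρ : Measure ℝ := ENNReal.ofReal c • ν + ENNReal.ofReal (1 - c) • Measure.dirac 0
  have hprob : IsProbabilityMeasure ρ := ⟨by
    simp only [ρ, Measure.coe_add, Measure.coe_smul, Pi.add_apply, Pi.smul_apply, measure_univ,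
      smul_eq_mul, mul_one]
    rw [← ENNReal.ofReal_add hc (by linarith)]
    simp⟩
  have hint : ∀ k : ℕ, Integrable (fun x : ℝ => x ^ k) ρ := fun k =>
    ((hν k).smul_measure ENNReal.ofReal_ne_top).add_measure
      ((integrable_dirac (by finiteness)).smul_measure ENNReal.ofReal_ne_top)
  have hmom : ∀ k : ℕ, ∫ x, x ^ k ∂ρ = edgeMoment c (weightMoment ν) k := fun k => by
    rw [integral_add_measure ((hν k).smul_measure ENNReal.ofReal_ne_top)
      ((integrable_dirac (by finiteness)).smul_measure ENNReal.ofReal_ne_top),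
      integral_smul_measure, integral_smul_measure, integral_dirac, edgeMoment,
      ENNReal.toReal_ofReal hc, ENNReal.toReal_ofReal (by linarith)]
    by_cases hk : k = 0
    · simp [hk]
    · simp [hk, weightMoment]
  refine ⟨Measure.pi fun _ => ρ, fun e ω => if h : e ∈ H then ω ⟨e, h⟩ else 1, fun m => ?_⟩
  have h1 : ∀ ω : {e // e ∈ H} → ℝ, ∏ e ∈ H, (if h : e ∈ H then ω ⟨e, h⟩ else 1) ^ m e
      = ∏ e : {e // e ∈ H}, ω e ^ m e := fun ω => by
    rw [← Finset.prod_coe_sort]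
    refine Finset.prod_congr rfl fun e _ => ?_
    rw [dif_pos e.2]
  simp only [h1]
  constructor
  · exact Integrable.fintype_prod (f := fun (e : {e // e ∈ H}) (x : ℝ) => x ^ m e)
      fun e => hint (m e)
  · rw [integral_fintype_prod_eq_prod (fun (e : {e // e ∈ H}) (x : ℝ) => x ^ m e),
      ← Finset.prod_coe_sort H fun e => edgeMoment c (weightMoment ν) (m e)]
    exact Finset.prod_congr rfl fun e _ => hmom (m e)

variable {q : ℕ} {p : ℝ} {Ω : Type*} [MeasurableSpace Ω] {μ : Measure Ω} [IsProbabilityMeasure μ]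

/-- The two families separate by independence, and each product of powers then separates further. An
indicator has moment `c` for every positive exponent and `1` for the exponent zero. -/
theorem hasEdgeMoments_mul {H : Finset (Finset ℕ)} {c : ℝ} (hc : 0 ≤ c) (hc1 : c ≤ 1)
    {a d : Finset ℕ → Ω → ℝ} (hma : ∀ e ∈ H, Measurable (a e)) (hmd : ∀ e ∈ H, Measurable (d e))
    (ha : iIndepFun (fun (e : {e // e ∈ H}) ω => a e ω) μ)
    (hd : iIndepFun (fun (e : {e // e ∈ H}) ω => d e ω) μ)
    (hlawa : ∀ e ∈ H, μ.map (a e) = ν)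
    (hlawd : ∀ e ∈ H, μ.map (d e)
      = ENNReal.ofReal c • Measure.dirac 1 + ENNReal.ofReal (1 - c) • Measure.dirac 0)
    (hind : IndepFun (fun ω (e : {e // e ∈ H}) => a e ω) (fun ω (e : {e // e ∈ H}) => d e ω) μ) :
    HasEdgeMoments H c (weightMoment ν) μ (fun e ω => a e ω * d e ω) := by
  intro m
  set fa : Ω → ℝ := fun ω => ∏ e : {e // e ∈ H}, a e ω ^ m e
  set fd : Ω → ℝ := fun ω => ∏ e : {e // e ∈ H}, d e ω ^ m e
  have hsplit : ∀ ω, ∏ e ∈ H, (a e ω * d e ω) ^ m e = fa ω * fd ω := fun ω => by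
    rw [← Finset.prod_coe_sort, ← Finset.prod_mul_distrib]
    exact Finset.prod_congr rfl fun e _ => mul_pow _ _ _
  have hφ : Measurable fun y : {e // e ∈ H} → ℝ => ∏ e : {e // e ∈ H}, y e ^ m e :=
    Finset.measurable_fun_prod _ fun e _ => (measurable_pi_apply e).pow_const _
  have hind' : IndepFun fa fd μ := hind.comp hφ hφ
  have hlawd' : ∀ e : {e // e ∈ H}, μ.map (d e)
      = ENNReal.ofReal c • Measure.dirac 1 + ENNReal.ofReal (1 - c) • Measure.dirac 0 :=
    fun e => hlawd e e.2
  have hinta : ∀ e : {e // e ∈ H}, Integrable (fun x : ℝ => x ^ m e) (μ.map (a e)) := fun e => by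
    rw [hlawa e e.2]; exact hν _
  have hintd : ∀ e : {e // e ∈ H}, Integrable (fun x : ℝ => x ^ m e) (μ.map (d e)) := fun e => by
    rw [hlawd' e]
    exact ((integrable_dirac (by finiteness)).smul_measure ENNReal.ofReal_ne_top).add_measure
      ((integrable_dirac (by finiteness)).smul_measure ENNReal.ofReal_ne_top)
  have hprod : ∀ (b : {e // e ∈ H} → Ω → ℝ), (∀ e, Measurable (b e)) → iIndepFun b μ →
      (∀ e : {e // e ∈ H}, Integrable (fun x : ℝ => x ^ m e) (μ.map (b e))) →
      Integrable (fun ω => ∏ e, b e ω ^ m e) μ := fun b hmb hb hint => by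
    have hpm : ∀ e, IsProbabilityMeasure (μ.map (b e)) := fun e =>
      Measure.isProbabilityMeasure_map (hmb e).aemeasurable
    have h1 := Integrable.fintype_prod (f := fun (e : {e // e ∈ H}) (x : ℝ) => x ^ m e) hint
    rw [← hb.map_fun_eq_pi_map fun e => (hmb e).aemeasurable] at h1
    exact h1.comp_measurable (measurable_pi_lambda _ hmb)
  have hIa := hprod (fun e => a e) (fun e => hma e e.2) ha hinta
  have hId := hprod (fun e => d e) (fun e => hmd e e.2) hd hintd
  simp only [hsplit]
  refine ⟨hind'.integrable_mul hIa hId, ?_⟩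
  rw [hind'.integral_fun_mul_eq_mul_integral hIa.aestronglyMeasurable hId.aestronglyMeasurable]
  have e1 : ∫ ω, fa ω ∂μ = ∏ e : {e // e ∈ H}, weightMoment ν (m e) := by
    refine (ha.integral_fun_prod_comp (f := fun (e : {e // e ∈ H}) x => x ^ m e) (fun e => (hma e e.2).aemeasurable)
      fun e => (hinta e).aestronglyMeasurable).trans (Finset.prod_congr rfl fun e _ => ?_)
    rw [weightMoment, ← hlawa e e.2, integral_map (hma e e.2).aemeasurable
      (hinta e).aestronglyMeasurable]
  have e2 : ∫ ω, fd ω ∂μ = ∏ e : {e // e ∈ H}, (if m e = 0 then 1 else c) := by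
    refine (hd.integral_fun_prod_comp (f := fun (e : {e // e ∈ H}) x => x ^ m e) (fun e => (hmd e e.2).aemeasurable)
      fun e => (hintd e).aestronglyMeasurable).trans (Finset.prod_congr rfl fun e _ => ?_)
    rw [← integral_map (f := fun x : ℝ => x ^ m e) (hmd e e.2).aemeasurable
      (hintd e).aestronglyMeasurable, hlawd' e,
      integral_add_measure ((integrable_dirac (by finiteness)).smul_measure ENNReal.ofReal_ne_top)
      ((integrable_dirac (by finiteness)).smul_measure ENNReal.ofReal_ne_top),
      integral_smul_measure, integral_smul_measure, integral_dirac, integral_dirac,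
      ENNReal.toReal_ofReal hc, ENNReal.toReal_ofReal (by linarith)]
    split_ifs with h0
    · simp [h0]
    · simp [h0]
  rw [e1, e2, ← Finset.prod_mul_distrib,
    ← Finset.prod_coe_sort H fun e => edgeMoment c (weightMoment ν) (m e)]
  refine Finset.prod_congr rfl fun e _ => ?_
  rw [edgeMoment]
  split_ifs with h0
  · rw [h0, weightMoment_zero, mul_one]
  · ring

theorem IsModel.hasEdgeMoments {a : Finset ℕ → Ω → ℝ} {d : ℕ → Finset ℕ → Ω → ℝ}
    (hM : IsModel μ q p ν a d) (hq : 2 ≤ q) (hp : 0 < p) {N : ℕ}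
    (hN : p ≤ N) : HasEdgeMoments (hyperedges N q) (edgeProb q N p) (weightMoment ν) μ
      (fun e ω => a e ω * d N e ω) := by
  have hcard : ∀ e ∈ hyperedges N q, e.card = q := fun e he => (Finset.mem_powersetCard.1 he).2
  have hainj : Function.Injective (fun e : {e // e ∈ hyperedges N q} =>
      (⟨e, hcard e e.2⟩ : {e : Finset ℕ // e.card = q})) := fun e e' h =>
    Subtype.ext (congrArg (fun x : {e : Finset ℕ // e.card = q} => (x : Finset ℕ)) h)
  have hφ : Measurable fun (y : {e : Finset ℕ // e.card = q} → ℝ) (e : {e // e ∈ hyperedges N q}) =>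
      y ⟨e, hcard e e.2⟩ := measurable_pi_lambda _ fun e => measurable_pi_apply _
  have hind := (hM.indep_weight_ind N hN).comp hφ measurable_id
  exact hasEdgeMoments_mul hν (edgeProb_nonneg hp) (edgeProb_le_one hq hp hN)
    (fun e he => hM.measurable_weight e (hcard e he)) (hM.measurable_ind N hN)
    (hM.indep_weight.precomp hainj) (hM.indep_ind N hN)
    (fun e he => hM.law_weight e (hcard e he)) (hM.law_ind N hN)
    hind

end Model

end SparseHypergraph

end

noncomputable section

namespace SparseHypergraph

/-! ### Growth of the moments of the weights -/

/-- Even moments follow from `n ^ n ≤ e ^ n * n!`. Odd moments lie between their even neighbours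
through `|x| ^ (2 * m + 1) ≤ x ^ (2 * m) + x ^ (2 * m + 2)`. -/
theorem exists_weightMoment_bound {ν : Measure ℝ} [IsProbabilityMeasure ν]
    (hν : ∀ k : ℕ, Integrable (fun x : ℝ => x ^ k) ν)
    (hX : ∃ C : ℝ, ∀ m : ℕ, weightMoment ν (2 * m) ≤ (C * m) ^ (2 * m)) :
    ∃ K : ℝ, 1 ≤ K ∧ ∀ F, |weightMoment ν F| ≤ K ^ F * F.factorial := by
  obtain ⟨C, hC⟩ := hX
  set c : ℝ := (|C| + 1) * Real.exp 1 with hc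
  have hexp : 1 ≤ Real.exp 1 := Real.one_le_exp zero_le_one
  have hc1 : 1 ≤ c := one_le_mul_of_one_le_of_one_le (by linarith [abs_nonneg C]) hexp
  have heven : ∀ m : ℕ, weightMoment ν (2 * m) ≤ c ^ (2 * m) * (2 * m).factorial := fun m => by
    refine (hC m).trans ?_
    have h1 : ((2 * m : ℕ) : ℝ) ^ (2 * m) ≤ Real.exp 1 ^ (2 * m) * (2 * m).factorial := by
      have h2 := Real.pow_div_factorial_le_exp ((2 * m : ℕ) : ℝ) (Nat.cast_nonneg _) (2 * m)
      rw [div_le_iff₀ (by positivity)] at h2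
      rwa [← Real.exp_nat_mul, mul_one]
    have h3 : (C * m) ^ (2 * m) ≤ ((|C| + 1) * (2 * m : ℕ)) ^ (2 * m) := by
      rw [← Even.pow_abs (even_two_mul m), abs_mul, Nat.abs_cast]
      refine pow_le_pow_left₀ (by positivity) ?_ _
      push_cast
      have h4 : (0 : ℝ) ≤ m := Nat.cast_nonneg m
      nlinarith [abs_nonneg C]
    refine h3.trans ?_
    rw [mul_pow, hc, mul_pow, mul_assoc]
    gcongr
  have hnn : ∀ m : ℕ, 0 ≤ weightMoment ν (2 * m) := fun m =>
    integral_nonneg fun x => (even_two_mul m).pow_nonneg x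
  have hc0 : 0 ≤ c := zero_le_one.trans hc1
  have hcc : c ≤ 4 * c ^ 2 := by nlinarith
  -- For odd `F` the square absorbs the shift of the exponent of `c`, and the `4` absorbs `(F + 1)!
  -- ≤ 2 ^ F * F!` together with the sum of two terms.
  refine ⟨4 * c ^ 2, by nlinarith, fun F => ?_⟩
  rcases Nat.even_or_odd' F with ⟨m, rfl | rfl⟩
  · rw [abs_of_nonneg (hnn m)]
    refine (heven m).trans ?_
    gcongr
  · have h1 : |weightMoment ν (2 * m + 1)| ≤ weightMoment ν (2 * m) + weightMoment ν (2 * (m + 1)) := by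
      rw [weightMoment, weightMoment, weightMoment, ← integral_add (hν _) (hν _)]
      refine (abs_integral_le_integral_abs).trans
        (integral_mono (hν _).abs ((hν _).add (hν _)) fun x => ?_)
      have h2 : |x ^ (2 * m + 1)| = (x ^ 2) ^ m * |x| := by
        rw [pow_succ, pow_mul, abs_mul, abs_of_nonneg (by positivity)]
      have h3 : x ^ (2 * m) + x ^ (2 * (m + 1)) = (x ^ 2) ^ m * (1 + |x| ^ 2) := by
        rw [pow_mul, pow_mul, pow_succ, sq_abs]; ring
      change |x ^ (2 * m + 1)| ≤ x ^ (2 * m) + x ^ (2 * (m + 1))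
      rw [h2, h3]
      refine mul_le_mul_of_nonneg_left ?_ (by positivity)
      nlinarith [sq_nonneg (|x| - 1)]
    refine h1.trans ((add_le_add (heven m) (heven (m + 1))).trans ?_)
    set f : ℝ := ((2 * m + 1).factorial : ℝ)
    have hf0 : 0 ≤ f := Nat.cast_nonneg _
    have hf1 : ((2 * m).factorial : ℝ) ≤ f := by
      exact Nat.cast_le.2 (Nat.factorial_le (Nat.le_succ _))
    have hf2 : ((2 * (m + 1)).factorial : ℝ) ≤ 2 ^ (2 * m + 1) * f := by
      have h4 : (2 * (m + 1)).factorial = (2 * m + 2) * (2 * m + 1).factorial := by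
        rw [show 2 * (m + 1) = 2 * m + 1 + 1 by ring, Nat.factorial_succ]
      have h5 : 2 * m + 2 ≤ 2 ^ (2 * m + 1) := Nat.lt_two_pow_self (n := 2 * m + 1)
      rw [h4]
      push_cast
      refine mul_le_mul_of_nonneg_right ?_ hf0
      exact_mod_cast h5
    have hp1 : c ^ (2 * m) ≤ (c ^ 2) ^ (2 * m + 1) := by
      rw [← pow_mul]; exact pow_le_pow_right₀ hc1 (by omega)
    have hp2 : c ^ (2 * (m + 1)) ≤ (c ^ 2) ^ (2 * m + 1) := by
      rw [← pow_mul]; exact pow_le_pow_right₀ hc1 (by omega)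
    have hp3 : (1 : ℝ) + 2 ^ (2 * m + 1) ≤ 4 ^ (2 * m + 1) := by
      have h6 : (1 : ℝ) ≤ 2 ^ (2 * m) := one_le_pow₀ (by norm_num)
      have h7 : (4 : ℝ) ^ (2 * m + 1) = 2 ^ (2 * m + 1) * 2 ^ (2 * m + 1) := by
        rw [← mul_pow]; norm_num
      rw [h7, pow_succ]
      nlinarith
    calc _ ≤ (c ^ 2) ^ (2 * m + 1) * f + (c ^ 2) ^ (2 * m + 1) * (2 ^ (2 * m + 1) * f) := by gcongr
      _ = (1 + 2 ^ (2 * m + 1)) * ((c ^ 2) ^ (2 * m + 1) * f) := by ring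
      _ ≤ 4 ^ (2 * m + 1) * ((c ^ 2) ^ (2 * m + 1) * f) := by gcongr
      _ = _ := by clear_value c; rw [mul_pow]; ring

/-! ### One and two closed walks -/

/-- The coefficients that select the closed walks with at most `t / 2` returns. -/
def loopCoeff (t v : ℕ) : ℝ := if 2 * v ≤ t then 1 else 0

theorem abs_loopCoeff_le (t v : ℕ) : |loopCoeff t v| ≤ 1 := by
  unfold loopCoeff; split_ifs <;> simp

theorem loopPoly_eq_vertexFactor (H : Finset (Finset ℕ)) {t V : ℕ} (hV : t ≤ V) (x : ℕ) :
    loopPoly H t x = vertexFactor H V (loopCoeff t) t x := by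
  rw [loopPoly, walkPoly_one_self edgeVar H x t (V := V) (by omega), vertexFactor]
  refine Finset.sum_congr rfl fun v _ => ?_
  rw [loopCoeff]
  split_ifs with h
  · rw [map_one, one_mul]
  · rw [map_zero, zero_mul, closedWalk_eq_zero edgeVar H x (by omega)]

theorem limitFactor_loopCoeff (q : ℕ) (p : ℝ) (X : ℕ → ℝ) {t V : ℕ} (hV : t ≤ V) :
    limitFactor (momentArray q p X) V (loopCoeff t) t = limitMoment q p X t := by
  rw [limitMoment, limitFactor]
  symm
  refine Finset.sum_subset_zero_on_sdiff (Finset.range_subset_range.2 (by omega))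
    (fun v hv => ?_) fun v hv => ?_
  · rw [Finset.mem_sdiff, Finset.mem_range, Finset.mem_range] at hv
    rw [loopCoeff, if_neg (by omega), zero_mul]
  · rw [Finset.mem_range] at hv
    rw [loopCoeff, if_pos (by omega), one_mul]

theorem loopPoly_edgeDegreeLE {H : Finset (Finset ℕ)} (H' : Finset (Finset ℕ)) (t x : ℕ) :
    EdgeDegreeLE H t (loopPoly H' t x) := by
  rw [loopPoly_eq_vertexFactor H' le_rfl]
  exact vertexFactor_edgeDegreeLE H' t _ t x

/-! ### Limits and covariances of the traces -/

section Loops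

variable {q : ℕ} {p K : ℝ} {X : ℕ → ℝ}

theorem IsScale.abs_momentFun_le_of_mulBound {N : ℕ} (h : IsScale q N p K)
    (hX : ∀ F, |X F| ≤ K ^ F * F.factorial) {D : ℕ} {κ : ℝ} (hκ : 0 ≤ κ) {P : EdgePoly}
    (hP : MulBound (scaleWeight q N p K D) κ P) (hD : EdgeDegreeLE (hyperedges N q) D P) :
    |momentFun (hyperedges N q) (edgeProb q N p) X 0 P| ≤ κ := by
  refine (abs_momentFun_le h.prob_nonneg h.K_nonneg hX 0 hD).trans ?_
  have h1 := hP 1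
  rw [one_mul] at h1
  refine h1.trans (mul_le_of_le_one_right hκ ?_)
  rw [← MvPolynomial.C_1, ← MvPolynomial.monomial_zero', wnorm_monomial]
  simp [monoWeight, edgeDegree, edgeWeight]

theorem IsScale.abs_momentFun_loopPoly_le {N : ℕ} (h : IsScale q N p K)
    (hX : ∀ F, |X F| ≤ K ^ F * F.factorial) (t x : ℕ) :
    |momentFun (hyperedges N q) (edgeProb q N p) X 0 (loopPoly (hyperedges N q) t x)|
      ≤ stepConst q p K t ^ t := by
  have h1 := h.one_le_stepConst (D := t)
  exact h.abs_momentFun_le_of_mulBound hX (by positivity)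
    (h.mulBound_walkPoly isVertexWeight_one (Finset.Subset.refl _) x t x)
    (loopPoly_edgeDegreeLE _ t x)

theorem IsScale.abs_momentFun_loopPoly_mul_le {N : ℕ} (h : IsScale q N p K)
    (hX : ∀ F, |X F| ≤ K ^ F * F.factorial) (s t x y : ℕ) :
    |momentFun (hyperedges N q) (edgeProb q N p) X 0
      (loopPoly (hyperedges N q) s x * loopPoly (hyperedges N q) t y)|
      ≤ stepConst q p K (s + t) ^ s * stepConst q p K (s + t) ^ t := by
  have h1 := h.one_le_stepConst (D := s + t)
  exact h.abs_momentFun_le_of_mulBound hX (by positivity)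
    ((h.mulBound_walkPoly isVertexWeight_one (Finset.Subset.refl _) x s x).mul (by positivity)
      (h.mulBound_walkPoly isVertexWeight_one (Finset.Subset.refl _) y t y))
    ((loopPoly_edgeDegreeLE _ s x).mul (loopPoly_edgeDegreeLE _ t y))

variable (h2 : 2 ≤ q) (hp : 0 < p) (hK : 1 ≤ K) (hX : ∀ F, |X F| ≤ K ^ F * F.factorial)

include h2 hp hK hX

theorem exists_loopPoly_bound (t : ℕ) : ∃ C : ℝ, 0 ≤ C ∧ ∀ N : ℕ, p ≤ N → ∀ x ∈ Finset.range N,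
    |momentFun (hyperedges N q) (edgeProb q N p) X 0 (loopPoly (hyperedges N q) t x)
      - limitMoment q p X t| ≤ C / N := by
  obtain ⟨C, hC, hb⟩ := factorizesUpTo (V := t) h2 hp hK hX (le_refl t) 1 1
  refine ⟨C, hC, fun N hN x hx => ?_⟩
  have h1 := hb N hN {x} (Finset.singleton_subset_iff.2 hx) (by simp) (fun _ => t) (by simp)
    (fun _ => loopCoeff t) fun _ v => abs_loopCoeff_le t v
  rw [Finset.prod_singleton, Finset.prod_singleton, limitFactor_loopCoeff q p X le_rfl,
    ← loopPoly_eq_vertexFactor _ le_rfl] at h1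
  exact h1

theorem exists_loopPoly_mul_bound (s t : ℕ) : ∃ C : ℝ, 0 ≤ C ∧ ∀ N : ℕ, p ≤ N →
    ∀ x ∈ Finset.range N, ∀ y ∈ Finset.range N, x ≠ y →
    |momentFun (hyperedges N q) (edgeProb q N p) X 0
        (loopPoly (hyperedges N q) s x * loopPoly (hyperedges N q) t y)
      - limitMoment q p X s * limitMoment q p X t| ≤ C / N := by
  obtain ⟨C, hC, hb⟩ := factorizesUpTo (V := s + t) h2 hp hK hX (le_refl (s + t)) 2 1
  refine ⟨C, hC, fun N hN x hx y hy hxy => ?_⟩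
  have h1 := hb N hN {x, y} (by simp only [Finset.insert_subset_iff, Finset.singleton_subset_iff]; exact ⟨hx, hy⟩)
    Finset.card_le_two (fun z => if z = x then s else t)
    (by rw [Finset.sum_pair hxy, if_pos rfl, if_neg hxy.symm])
    (fun z => if z = x then loopCoeff s else loopCoeff t) fun z v => by
      split_ifs
      exacts [abs_loopCoeff_le s v, abs_loopCoeff_le t v]
  rw [Finset.prod_pair hxy, Finset.prod_pair hxy] at h1
  simp only [if_true, if_neg hxy.symm] at h1
  rw [limitFactor_loopCoeff q p X (by omega), limitFactor_loopCoeff q p X (by omega),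
    ← loopPoly_eq_vertexFactor _ (by omega), ← loopPoly_eq_vertexFactor _ (by omega)] at h1
  exact h1

theorem exists_covariance_bound (s t : ℕ) : ∃ C : ℝ, 0 ≤ C ∧ ∀ N : ℕ, p ≤ N →
    ∀ x ∈ Finset.range N, ∀ y ∈ Finset.range N,
    |momentFun (hyperedges N q) (edgeProb q N p) X 0
        (loopPoly (hyperedges N q) s x * loopPoly (hyperedges N q) t y)
      - momentFun (hyperedges N q) (edgeProb q N p) X 0 (loopPoly (hyperedges N q) s x)
        * momentFun (hyperedges N q) (edgeProb q N p) X 0 (loopPoly (hyperedges N q) t y)|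
      ≤ C / N + if x = y then C else 0 := by
  obtain ⟨C₁, hC₁, hb₁⟩ := exists_loopPoly_bound h2 hp hK hX s
  obtain ⟨C₂, hC₂, hb₂⟩ := exists_loopPoly_bound h2 hp hK hX t
  obtain ⟨C₃, hC₃, hb₃⟩ := exists_loopPoly_mul_bound h2 hp hK hX s t
  set B₁ := |stepConst q p K s ^ s|
  set B₂ := |stepConst q p K t ^ t|
  set B₃ := |stepConst q p K (s + t) ^ s * stepConst q p K (s + t) ^ t|
  -- The first group serves distinct vertices, where both expectations are compared with the product
  -- of the limits; the second serves `x = y`, where boundedness is all that is used.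
  refine ⟨(C₃ + C₁ * |limitMoment q p X t| + B₁ * C₂) + (B₃ + B₁ * B₂), by positivity, ?_⟩
  intro N hN x hx y hy
  have h : IsScale q N p K := ⟨h2, hp, hN, hK⟩
  have hNpos := h.N_pos
  set φ := momentFun (hyperedges N q) (edgeProb q N p) X 0
  have b1 : |φ (loopPoly (hyperedges N q) s x)| ≤ B₁ :=
    (h.abs_momentFun_loopPoly_le hX s x).trans (le_abs_self _)
  have b2 : |φ (loopPoly (hyperedges N q) t y)| ≤ B₂ :=
    (h.abs_momentFun_loopPoly_le hX t y).trans (le_abs_self _)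
  split_ifs with hxy
  · have b3 : |φ (loopPoly (hyperedges N q) s x * loopPoly (hyperedges N q) t y)| ≤ B₃ :=
      (h.abs_momentFun_loopPoly_mul_le hX s t x y).trans (le_abs_self _)
    rw [sub_eq_add_neg]
    refine (abs_add_le _ _).trans ?_
    rw [abs_neg, abs_mul]
    have b4 := mul_le_mul b1 b2 (abs_nonneg _) (abs_nonneg _)
    have b5 : 0 ≤ (C₃ + C₁ * |limitMoment q p X t| + B₁ * C₂ + (B₃ + B₁ * B₂)) / N := by positivity
    have b6 : 0 ≤ C₃ + C₁ * |limitMoment q p X t| + B₁ * C₂ := by positivity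
    linarith
  · rw [add_zero]
    have c1 := hb₁ N hN x hx
    have c2 := hb₂ N hN y hy
    have c3 := hb₃ N hN x hx y hy hxy
    set u := φ (loopPoly (hyperedges N q) s x)
    set v := φ (loopPoly (hyperedges N q) t y)
    set w := φ (loopPoly (hyperedges N q) s x * loopPoly (hyperedges N q) t y)
    have e1 : w - u * v = (w - limitMoment q p X s * limitMoment q p X t)
        + (-((u - limitMoment q p X s) * limitMoment q p X t)
          + -(u * (v - limitMoment q p X t))) := by ring
    rw [e1]
    calc _ ≤ C₃ / N + (C₁ / N * |limitMoment q p X t| + B₁ * (C₂ / N)) := by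
          refine (abs_add_le _ _).trans (add_le_add c3 ((abs_add_le _ _).trans (add_le_add ?_ ?_)))
          · rw [abs_neg, abs_mul]
            exact mul_le_mul_of_nonneg_right c1 (abs_nonneg _)
          · rw [abs_neg, abs_mul]
            exact mul_le_mul b1 c2 (abs_nonneg _) (abs_nonneg _)
      _ = (C₃ + C₁ * |limitMoment q p X t| + B₁ * C₂) / N := by ring
      _ ≤ _ := div_le_div_of_nonneg_right (le_add_of_nonneg_right (by positivity)) hNpos.le

theorem exists_tracePoly_covariance_bound (s t : ℕ) : ∃ C : ℝ, ∀ N : ℕ, p ≤ N →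
    |(N : ℝ)⁻¹ * (N : ℝ)⁻¹ * momentFun (hyperedges N q) (edgeProb q N p) X 0
        (tracePoly N q s * tracePoly N q t)
      - ((N : ℝ)⁻¹ * momentFun (hyperedges N q) (edgeProb q N p) X 0 (tracePoly N q s))
        * ((N : ℝ)⁻¹ * momentFun (hyperedges N q) (edgeProb q N p) X 0 (tracePoly N q t))|
      ≤ C / N := by
  obtain ⟨C, hC, hb⟩ := exists_covariance_bound h2 hp hK hX s t
  -- One `C` comes from the `N ^ 2` pairs with error `C / N`, the other from the `N` diagonal pairs
  -- with error `C`, both divided by `N ^ 2`.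
  refine ⟨2 * C, fun N hN => ?_⟩
  have hNpos : (0 : ℝ) < N := hp.trans_le hN
  set φ := momentFun (hyperedges N q) (edgeProb q N p) X 0
  have e1 : (N : ℝ)⁻¹ * (N : ℝ)⁻¹ * φ (tracePoly N q s * tracePoly N q t)
      - ((N : ℝ)⁻¹ * φ (tracePoly N q s)) * ((N : ℝ)⁻¹ * φ (tracePoly N q t))
      = (N : ℝ)⁻¹ * (N : ℝ)⁻¹ * ∑ x ∈ Finset.range N, ∑ y ∈ Finset.range N,
        (φ (loopPoly (hyperedges N q) s x * loopPoly (hyperedges N q) t y)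
          - φ (loopPoly (hyperedges N q) s x) * φ (loopPoly (hyperedges N q) t y)) := by
    simp only [Finset.sum_sub_distrib]
    rw [tracePoly, tracePoly, Finset.sum_mul_sum, map_sum, map_sum, map_sum, ← Finset.sum_mul_sum]
    simp only [map_sum]
    ring
  rw [e1, abs_mul, abs_of_nonneg (by positivity)]
  calc _ ≤ (N : ℝ)⁻¹ * (N : ℝ)⁻¹ * ∑ x ∈ Finset.range N, ∑ y ∈ Finset.range N,
        (C / N + if x = y then C else 0) := by
        refine mul_le_mul_of_nonneg_left ?_ (by positivity)
        refine (Finset.abs_sum_le_sum_abs _ _).trans (Finset.sum_le_sum fun x hx => ?_)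
        exact (Finset.abs_sum_le_sum_abs _ _).trans
          (Finset.sum_le_sum fun y hy => hb N hN x hx y hy)
    _ = (N : ℝ)⁻¹ * (N : ℝ)⁻¹ * ∑ x ∈ Finset.range N, (N * (C / N) + C) := by
        congr 1
        refine Finset.sum_congr rfl fun x hx => ?_
        rw [Finset.sum_add_distrib, Finset.sum_const, Finset.card_range, nsmul_eq_mul,
          Finset.sum_ite_eq, if_pos hx]
    _ = _ := by
        rw [Finset.sum_const, Finset.card_range, nsmul_eq_mul]
        field_simp
        ring

theorem exists_tracePoly_bound (t : ℕ) : ∃ C : ℝ, ∀ N : ℕ, p ≤ N →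
    |(N : ℝ)⁻¹ * momentFun (hyperedges N q) (edgeProb q N p) X 0 (tracePoly N q t)
      - limitMoment q p X t| ≤ C / N := by
  obtain ⟨C, hC, hb⟩ := exists_loopPoly_bound h2 hp hK hX t
  refine ⟨C, fun N hN => ?_⟩
  have hNpos : (0 : ℝ) < N := hp.trans_le hN
  set φ := momentFun (hyperedges N q) (edgeProb q N p) X 0
  have e1 : (N : ℝ)⁻¹ * φ (tracePoly N q t) - limitMoment q p X t
      = (N : ℝ)⁻¹ * ∑ x ∈ Finset.range N,
        (φ (loopPoly (hyperedges N q) t x) - limitMoment q p X t) := by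
    rw [Finset.sum_sub_distrib, Finset.sum_const, Finset.card_range, nsmul_eq_mul, tracePoly,
      map_sum, mul_sub]
    field_simp
  rw [e1, abs_mul, abs_of_nonneg (by positivity)]
  calc _ ≤ (N : ℝ)⁻¹ * ∑ x ∈ Finset.range N, C / N := by
        refine mul_le_mul_of_nonneg_left ?_ (by positivity)
        exact (Finset.abs_sum_le_sum_abs _ _).trans (Finset.sum_le_sum fun x hx => hb N hN x hx)
    _ = _ := by
        rw [Finset.sum_const, Finset.card_range, nsmul_eq_mul]
        field_simp

theorem tendsto_tracePoly (t : ℕ) : Tendsto (fun N : ℕ => (N : ℝ)⁻¹ *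
    momentFun (hyperedges N q) (edgeProb q N p) X 0 (tracePoly N q t)) atTop
    (𝓝 (limitMoment q p X t)) := by
  obtain ⟨C, hC⟩ := exists_tracePoly_bound h2 hp hK hX t
  rw [tendsto_iff_norm_sub_tendsto_zero]
  refine squeeze_zero' (Eventually.of_forall fun N => norm_nonneg _) ?_
    (tendsto_const_div_atTop_nhds_zero_nat C)
  filter_upwards [eventually_ge_atTop ⌈p⌉₊] with N hN
  exact hC N (Nat.ceil_le.1 hN)

/-- The bound for walks of `t` steps is uniform in `N` and passes to the limit. Taking `D = t` keeps
the cost of a step linear in `t`, which is what Carleman's condition needs. -/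
theorem abs_limitMoment_le (t : ℕ) : |limitMoment q p X t| ≤ stepConst q p K t ^ t := by
  refine le_of_tendsto (tendsto_tracePoly h2 hp hK hX t).abs ?_
  filter_upwards [eventually_ge_atTop ⌈p⌉₊] with N hN
  have hN' : p ≤ N := Nat.ceil_le.1 hN
  have h : IsScale q N p K := ⟨h2, hp, hN', hK⟩
  have hNpos := h.N_pos
  rw [abs_mul, abs_of_nonneg (by positivity), tracePoly, map_sum, inv_mul_le_iff₀ hNpos]
  refine (Finset.abs_sum_le_sum_abs _ _).trans ((Finset.sum_le_card_nsmul _ _ _ fun x _ =>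
    h.abs_momentFun_loopPoly_le hX t x).trans (le_of_eq ?_))
  rw [Finset.card_range, nsmul_eq_mul]

end Loops

end SparseHypergraph

end

noncomputable section

namespace SparseHypergraph

/-! ### Spectral moments -/

section Spectral

variable {Ω : Type*} {q : ℕ} {p : ℝ} {X : ℕ → ℝ} {a : Finset ℕ → Ω → ℝ}
  {d : ℕ → Finset ℕ → Ω → ℝ} {N : ℕ} {c : ℝ}

theorem spectralMoment_eq (t : ℕ) (ω : Ω) : spectralMoment q a d N t ω = (N : ℝ)⁻¹ *
    MvPolynomial.eval (edgeValue (hyperedges N q) fun e => a e ω * d N e ω) (tracePoly N q t) :=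
  integral_pow_countingMeasure_adjMatrix N q _ _ t

theorem spectralMoment_mul_eq (s t : ℕ) (ω : Ω) :
    spectralMoment q a d N s ω * spectralMoment q a d N t ω = (N : ℝ)⁻¹ * (N : ℝ)⁻¹ *
    MvPolynomial.eval (edgeValue (hyperedges N q) fun e => a e ω * d N e ω)
      (tracePoly N q s * tracePoly N q t) := by
  rw [spectralMoment_eq, spectralMoment_eq, map_mul]
  ring

variable [MeasurableSpace Ω] {μ : Measure Ω}
  (hb : HasEdgeMoments (hyperedges N q) c X μ fun e ω => a e ω * d N e ω)

include hb

theorem HasEdgeMoments.integrable_spectralMoment (t : ℕ) :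
    Integrable (spectralMoment q a d N t) μ := by
  have h1 : spectralMoment q a d N t = fun ω => (N : ℝ)⁻¹ * MvPolynomial.eval
      (edgeValue (hyperedges N q) fun e => a e ω * d N e ω) (tracePoly N q t) :=
    funext fun ω => spectralMoment_eq t ω
  rw [h1]
  exact (hb.integrable_eval _).const_mul _

theorem HasEdgeMoments.expectedMoment_eq (t : ℕ) :
    expectedMoment μ q a d N t
      = (N : ℝ)⁻¹ * momentFun (hyperedges N q) c X 0 (tracePoly N q t) := by
  simp only [expectedMoment, spectralMoment_eq]
  rw [integral_const_mul, hb.integral_eval (tracePoly_mem_freeOf_none N q t)]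

theorem HasEdgeMoments.integrable_spectralMoment_mul (s t : ℕ) :
    Integrable (fun ω => spectralMoment q a d N s ω * spectralMoment q a d N t ω) μ := by
  simp only [spectralMoment_mul_eq]
  exact (hb.integrable_eval _).const_mul _

theorem HasEdgeMoments.correlator_eq (s t : ℕ) :
    correlator μ q a d N s t = (N : ℝ)⁻¹ * (N : ℝ)⁻¹ * momentFun (hyperedges N q) c X 0
        (tracePoly N q s * tracePoly N q t)
      - ((N : ℝ)⁻¹ * momentFun (hyperedges N q) c X 0 (tracePoly N q s))
        * ((N : ℝ)⁻¹ * momentFun (hyperedges N q) c X 0 (tracePoly N q t)) := by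
  rw [correlator, hb.expectedMoment_eq, hb.expectedMoment_eq]
  simp only [spectralMoment_mul_eq]
  rw [integral_const_mul, hb.integral_eval
    (mul_mem (tracePoly_mem_freeOf_none N q s) (tracePoly_mem_freeOf_none N q t))]

end Spectral

/-- The functional is an expectation over a finite product space, where the normalized trace of an
even power is an integral of `x ^ (2 * k)`. No model on an ambient space is required. -/
theorem tracePoly_even_nonneg {ν : Measure ℝ} [IsProbabilityMeasure ν]
    (hν : ∀ k : ℕ, Integrable (fun x : ℝ => x ^ k) ν) (N q k : ℕ) {c : ℝ} (hc : 0 ≤ c)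
    (hc1 : c ≤ 1) :
    0 ≤ (N : ℝ)⁻¹ * momentFun (hyperedges N q) c (weightMoment ν) 0 (tracePoly N q (2 * k)) := by
  obtain ⟨μ, b, hb⟩ := exists_hasEdgeMoments hν (hyperedges N q) hc hc1
  rw [← hb.integral_eval (tracePoly_mem_freeOf_none N q _), ← integral_const_mul]
  refine integral_nonneg fun ω => ?_
  have h1 := integral_pow_countingMeasure_adjMatrix N q (fun e => b e ω) (fun _ => 1) (2 * k)
  simp only [mul_one] at h1
  change 0 ≤ (N : ℝ)⁻¹ * MvPolynomial.eval (edgeValue (hyperedges N q) fun e => b e ω) _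
  rw [← h1]
  exact integral_nonneg fun x => (even_two_mul k).pow_nonneg x

/-! ### Carleman's condition -/

theorem tsum_inv_succ_eq_top : ∑' k : ℕ, ENNReal.ofReal (1 / ((k : ℝ) + 1)) = ⊤ := by
  by_contra h
  have h1 := ENNReal.summable_toReal h
  have h2 : (fun k : ℕ => (ENNReal.ofReal (1 / ((k : ℝ) + 1))).toReal)
      = fun k : ℕ => 1 / ((k + 1 : ℕ) : ℝ) := funext fun k => by
    rw [ENNReal.toReal_ofReal (by positivity)]; push_cast; rfl
  rw [h2, summable_nat_add_iff 1 (f := fun k : ℕ => 1 / (k : ℝ))] at h1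
  exact Real.not_summable_one_div_natCast h1

/-- The roots are at most `M * (k + 1)`, so the series dominates a multiple of the harmonic series.
In extended reals a vanishing moment gives an infinite term, as required. -/
theorem carleman_of_le {m : ℕ → ℝ} {M : ℝ} (hM : 0 < M)
    (hm : ∀ k : ℕ, m (2 * (k + 1)) ≤ (M * (k + 1)) ^ (2 * (k + 1))) :
    ∑' k : ℕ, 1 / ENNReal.ofReal (m (2 * (k + 1))) ^ (1 / (2 * ((k : ℝ) + 1))) = ⊤ := by
  have key : ∀ k : ℕ, (ENNReal.ofReal M)⁻¹ * ENNReal.ofReal (1 / ((k : ℝ) + 1))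
      ≤ 1 / ENNReal.ofReal (m (2 * (k + 1))) ^ (1 / (2 * ((k : ℝ) + 1))) := fun k => by
    have hk : (0 : ℝ) < (k : ℝ) + 1 := by positivity
    have h1 : ENNReal.ofReal (m (2 * (k + 1))) ^ (1 / (2 * ((k : ℝ) + 1)))
        ≤ ENNReal.ofReal (M * (k + 1)) := by
      calc _ ≤ ENNReal.ofReal ((M * (k + 1)) ^ (2 * (k + 1))) ^ (1 / (2 * ((k : ℝ) + 1))) :=
            ENNReal.rpow_le_rpow (ENNReal.ofReal_le_ofReal (hm k)) (by positivity)
        _ = _ := by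
            rw [ENNReal.ofReal_pow (by positivity), ← ENNReal.rpow_natCast, ← ENNReal.rpow_mul]
            have h2 : ((2 * (k + 1) : ℕ) : ℝ) * (1 / (2 * ((k : ℝ) + 1))) = 1 := by
              push_cast; field_simp
            rw [h2, ENNReal.rpow_one]
    rw [one_div (ENNReal.ofReal _ ^ _), one_div ((k : ℝ) + 1), ENNReal.ofReal_inv_of_pos hk,
      ← ENNReal.mul_inv (Or.inr ENNReal.ofReal_ne_top) (Or.inl ENNReal.ofReal_ne_top),
      ← ENNReal.ofReal_mul hM.le]
    exact ENNReal.inv_le_inv.2 h1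
  refine top_unique (le_trans ?_ (ENNReal.tsum_le_tsum key))
  rw [ENNReal.tsum_mul_left, tsum_inv_succ_eq_top, ENNReal.mul_top]
  exact ENNReal.inv_ne_zero.2 ENNReal.ofReal_ne_top

/-! ### Hyperedges with one vertex -/

theorem momentArray_one (p : ℝ) (X : ℕ → ℝ) (l : ℕ) {r : ℕ} (hr : 1 ≤ r) :
    momentArray 1 p X l r = 0 := by
  rw [momentArray_eq_momentStep _ _ _ _ _ hr, momentStep]
  refine mul_eq_zero_of_right _ (Finset.sum_eq_zero fun F hF => mul_eq_zero_of_right _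
    (Finset.sum_eq_zero fun ϰ hϰ => Finset.sum_eq_zero fun f hf => ?_))
  rw [Finset.mem_filter] at hf
  obtain rfl : ϰ = 1 := by rw [Finset.mem_Icc] at hϰ; omega
  have hf0 : f ≠ 0 := fun h0 => by
    have := hf.2.1 1 (by simp)
    rw [h0] at this
    simp at this
  rw [walkNumber, if_neg fun h => hf0 h.2]
  simp

theorem limitMoment_one (p : ℝ) (X : ℕ → ℝ) (t : ℕ) :
    limitMoment 1 p X t = if t = 0 then 1 else 0 := by
  rw [limitMoment, Finset.sum_range_succ', Finset.sum_eq_zero fun i _ =>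
    momentArray_one p X t (Nat.le_add_left 1 i), zero_add, momentArray_zero_right]

theorem adjMatrix_one (N : ℕ) (a d : Finset ℕ → ℝ) : adjMatrix N 1 a d = 0 := by
  ext i j
  rw [adjMatrix, Matrix.of_apply, Matrix.zero_apply]
  refine Finset.sum_eq_zero fun e he => if_neg fun h => h.2.2 (Fin.ext ?_)
  obtain ⟨z, rfl⟩ := Finset.card_eq_one.1 (Finset.mem_powersetCard.1 he).2
  rw [Finset.mem_singleton.1 h.1, Finset.mem_singleton.1 h.2.1]

theorem spectralMoment_one {Ω : Type*} (a : Finset ℕ → Ω → ℝ) (d : ℕ → Finset ℕ → Ω → ℝ) {N : ℕ}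
    (hN : 1 ≤ N) (t : ℕ) (ω : Ω) : spectralMoment 1 a d N t ω = if t = 0 then 1 else 0 := by
  have hN0 : (N : ℝ) ≠ 0 := by positivity
  rw [spectralMoment, integral_pow_countingMeasure, adjMatrix_one]
  split_ifs with h
  · rw [h, pow_zero, Matrix.trace_one, Fintype.card_fin, inv_mul_cancel₀ hN0]
  · rw [zero_pow h, Matrix.trace_zero, mul_zero]

theorem spectralMoment_one' {Ω : Type*} (a : Finset ℕ → Ω → ℝ) (d : ℕ → Finset ℕ → Ω → ℝ) {N : ℕ}
    (hN : 1 ≤ N) (t : ℕ) : spectralMoment 1 a d N t = fun _ => if t = 0 then 1 else 0 :=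
  funext fun ω => spectralMoment_one a d hN t ω

end SparseHypergraph

end

/-! ### The main theorem -/

open SparseHypergraph in
theorem theorem2 (q : ℕ) (hq : 1 ≤ q) (p : ℝ) (hp : 0 < p)
    (ν : Measure ℝ) [IsProbabilityMeasure ν]
    (hν : ∀ k : ℕ, Integrable (fun x : ℝ => x ^ k) ν)
    (hX : ∃ C : ℝ, ∀ m : ℕ, weightMoment ν (2 * m) ≤ (C * m) ^ (2 * m)) :
    -- (i)
    (∀ k m : ℕ, ∃ C : ℝ, ∀ (Ω : Type*) [MeasurableSpace Ω] (μ : Measure Ω)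
      [IsProbabilityMeasure μ] (a : Finset ℕ → Ω → ℝ) (d : ℕ → Finset ℕ → Ω → ℝ),
      IsModel μ q p ν a d → ∀ N : ℕ, p ≤ N →
        Integrable (fun ω => spectralMoment q a d N k ω * spectralMoment q a d N m ω) μ ∧
        |correlator μ q a d N k m| ≤ C / N) ∧
    -- (ii)
    (∀ (Ω : Type*) [MeasurableSpace Ω] (μ : Measure Ω)
      [IsProbabilityMeasure μ] (a : Finset ℕ → Ω → ℝ) (d : ℕ → Finset ℕ → Ω → ℝ),
      IsModel μ q p ν a d → ∀ k : ℕ,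
        (∀ N : ℕ, p ≤ N → Integrable (spectralMoment q a d N k) μ) ∧
        Tendsto (fun N : ℕ => expectedMoment μ q a d N k) atTop
          (𝓝 (limitMoment q p (weightMoment ν) k))) ∧
    -- (iii)
    ((∀ k : ℕ, 0 ≤ limitMoment q p (weightMoment ν) (2 * k)) ∧
      ∑' k : ℕ, 1 / ENNReal.ofReal (limitMoment q p (weightMoment ν) (2 * (k + 1))) ^
        (1 / (2 * ((k : ℝ) + 1))) = ⊤) := by
  rcases Nat.lt_or_ge q 2 with hq1 | hq2
  -- A hyperedge with one vertex joins nothing: the matrix is zero and the covariances vanish. The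
  -- general estimates require `q ≥ 2`, since they use pairs of vertices in a hyperedge.
  · obtain rfl : q = 1 := by omega
    have hN1 : ∀ N : ℕ, p ≤ N → 1 ≤ N := fun N hN => by
      have : (0 : ℝ) < N := hp.trans_le hN
      exact_mod_cast this
    refine ⟨fun k m => ⟨0, ?_⟩, ?_, fun k => ?_, ?_⟩
    · intro Ω _ μ _ a d _ N hN
      simp only [correlator, expectedMoment, spectralMoment_one' a d (hN1 N hN)]
      refine ⟨integrable_const _, ?_⟩
      simp
    · intro Ω _ μ _ a d _ k
      refine ⟨fun N hN => ?_, ?_⟩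
      · rw [spectralMoment_one' a d (hN1 N hN)]
        exact integrable_const _
      · refine tendsto_const_nhds.congr' ?_
        filter_upwards [eventually_ge_atTop 1] with N hN
        rw [expectedMoment, spectralMoment_one' a d hN, limitMoment_one]
        simp
    · rw [limitMoment_one]
      split_ifs <;> simp
    · refine carleman_of_le one_pos fun k => ?_
      rw [limitMoment_one, if_neg (by omega)]
      positivity
  obtain ⟨K, hK, hKX⟩ := exists_weightMoment_bound hν hX
  refine ⟨fun k m => ?_, ?_, fun k => ?_, ?_⟩
  · obtain ⟨C, hC⟩ := exists_tracePoly_covariance_bound hq2 hp hK hKX k m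
    refine ⟨C, fun Ω _ μ _ a d hM N hN => ?_⟩
    have hb := hM.hasEdgeMoments hν hq2 hp hN
    refine ⟨hb.integrable_spectralMoment_mul k m, ?_⟩
    rw [hb.correlator_eq]
    exact hC N hN
  · intro Ω _ μ _ a d hM k
    refine ⟨fun N hN => (hM.hasEdgeMoments hν hq2 hp hN).integrable_spectralMoment k, ?_⟩
    refine (tendsto_tracePoly hq2 hp hK hKX k).congr' ?_
    filter_upwards [eventually_ge_atTop ⌈p⌉₊] with N hN
    exact ((hM.hasEdgeMoments hν hq2 hp (Nat.ceil_le.1 hN)).expectedMoment_eq k).symm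
  -- No model is given in this part; the sign comes from the realizations on finite product spaces.
  · refine ge_of_tendsto (tendsto_tracePoly hq2 hp hK hKX (2 * k)) ?_
    filter_upwards [eventually_ge_atTop ⌈p⌉₊] with N hN
    exact tracePoly_even_nonneg hν N q k (edgeProb_nonneg hp)
      (edgeProb_le_one hq2 hp (Nat.ceil_le.1 hN))
  -- With `t = 2 * (k + 1)` the cost of a step is `q * K * (4 * (k + 1) + p + 1)`, and `4 * (k + 1)
  -- + p + 1 ≤ (p + 5) * (k + 1)`.
  · refine carleman_of_le (M := q * K * (p + 5)) (by positivity) fun k => ?_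
    refine (le_abs_self _).trans ((abs_limitMoment_le hq2 hp hK hKX _).trans ?_)
    rw [stepConst, mul_assoc (q * K : ℝ)]
    have hk : (0 : ℝ) ≤ k := Nat.cast_nonneg k
    have h1 : 2 * ((2 * (k + 1) : ℕ) : ℝ) + p + 1 ≤ (p + 5) * (k + 1) := by
      push_cast
      nlinarith
    gcongr
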